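/- Let $\Gamma$ be a finite non-empty graph (symmetric, irreflexive), whose vertices are called colours. Structures are non-empty and are considered in the language with a binary relation for edges and a unary predicate for each colour. A $\Gamma$-graph $M$ is a graph in which each vertex has exactly one colour and adjacent vertices have adjacent colours. A flag of $M$ is a family $F=(f_\gamma)_{\gamma\in\Gamma}$ of vertices, $f_\gamma$ of colour $\gamma$, such that $\gamma\mapsto f_\gamma$ is a graph isomorphism from $\Gamma$ onto the induced subgraph $F$. A $\Gamma$-space is a $\Gamma$-graph in which every vertex lies in a flag and any two adjacent vertices lie in a common flag. A letter is a non-empty connected subset of $\Gamma$; a word is a finite sequence of letters. Letters $s,t$ commute if they are disjoint and there is no edge between them. A word $s_1\cdots s_n$ is reduced if there are no $i\neq j$ such that $s_i\subset s_j$ and $s_i$ commutes with all letters strictly between the positions $i$ and $j$. A splitting of $s$ is a (possibly empty) word whose letters are properly contained in $s$. A weak flag path with word $s_1\cdots s_n$ is a sequence of flags $F_0,\dots,F_n$ such that the set of colours at which $F_{i-1}$ and $F_i$ differ is $s_i$. Write $F\xrightarrow{s}G$ if $F$ and $G$ differ exactly at the colours in $s$ and there is no weak flag path from $F$ to $G$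 whose word is a splitting of $s$. A flag path is a weak flag path with $F_{i-1}\xrightarrow{s_i}F_i$ for all $i$; it is reduced if its word is. A $\Gamma$-space is simply connected if every closed reduced flag path in it is trivial (has the empty word). It has infinite residues if for each flag $F$ and each colour $\gamma$ infinitely many flags agree with $F$ at all colours other than $\gamma$. Let $\mathrm{PS}_\Gamma$ be the first-order theory of the simply connected $\Gamma$-spaces with infinite residues, i.e. the set of sentences true in all of them. A non-empty induced subgraph $D$ of a $\Gamma$-space $M$ is nice if each of its vertices lies in a flag contained in $D$, and, for all flags $F,G$ in $D$ and letters $s$, $F\xrightarrow{s}G$ in $D$ implies $F\xrightarrow{s}G$ in $M$. **Theorem.** The models of $\mathrm{PS}_\Gamma$ are exactly the simply connected $\Gamma$-spaces with infinite residues, and moreover: 1. If $M$ and $N$ are $\omega$-saturated models of $\mathrm{PS}_\Gamma$, then the isomorphisms $f:A\to B$ between finite nice substructures $A\subset M$ and $B\subset N$ form a back-and-forth system: there is at least one such $f$, and for each such $f$ and each $a\in M$ (respectively $b\in N$) there is an isomorphism between finite nice substructures which extends $f$ and whose domain contains $a$ (respectively whose image contains $b$). 2. If $M$ and $N$ are arbitrary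 models of $\mathrm{PS}_\Gamma$, then every isomorphism $f:A\to B$ between finite nice substructures $A\subset M$ and $B\subset N$ is elementary: for every first-order formula $\varphi(x_1,\dots,x_n)$ and all $a_1,\dots,a_n\in A$, $M\models\varphi(a_1,\dots,a_n)$ if and only if $N\models\varphi(f(a_1),\dots,f(a_n))$. 3. The theory $\mathrm{PS}_\Gamma$ is complete (that is, it is consistent and decides every sentence). -/

import Mathlib

universe u v w

/-! Right-angled Coxeter graphs are simple graphs `Γ` on a finite vertex type `V`; the vertices of
`Γ` are the colours. All structures below are structures for the language of graphs with a unary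
predicate for each colour. -/

namespace RAB

open FirstOrder FirstOrder.Language FirstOrder.Language.Structure

/-- The relation symbols: a binary edge symbol and a unary predicate for every colour. -/
inductive GammaRel (V : Type u) : ℕ → Type u
  | edge : GammaRel V 2
  | colour (γ : V) : GammaRel V 1

/-- The language of graphs with unary predicates for the colours in `V`; no function symbols. -/
def gammaLang (V : Type u) : FirstOrder.Language.{0, u} := ⟨fun _ => Empty, GammaRel V⟩

section Defs

variable {V : Type u} (Γ : SimpleGraph V)

/-! ### Letters and words -/

/-- A letter is a non-empty connected set of colours. -/
def IsLetter (s : Set V) : Prop := (Γ.induce s).Connected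

/-- Two letters commute if they are disjoint and there is no edge of `Γ` between them. -/
def LettersCommute (s t : Set V) : Prop := ∀ γ ∈ s, ∀ δ ∈ t, γ ≠ δ ∧ ¬ Γ.Adj γ δ

/-- A word is reduced if there are no indices `i ≠ j` such that the `i`-th letter is contained in
the `j`-th one and commutes with all letters strictly between the two positions. -/
def IsReduced (w : List (Set V)) : Prop :=
  ¬ ∃ i j : Fin w.length, i ≠ j ∧ w.get i ⊆ w.get j ∧
    ∀ k : Fin w.length, (i < k ∧ k < j) ∨ (j < k ∧ k < i) →
      LettersCommute Γ (w.get i) (w.get k)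

/-- A splitting of `s` is a (possibly empty) word whose letters are properly contained in `s`. -/
def IsSplitting (s : Set V) (w : List (Set V)) : Prop := ∀ t ∈ w, IsLetter Γ t ∧ t ⊂ s

/-! ### `Γ`-graphs, flags and `Γ`-spaces -/

variable {M : Type v} [(gammaLang V).Structure M]

variable (V) in
/-- The edge relation of the structure. -/
def Adj (a b : M) : Prop := RelMap (L := gammaLang V) (GammaRel.edge (V := V)) ![a, b]

/-- The vertex `a` has colour `γ`. -/
def HasColour (γ : V) (a : M) : Prop := RelMap (L := gammaLang V) (GammaRel.colour γ) ![a]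

variable (M) in
/-- `M` is a graph whose vertices are coloured (every vertex has exactly one colour), with edges
only between vertices whose colours are adjacent in `Γ`. -/
structure IsGammaGraph : Prop where
  symm : ∀ a b : M, Adj V a b → Adj V b a
  irrefl : ∀ a : M, ¬ Adj V a a
  colour : ∀ a : M, ∃! γ : V, HasColour γ a
  edge_colour : ∀ (a b : M) (γ δ : V), HasColour γ a → HasColour δ b → Adj V a b → Γ.Adj γ δ

/-- The family `F` is a flag: `F γ` has colour `γ`, and `γ ↦ F γ` is an isomorphism of `Γ` onto the
induced subgraph on its range (injectivity is automatic, since a vertex has only one colour). -/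
def IsFlag (F : V → M) : Prop :=
  (∀ γ, HasColour γ (F γ)) ∧ ∀ γ δ, Adj V (F γ) (F δ) ↔ Γ.Adj γ δ

/-- The flags of the full subgraph of `M` with vertex set `D`. -/
def IsFlagIn (D : Set M) (F : V → M) : Prop := IsFlag Γ F ∧ ∀ γ, F γ ∈ D

variable (M) in
/-- A `Γ`-graph is a `Γ`-space if every vertex lies in a flag, and any two adjacent vertices lie in
a common flag. -/
structure IsGammaSpace : Prop extends IsGammaGraph Γ M where
  vertex_flag : ∀ a : M, ∃ F : V → M, IsFlag Γ F ∧ a ∈ Set.range F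
  edge_flag : ∀ a b : M, Adj V a b →
    ∃ F : V → M, IsFlag Γ F ∧ a ∈ Set.range F ∧ b ∈ Set.range F

/-! ### Flag paths

Everything is relative to a set `D` of vertices: the paths are those of the full subgraph on `D`.
The notions for `M` itself are those with `D = Set.univ`. -/

/-- The set of colours at which `F` and `G` differ. -/
def diffSet (F G : V → M) : Set V := {γ | F γ ≠ G γ}

/-- `IsWeakFlagPath Γ D F w G`: there is a weak flag path in `D` from `F` to `G` with word `w`, that
is, a sequence of flags in `D` such that consecutive ones differ exactly in the respective letter
of `w`. -/
inductive IsWeakFlagPath (D : Set M) : (V → M) → List (Set V) → (V → M) → Prop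
  | nil {F : V → M} (hF : IsFlagIn Γ D F) : IsWeakFlagPath D F [] F
  | cons {F H G : V → M} {s : Set V} {w : List (Set V)} (hF : IsFlagIn Γ D F)
      (hs : IsLetter Γ s) (hd : diffSet F H = s) (hw : IsWeakFlagPath D H w G) :
      IsWeakFlagPath D F (s :: w) G

/-- A step `F → G` with letter `s` in `D`: the flags `F` and `G` of `D` differ exactly in the
letter `s`, and no weak flag path in `D` from `F` to `G` has a splitting of `s` as its word. -/
def IsFlagStep (D : Set M) (F : V → M) (s : Set V) (G : V → M) : Prop :=
  IsFlagIn Γ D F ∧ IsFlagIn Γ D G ∧ IsLetter Γ s ∧ diffSet F G = s ∧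
    ∀ x : List (Set V), IsSplitting Γ s x → ¬ IsWeakFlagPath Γ D F x G

/-- `IsFlagPath Γ D F w G`: there is a flag path in `D` from `F` to `G` with word `w`. -/
inductive IsFlagPath (D : Set M) : (V → M) → List (Set V) → (V → M) → Prop
  | nil {F : V → M} (hF : IsFlagIn Γ D F) : IsFlagPath D F [] F
  | cons {F H G : V → M} {s : Set V} {w : List (Set V)} (hs : IsFlagStep Γ D F s H)
      (hw : IsFlagPath D H w G) : IsFlagPath D F (s :: w) G

variable (M) in
/-- There are no non-trivial closed reduced flag paths. -/
def IsSimplyConnected : Prop :=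
  ∀ (F : V → M) (w : List (Set V)), IsFlagPath Γ Set.univ F w F → IsReduced Γ w → w = []

variable (M) in
/-- For every flag `F` and every colour `γ`, infinitely many flags agree with `F` at all colours
different from `γ`. -/
def HasInfiniteResidues : Prop :=
  ∀ (γ : V) (F : V → M), IsFlag Γ F →
    {G : V → M | IsFlag Γ G ∧ ∀ δ, δ ≠ γ → G δ = F δ}.Infinite

variable (M) in
/-- `M` is a simply connected `Γ`-space with infinite `γ`-residues for every colour `γ`. -/
structure IsPSSpace : Prop extends IsGammaSpace Γ M where
  simply_connected : IsSimplyConnected Γ M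
  infinite_residues : HasInfiniteResidues Γ M

/-- A set `D` of vertices is nice: it is non-empty, each of its points lies in a flag in `D`, and
every step of a flag path in `D` is also a step of a flag path in `M`. -/
structure IsNice (D : Set M) : Prop where
  nonempty : D.Nonempty
  vertex_flag : ∀ a ∈ D, ∃ F : V → M, IsFlagIn Γ D F ∧ a ∈ Set.range F
  step : ∀ (F G : V → M) (s : Set V), IsFlagStep Γ D F s G → IsFlagStep Γ Set.univ F s G

/-! ### The theory -/

/-- The theory of simply connected `Γ`-spaces with infinite residues: all sentences that are true in
each of them. (Structures are non-empty, as usual. As the language is countable, it makes no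
difference to which universe the structures belong.) -/
def PS : (gammaLang V).Theory :=
  {φ | ∀ (M : Type) [Nonempty M] [(gammaLang V).Structure M], IsPSSpace Γ M → M ⊨ φ}

end Defs

/-! ### Model-theoretic notions for an arbitrary language -/

section ModelTheory

variable (L : FirstOrder.Language.{0, u})

/-- `M` is `ω`-saturated: for every finite tuple `a` of parameters, every set of formulas in one
variable with parameters from `a` that is finitely satisfiable in `M` is realised in `M`. -/
def IsOmegaSaturated (M : Type v) [L.Structure M] : Prop :=
  ∀ (n : ℕ) (a : Fin n → M) (p : Set (L.Formula (Fin n ⊕ Unit))),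
    (∀ q : Finset (L.Formula (Fin n ⊕ Unit)), (q : Set _) ⊆ p →
      ∃ b : M, ∀ φ ∈ q, φ.Realize (Sum.elim a fun _ => b)) →
    ∃ b : M, ∀ φ ∈ p, φ.Realize (Sum.elim a fun _ => b)

variable {L} {M : Type v} {N : Type w} [L.Structure M] [L.Structure N]

/-- A set of partial isomorphisms is a back-and-forth system: it is non-empty, and each member
extends, within the set, to any given element on either side. -/
structure IsBackAndForthSystem (I : Set (M ≃ₚ[L] N)) : Prop where
  nonempty : I.Nonempty
  forth : ∀ f ∈ I, ∀ a : M, ∃ g ∈ I, f ≤ g ∧ a ∈ g.dom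
  back : ∀ f ∈ I, ∀ b : N, ∃ g ∈ I, f ≤ g ∧ b ∈ g.cod

/-- A partial isomorphism is elementary if it preserves the truth of all first-order formulas. -/
def IsElementaryPartial (f : M ≃ₚ[L] N) : Prop :=
  ∀ (n : ℕ) (φ : L.Formula (Fin n)) (x : Fin n → f.dom),
    φ.Realize (fun i => (x i : M)) ↔ φ.Realize (fun i => (f.toEquiv (x i) : N))

end ModelTheory

/-- The partial isomorphisms between finite nice substructures of `M` and of `N`. -/
def nicePartialIsos {V : Type u} (Γ : SimpleGraph V) (M : Type v) (N : Type w)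
    [(gammaLang V).Structure M] [(gammaLang V).Structure N] : Set (M ≃ₚ[gammaLang V] N) :=
  {f | (f.dom : Set M).Finite ∧ (f.cod : Set N).Finite ∧
    IsNice Γ (f.dom : Set M) ∧ IsNice Γ (f.cod : Set N)}

end RAB

open RAB FirstOrder

/-! Flag paths are handled through lazy steps (`LStep`), where two flags differ at most in a given
set of colours, and true steps (`TStep`), the lazy steps that do not factor through properly smaller
sets. In a `Γ`-graph the true steps are exactly the arrows of the definition
(`IsGammaGraph.isFlagStep_iff`). Steps with commuting letters can be swapped, so any lazy path can
be turned into a reduced path of true steps, by induction along a multiset order on words. Under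
simple connectedness a reduced path is controlled by every lazy path that leads back: `covering`
places each of its letters inside a letter of the return path, with the order reversed up to
commutation.

For the back-and-forth, let `B` be nice and let `G` be reached from a flag `F` of `B` by a letter
`s` such that the steps to `G` from all flags of `B` in its `s`-residue are true (`IsGenericOver`).
By `covering`, the new vertices of `G` are joined to `B` only through `F`, so adding `G` keeps `B`
nice, and the isomorphism type of the result depends only on `B`, `F` and `s`. Every vertex is
reached by finitely many such extensions: a step that is not true from some flag of `B` is replaced
by smaller ones. In the other model a generic extension by the same letter is realised by
saturation, because each `s`-residue contains flags arbitrarily far from a given finite set of flags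
(`exists_far_flag`).

Truth of a step excludes splittings of every length, so simple connectedness is not visibly
first-order. The axioms forbid closed reduced paths whose steps merely do not factor into three
smaller ones. This formally stronger condition follows from simple connectedness: in
`not_isUnsplitCycle` such a cycle is deformed into a non-trivial closed reduced path of true steps.

Consistency comes from a free model, obtained by adding vertices freely over flags one at a time.
Elementarity in arbitrary models follows by passing to ultrapowers, which are `ω`-saturated.
Completeness follows since single flags are isomorphic nice sets. -/

namespace RAB

/-! ### Words, commutation and reducedness -/

section Words

variable {V : Type u} {Γ : SimpleGraph V}

theorem LettersCommute.symm {s t : Set V} (h : LettersCommute Γ s t) : LettersCommute Γ t s :=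
  fun γ hγ δ hδ => ⟨(h δ hδ γ hγ).1.symm, fun e => (h δ hδ γ hγ).2 e.symm⟩

theorem LettersCommute.mono {s t s' t' : Set V} (h : LettersCommute Γ s t) (hs : s' ⊆ s)
    (ht : t' ⊆ t) : LettersCommute Γ s' t' :=
  fun γ hγ δ hδ => h γ (hs hγ) δ (ht hδ)

variable (Γ) in
/-- Reducedness of a word, in terms of decompositions of the list. -/
def WordReduced (w : List (Set V)) : Prop :=
  ∀ a p b q c, w = a ++ p :: (b ++ q :: c) →
    ¬ ((p ⊆ q ∧ ∀ t ∈ b, LettersCommute Γ p t) ∨ (q ⊆ p ∧ ∀ t ∈ b, LettersCommute Γ q t))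

theorem exists_decomposition_of_lt {α : Type*} (w : List α) (i j : ℕ) (hij : i < j)
    (hj : j < w.length) :
    ∃ a b c, w = a ++ w[i] :: (b ++ w[j] :: c) ∧ a.length = i ∧ b.length = j - i - 1 := by
  refine ⟨w.take i, (w.drop (i + 1)).take (j - i - 1), w.drop (j + 1), ?_, by simp; omega,
    by simp; omega⟩
  have h1 : w = w.take i ++ w[i] :: w.drop (i + 1) := by
    rw [List.cons_getElem_drop_succ, List.take_append_drop]
  have h2 : w.drop (i + 1) =
      (w.drop (i + 1)).take (j - i - 1) ++ w[j] :: w.drop (j + 1) := by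
    conv_lhs => rw [← List.take_append_drop (j - i - 1) (w.drop (i + 1))]
    rw [List.drop_drop]
    congr 1
    have : i + 1 + (j - i - 1) = j := by omega
    rw [this, List.cons_getElem_drop_succ]
  rw [← h2]; exact h1

theorem isReduced_iff_wordReduced (w : List (Set V)) : IsReduced Γ w ↔ WordReduced Γ w := by
  constructor
  · rintro h a p b q c rfl hc
    apply h
    have hi : a.length < (a ++ p :: (b ++ q :: c)).length := by simp
    have hj : a.length + 1 + b.length < (a ++ p :: (b ++ q :: c)).length := by simp; omega
    have ei : (a ++ p :: (b ++ q :: c))[a.length]'hi = p := by simp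
    have ej : (a ++ p :: (b ++ q :: c))[a.length + 1 + b.length]'hj = q := by
      rw [List.getElem_append_right (by omega)]
      simp [Nat.add_assoc, Nat.add_comm 1]
    have ek : ∀ (k : ℕ) (hk : k < (a ++ p :: (b ++ q :: c)).length), a.length < k →
        k < a.length + 1 + b.length → (a ++ p :: (b ++ q :: c))[k] ∈ b := by
      intro k hk h1 h2
      obtain ⟨m, rfl⟩ : ∃ m, k = a.length + (m + 1) := ⟨k - a.length - 1, by omega⟩
      have hm : m < b.length := by omega
      rw [List.getElem_append_right (by omega)]
      simp [hm]
    rcases hc with ⟨h1, h2⟩ | ⟨h1, h2⟩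
    · refine ⟨⟨_, hi⟩, ⟨_, hj⟩, by simp [Fin.ext_iff]; omega, ?_, ?_⟩
      · simp only [List.get_eq_getElem, ei, ej]; exact h1
      · rintro ⟨k, hk'⟩ hk
        simp only [List.get_eq_getElem, ei]
        simp only [Fin.mk_lt_mk] at hk
        exact h2 _ (ek k hk' (by omega) (by omega))
    · refine ⟨⟨_, hj⟩, ⟨_, hi⟩, by simp [Fin.ext_iff]; omega, ?_, ?_⟩
      · simp only [List.get_eq_getElem, ei, ej]; exact h1
      · rintro ⟨k, hk'⟩ hk
        simp only [List.get_eq_getElem, ej]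
        simp only [Fin.mk_lt_mk] at hk
        exact h2 _ (ek k hk' (by omega) (by omega))
  · rintro h ⟨⟨i, hi⟩, ⟨j, hj⟩, hne, hsub, hk⟩
    simp only [List.get_eq_getElem, Fin.lt_def, Fin.forall_iff] at hsub hk
    have hne : i ≠ j := by simpa [Fin.ext_iff] using hne
    have key : ∀ (i j : ℕ) (hij : i < j) (hj : j < w.length) (a b c : List (Set V)),
        w = a ++ w[i] :: (b ++ w[j] :: c) → a.length = i → b.length = j - i - 1 →
        ∀ t ∈ b, ∃ (k : ℕ) (hk : k < w.length), i < k ∧ k < j ∧ w[k] = t := by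
      intro i j hij hj a b c hw ha hb t ht
      obtain ⟨m, hm, rfl⟩ := List.getElem_of_mem ht
      refine ⟨i + (m + 1), by omega, by omega, by omega, ?_⟩
      have : w[i + (m + 1)]'(by omega) = (a ++ w[i] :: (b ++ w[j] :: c))[i + (m + 1)]'
          (by rw [← hw]; omega) := by congr 1
      rw [this, List.getElem_append_right (by omega)]
      simp [ha, hm]
    rcases lt_or_gt_of_ne hne with hij | hij
    · obtain ⟨a, b, c, hw, ha, hb⟩ := exists_decomposition_of_lt w i j hij hj
      refine h a _ b _ c hw (Or.inl ⟨hsub, fun t ht => ?_⟩)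
      obtain ⟨k, hkl, h1, h2, rfl⟩ := key i j hij hj a b c hw ha hb t ht
      exact hk k hkl (Or.inl ⟨h1, h2⟩)
    · obtain ⟨a, b, c, hw, ha, hb⟩ := exists_decomposition_of_lt w j i hij hi
      refine h a _ b _ c hw (Or.inr ⟨hsub, fun t ht => ?_⟩)
      obtain ⟨k, hkl, h1, h2, rfl⟩ := key j i hij hi a b c hw ha hb t ht
      exact hk k hkl (Or.inr ⟨h1, h2⟩)

theorem WordReduced.of_append_left {w x : List (Set V)} (h : WordReduced Γ (w ++ x)) :
    WordReduced Γ w := by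
  rintro a p b q c rfl
  exact h a p b q (c ++ x) (by simp)

theorem WordReduced.of_append_right {w x : List (Set V)} (h : WordReduced Γ (w ++ x)) :
    WordReduced Γ x := by
  rintro a p b q c rfl
  exact h (w ++ a) p b q c (by simp)

theorem wordReduced_nil : WordReduced Γ [] := by
  rintro a p b q c h; simp at h

theorem wordReduced_singleton (s : Set V) : WordReduced Γ [s] := by
  rintro a p b q c h
  have := congrArg List.length h
  simp at this
  omega

theorem WordReduced.reverse {w : List (Set V)} (h : WordReduced Γ w) :
    WordReduced Γ w.reverse := by
  intro a p b q c hw hc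
  have : w = c.reverse ++ q :: (b.reverse ++ p :: a.reverse) := by
    rw [← w.reverse_reverse, hw]; simp
  refine h _ _ _ _ _ this (hc.symm.imp ?_ ?_) <;>
  · rintro ⟨h1, h2⟩
    exact ⟨h1, fun t ht => h2 t (List.mem_reverse.1 ht)⟩

/-- A pair of letters that witnesses that the concatenation of two reduced words is not reduced
has one letter in each of the words. -/
theorem exists_of_not_wordReduced_append {w x : List (Set V)} (hw : WordReduced Γ w)
    (hx : WordReduced Γ x) (h : ¬ WordReduced Γ (w ++ x)) :
    ∃ w₁ p w₂ x₁ q x₂, w = w₁ ++ p :: w₂ ∧ x = x₁ ++ q :: x₂ ∧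
      ((p ⊆ q ∧ (∀ t ∈ w₂, LettersCommute Γ p t) ∧ ∀ t ∈ x₁, LettersCommute Γ p t) ∨
       (q ⊆ p ∧ (∀ t ∈ w₂, LettersCommute Γ q t) ∧ ∀ t ∈ x₁, LettersCommute Γ q t)) := by
  unfold WordReduced at h
  push Not at h
  obtain ⟨a, p, b, q, c, e, hc⟩ := h
  rw [List.append_eq_append_iff] at e
  rcases e with ⟨a', rfl, hx'⟩ | ⟨c', rfl, e⟩
  · exact absurd hc (hx _ _ _ _ _ hx')
  · cases c' with
    | nil => exact absurd hc (hx [] p b q c (by simpa using e.symm))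
    | cons p' c' =>
      obtain ⟨rfl, e2⟩ := List.cons_eq_cons.1 e
      have e3 : b ++ q :: c = c' ++ x := e2
      rw [List.append_eq_append_iff] at e3
      rcases e3 with ⟨a', rfl, hx'⟩ | ⟨c'', rfl, e4⟩
      · cases a' with
        | nil =>
          simp only [List.nil_append] at hx'
          refine ⟨a, p, b, [], q, c, by simp, by simp [hx'], hc.imp ?_ ?_⟩ <;>
          · rintro ⟨h1, h2⟩; exact ⟨h1, by simpa using h2, by simp⟩
        | cons q' a' =>
          obtain ⟨rfl, rfl⟩ := List.cons_eq_cons.1 hx'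
          exact absurd hc (hw a p b q a' (by simp))
      · refine ⟨a, p, c', c'', q, c, rfl, e4, hc.imp ?_ ?_⟩ <;>
        · rintro ⟨h1, h2⟩
          exact ⟨h1, fun t ht => h2 t (by simp [ht]), fun t ht => h2 t (by simp [ht])⟩

/-- Deleting a letter that commutes with all later letters preserves reducedness. -/
theorem WordReduced.delete {w₁ w₂ : List (Set V)} {p : Set V}
    (h : WordReduced Γ (w₁ ++ p :: w₂)) (hp : ∀ t ∈ w₂, LettersCommute Γ p t) :
    WordReduced Γ (w₁ ++ w₂) := by
  have h1 : WordReduced Γ w₁ := h.of_append_left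
  have h2 : WordReduced Γ w₂ := by
    have : w₁ ++ p :: w₂ = (w₁ ++ [p]) ++ w₂ := by simp
    rw [this] at h; exact h.of_append_right
  by_contra hn
  obtain ⟨a, q, b, c, r, d, rfl, rfl, hc⟩ := exists_of_not_wordReduced_append h1 h2 hn
  refine h a q (b ++ p :: c) r d (by simp) (hc.imp ?_ ?_)
  · rintro ⟨hs, hb, hc⟩
    refine ⟨hs, fun t ht => ?_⟩
    simp only [List.mem_append, List.mem_cons] at ht
    rcases ht with ht | rfl | ht
    · exact hb t ht
    · exact ((hp r (by simp)).mono le_rfl hs).symm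
    · exact hc t ht
  · rintro ⟨hs, hb, hc⟩
    refine ⟨hs, fun t ht => ?_⟩
    simp only [List.mem_append, List.mem_cons] at ht
    rcases ht with ht | rfl | ht
    · exact hb t ht
    · exact (hp r (by simp)).symm
    · exact hc t ht

/-- Well-founded order on words: one word is below another if it arises by replacing letters by
words of properly smaller letters. -/
def wordLT (x y : List (Set V)) : Prop :=
  Relation.TransGen (Relation.CutExpand (fun s t : Set V => s ⊂ t)) (x : Multiset (Set V)) y

/-- Proper inclusion is well founded on subsets of the finite set `V`, and the hydra order on
multisets inherits this. All inductions in which a letter is dropped or split into smaller ones rest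
on it. -/
theorem wellFounded_cutExpand_ssubset [Finite V] :
    WellFounded (Relation.TransGen (Relation.CutExpand (fun s t : Set V => s ⊂ t))) := by
  have : Std.Irrefl (fun s t : Set V => s ⊂ t) := ⟨fun a h => h.2 subset_rfl⟩
  have hwf : WellFounded (fun s t : Set V => s ⊂ t) :=
    (wellFounded_lt : WellFounded (fun s t : Set V => s < t))
  exact hwf.cutExpand.transGen

theorem wellFounded_wordLT [Finite V] : WellFounded (wordLT : List (Set V) → _ → Prop) :=
  InvImage.wf (fun x : List (Set V) => (x : Multiset (Set V))) wellFounded_cutExpand_ssubset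

theorem wordLT_replace (a c : List (Set V)) {q : Set V} {y : List (Set V)}
    (hy : ∀ t ∈ y, t ⊂ q) : wordLT (a ++ y ++ c) (a ++ q :: c) := by
  refine Relation.TransGen.single ⟨(y : Multiset (Set V)), q, fun t ht => hy t (by simpa using ht),
    ?_⟩
  rw [← Multiset.coe_singleton, Multiset.coe_add, Multiset.coe_add, Multiset.coe_eq_coe]
  classical
  rw [List.perm_iff_count]
  intro b
  simp [List.count_cons]
  omega

theorem wordLT_delete (a c : List (Set V)) (q : Set V) : wordLT (a ++ c) (a ++ q :: c) := by
  simpa using wordLT_replace a c (q := q) (y := []) (by simp)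

end Words

/-! ### Labelled paths for an arbitrary step relation -/

section Chains

variable {V : Type u} {X : Type v}

/-- Paths with steps in the relation `R`, labelled by sets of colours. -/
def Chain (R : X → Set V → X → Prop) : X → List (Set V) → X → Prop
  | F, [], G => F = G
  | F, s :: w, G => ∃ H, R F s H ∧ Chain R H w G

variable {R R' : X → Set V → X → Prop}

@[simp] theorem chain_nil {F G : X} : Chain R F [] G ↔ F = G := Iff.rfl

@[simp] theorem chain_cons {F G : X} {s : Set V} {w : List (Set V)} :
    Chain R F (s :: w) G ↔ ∃ H, R F s H ∧ Chain R H w G := Iff.rfl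

theorem chain_append {F G : X} {w x : List (Set V)} :
    Chain R F (w ++ x) G ↔ ∃ H, Chain R F w H ∧ Chain R H x G := by
  induction w generalizing F with
  | nil => simp
  | cons s w ih =>
    simp only [List.cons_append, chain_cons, ih]
    constructor
    · rintro ⟨H, h1, K, h2, h3⟩; exact ⟨K, ⟨H, h1, h2⟩, h3⟩
    · rintro ⟨K, ⟨H, h1, h2⟩, h3⟩; exact ⟨H, h1, K, h2, h3⟩

theorem chain_singleton {F G : X} {s : Set V} : Chain R F [s] G ↔ R F s G := by simp

theorem Chain.append {F H G : X} {w x : List (Set V)} (h : Chain R F w H) (h' : Chain R H x G) :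
    Chain R F (w ++ x) G := chain_append.2 ⟨H, h, h'⟩

theorem Chain.mono {F G : X} {w : List (Set V)} (h : Chain R F w G)
    (hR : ∀ F s G, R F s G → R' F s G) : Chain R' F w G := by
  induction w generalizing F with
  | nil => exact h
  | cons s w ih =>
    obtain ⟨H, h1, h2⟩ := h
    exact ⟨H, hR _ _ _ h1, ih h2⟩

theorem Chain.reverse {F G : X} {w : List (Set V)} (h : Chain R F w G)
    (hR : ∀ F s G, R F s G → R G s F) : Chain R G w.reverse F := by
  induction w generalizing F with
  | nil => exact h.symm
  | cons s w ih =>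
    obtain ⟨H, h1, h2⟩ := h
    rw [List.reverse_cons]
    exact (ih h2).append (chain_singleton.2 (hR _ _ _ h1))

theorem Chain.of_prop {F G : X} {w : List (Set V)} (h : Chain R F w G) {P : X → Prop}
    (hP : ∀ F s G, R F s G → P F → P G) (hF : P F) : P G := by
  induction w generalizing F with
  | nil => exact h ▸ hF
  | cons s w ih =>
    obtain ⟨H, h1, h2⟩ := h
    exact ih h2 (hP _ _ _ h1 hF)

end Chains

/-! ### Splicing two families of vertices -/

section Splice

variable {V : Type u} {M : Type v}

open Classical in
/-- The family that agrees with `G` on `C` and with `F` elsewhere. -/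
noncomputable def splice (C : Set V) (G F : V → M) : V → M := fun γ => if γ ∈ C then G γ else F γ

theorem splice_of_mem {C : Set V} {G F : V → M} {γ : V} (h : γ ∈ C) : splice C G F γ = G γ :=
  if_pos h

theorem splice_of_notMem {C : Set V} {G F : V → M} {γ : V} (h : γ ∉ C) :
    splice C G F γ = F γ := if_neg h

end Splice

/-! ### Lazy and true steps; commutation and reduction of paths -/

section Steps

variable {V : Type u} {Γ : SimpleGraph V} {M : Type v} [(gammaLang V).Structure M] {D : Set M}

/-- The union of all connected subsets of `S` through `γ` is connected, and a colour of `S` adjacent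
to it could be added without losing connectedness. -/
theorem exists_component {S : Set V} {γ : V} (hγ : γ ∈ S) :
    ∃ C ⊆ S, γ ∈ C ∧ IsLetter Γ C ∧ ∀ δ ∈ C, ∀ ε ∈ S, ε ∉ C → ¬ Γ.Adj δ ε := by
  have hs : (Γ.induce ({γ} : Set V)).Connected := by
    have : Nonempty ({γ} : Set V) := ⟨⟨γ, rfl⟩⟩
    have : Subsingleton ({γ} : Set V) := by
      constructor; rintro ⟨a, rfl⟩ ⟨b, rfl⟩; rfl
    exact ⟨SimpleGraph.Preconnected.of_subsingleton⟩
  have hC : (Γ.induce (⋃₀ {T | T ⊆ S ∧ γ ∈ T ∧ IsLetter Γ T})).Connected :=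
    SimpleGraph.induce_sUnion_connected_of_pairwise_not_disjoint
      ⟨{γ}, by simpa using hγ, rfl, hs⟩ (fun hs ht => ⟨γ, hs.2.1, ht.2.1⟩)
      (fun hs => hs.2.2)
  refine ⟨⋃₀ {T | T ⊆ S ∧ γ ∈ T ∧ IsLetter Γ T}, Set.sUnion_subset fun T hT => hT.1,
    ⟨{γ}, ⟨by simpa using hγ, rfl, hs⟩, rfl⟩, hC, ?_⟩
  intro δ hδ ε hε hn hadj
  apply hn
  refine ⟨insert ε (⋃₀ {T | T ⊆ S ∧ γ ∈ T ∧ IsLetter Γ T}), ⟨?_, ?_, ?_⟩, Set.mem_insert _ _⟩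
  · exact Set.insert_subset hε (Set.sUnion_subset fun T hT => hT.1)
  · exact Set.mem_insert_of_mem _ ⟨{γ}, ⟨by simpa using hγ, rfl, hs⟩, rfl⟩
  · have : IsLetter Γ _ := SimpleGraph.induce_union_connected hC.preconnected
      (SimpleGraph.induce_pair_connected_of_adj hadj).preconnected ⟨δ, hδ, Set.mem_insert _ _⟩
    rwa [show insert ε (⋃₀ {T | T ⊆ S ∧ γ ∈ T ∧ IsLetter Γ T}) =
      ⋃₀ {T | T ⊆ S ∧ γ ∈ T ∧ IsLetter Γ T} ∪ {δ, ε} from ?_]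
    rw [Set.union_insert, Set.union_singleton]
    exact (Set.insert_eq_of_mem (Set.mem_insert_of_mem _ hδ)).symm

theorem IsGammaGraph.isFlag (hM : IsGammaGraph Γ M) {F : V → M} (hc : ∀ γ, HasColour γ (F γ))
    (ha : ∀ γ δ, Γ.Adj γ δ → Adj V (F γ) (F δ)) : IsFlag Γ F :=
  ⟨hc, fun γ δ => ⟨fun h => hM.edge_colour _ _ _ _ (hc γ) (hc δ) h, ha γ δ⟩⟩

theorem IsGammaGraph.colour_unique (hM : IsGammaGraph Γ M) {a : M} {γ δ : V}
    (h : HasColour γ a) (h' : HasColour δ a) : γ = δ := (hM.colour a).unique h h'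

/-- Only the edges of `Γ` that leave `C` are at risk. At their outer end `F` and `G` agree, so the
required edge is already present in `G`. -/
theorem IsGammaGraph.isFlagIn_splice (hM : IsGammaGraph Γ M) {F G : V → M} {C : Set V}
    (hF : IsFlagIn Γ D F) (hG : IsFlagIn Γ D G)
    (h : ∀ γ ∈ C, ∀ δ, δ ∉ C → Γ.Adj γ δ → G δ = F δ) : IsFlagIn Γ D (splice C G F) := by
  refine ⟨hM.isFlag (fun γ => ?_) (fun γ δ hadj => ?_), fun γ => ?_⟩
  · by_cases hγ : γ ∈ C
    · rw [splice_of_mem hγ]; exact hG.1.1 γ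
    · rw [splice_of_notMem hγ]; exact hF.1.1 γ
  · by_cases hγ : γ ∈ C <;> by_cases hδ : δ ∈ C
    · rw [splice_of_mem hγ, splice_of_mem hδ]; exact (hG.1.2 γ δ).2 hadj
    · rw [splice_of_mem hγ, splice_of_notMem hδ, ← h γ hγ δ hδ hadj]
      exact (hG.1.2 γ δ).2 hadj
    · rw [splice_of_notMem hγ, splice_of_mem hδ, ← h δ hδ γ hγ hadj.symm]
      exact (hG.1.2 γ δ).2 hadj
    · rw [splice_of_notMem hγ, splice_of_notMem hδ]; exact (hF.1.2 γ δ).2 hadj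
  · by_cases hγ : γ ∈ C
    · rw [splice_of_mem hγ]; exact hG.2 γ
    · rw [splice_of_notMem hγ]; exact hF.2 γ

variable (Γ D) in
/-- A lazy step: the flags differ at most in `s`, an arbitrary set of colours. -/
def LStep (F : V → M) (s : Set V) (G : V → M) : Prop :=
  IsFlagIn Γ D F ∧ IsFlagIn Γ D G ∧ ∀ γ, γ ∉ s → F γ = G γ

variable (Γ D) in
/-- A true step: a lazy step that does not decompose into lazy steps with smaller sets. -/
def TStep (F : V → M) (s : Set V) (G : V → M) : Prop :=
  LStep Γ D F s G ∧ ∀ y : List (Set V), (∀ t ∈ y, t ⊂ s) → ¬ Chain (LStep Γ D) F y G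

theorem LStep.symm {F G : V → M} {s : Set V} (h : LStep Γ D F s G) : LStep Γ D G s F :=
  ⟨h.2.1, h.1, fun γ hγ => (h.2.2 γ hγ).symm⟩

theorem LStep.weaken {F G : V → M} {s t : Set V} (h : LStep Γ D F s G) (hst : s ⊆ t) :
    LStep Γ D F t G :=
  ⟨h.1, h.2.1, fun γ hγ => h.2.2 γ fun h' => hγ (hst h')⟩

theorem LStep.trans {F G H : V → M} {s : Set V} (h : LStep Γ D F s G) (h' : LStep Γ D G s H) :
    LStep Γ D F s H :=
  ⟨h.1, h'.2.1, fun γ hγ => (h.2.2 γ hγ).trans (h'.2.2 γ hγ)⟩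

theorem LStep.refl {F : V → M} (hF : IsFlagIn Γ D F) (s : Set V) : LStep Γ D F s F :=
  ⟨hF, hF, fun _ _ => rfl⟩

theorem TStep.symm {F G : V → M} {s : Set V} (h : TStep Γ D F s G) : TStep Γ D G s F := by
  refine ⟨h.1.symm, fun y hy hc => h.2 y.reverse (fun t ht => hy t (List.mem_reverse.1 ht)) ?_⟩
  exact hc.reverse fun _ _ _ => LStep.symm

theorem LStep.mono {D' : Set M} (hD : D ⊆ D') {F G : V → M} {s : Set V} (h : LStep Γ D F s G) :
    LStep Γ D' F s G :=
  ⟨⟨h.1.1, fun γ => hD (h.1.2 γ)⟩, ⟨h.2.1.1, fun γ => hD (h.2.1.2 γ)⟩, h.2.2⟩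

theorem lstep_of_diffSet {F G : V → M} (hF : IsFlagIn Γ D F) (hG : IsFlagIn Γ D G) :
    LStep Γ D F (diffSet F G) G :=
  ⟨hF, hG, fun _ hγ => by_contra fun h => hγ h⟩

theorem LStep.diffSet_subset {F G : V → M} {s : Set V} (h : LStep Γ D F s G) :
    diffSet F G ⊆ s := fun γ hγ => by_contra fun h' => hγ (h.2.2 γ h')

theorem TStep.diffSet_eq {F G : V → M} {s : Set V} (h : TStep Γ D F s G) : diffSet F G = s := by
  by_contra hne
  have : diffSet F G ⊂ s := lt_of_le_of_ne h.1.diffSet_subset hne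
  exact h.2 [diffSet F G] (by simpa using this)
    (chain_singleton.2 (lstep_of_diffSet h.1.1 h.1.2.1))

theorem TStep.nonempty {F G : V → M} {s : Set V} (h : TStep Γ D F s G) : s.Nonempty := by
  by_contra hne
  rw [Set.not_nonempty_iff_eq_empty] at hne
  exact h.2 [] (by simp) (funext fun γ => h.1.2.2 γ (by simp [hne]))

/-- A true step in `M` between flags of `D` is a true step in `D`. -/
theorem TStep.anti {D' : Set M} (hD : D ⊆ D') {F G : V → M} {s : Set V} (h : TStep Γ D' F s G)
    (hF : IsFlagIn Γ D F) (hG : IsFlagIn Γ D G) : TStep Γ D F s G :=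
  ⟨⟨hF, hG, h.1.2.2⟩, fun y hy hc => h.2 y hy (hc.mono fun _ _ _ => LStep.mono hD)⟩

theorem IsWeakFlagPath.append {F G H : V → M} {w x : List (Set V)}
    (h : IsWeakFlagPath Γ D F w G) (h' : IsWeakFlagPath Γ D G x H) :
    IsWeakFlagPath Γ D F (w ++ x) H := by
  induction h with
  | nil => exact h'
  | cons hF hs hd _ ih => exact .cons hF hs hd (ih h')

theorem IsWeakFlagPath.left {F G : V → M} {w : List (Set V)}
    (h : IsWeakFlagPath Γ D F w G) : IsFlagIn Γ D F := by
  cases h <;> assumption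

theorem IsWeakFlagPath.chain {F G : V → M} {w : List (Set V)}
    (h : IsWeakFlagPath Γ D F w G) : Chain (LStep Γ D) F w G := by
  induction h with
  | nil => rfl
  | cons hF hs hd hw ih =>
    refine ⟨_, ⟨hF, hw.left, fun γ hγ => ?_⟩, ih⟩
    rw [← hd] at hγ
    exact by_contra fun h => hγ h

/-- Any two flags are connected by a weak flag path, exchanging the components of the difference
set one by one. -/
theorem IsGammaGraph.exists_weakFlagPath [Finite V] (hM : IsGammaGraph Γ M) {F G : V → M}
    (hF : IsFlagIn Γ D F) (hG : IsFlagIn Γ D G) :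
    ∃ w, IsWeakFlagPath Γ D F w G ∧ ∀ t ∈ w, IsLetter Γ t ∧ t ⊆ diffSet F G := by
  induction hS : (diffSet F G).ncard using Nat.strong_induction_on generalizing F with
  | _ n ih =>
  by_cases he : F = G
  · subst he
    exact ⟨[], .nil hF, by simp⟩
  obtain ⟨γ, hγ⟩ := Function.ne_iff.1 he
  obtain ⟨C, hCS, hγC, hC, hadj⟩ := exists_component (Γ := Γ) (S := diffSet F G) (γ := γ) hγ
  have hH : IsFlagIn Γ D (splice C G F) := by
    refine hM.isFlagIn_splice hF hG fun δ hδ ε hε h => ?_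
    by_contra hne
    exact hadj δ hδ ε (fun e => hne e.symm) hε h
  have hd : diffSet (splice C G F) G = diffSet F G \ C := by
    ext δ
    by_cases hδ : δ ∈ C
    · simp [diffSet, splice_of_mem hδ, hδ]
    · simp [diffSet, splice_of_notMem hδ, hδ]
  have hd' : diffSet F (splice C G F) = C := by
    ext δ
    by_cases hδ : δ ∈ C
    · simpa [diffSet, splice_of_mem hδ, hδ] using hCS hδ
    · simp [diffSet, splice_of_notMem hδ, hδ]
  obtain ⟨w, hw, hw'⟩ := ih _ (by
    rw [← hS, hd]
    exact Set.ncard_lt_ncard ⟨Set.sdiff_subset, fun h => (h hγ).2 hγC⟩ (Set.toFinite _)) hH rfl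
  refine ⟨C :: w, .cons hF hC hd' hw, ?_⟩
  intro t ht
  rcases List.mem_cons.1 ht with rfl | ht
  · exact ⟨hC, hCS⟩
  · refine ⟨(hw' t ht).1, (hw' t ht).2.trans ?_⟩
    rw [hd]; exact Set.sdiff_subset

/-- Each lazy step is refined into exchanges of the components of its difference set, which are
letters. -/
theorem IsGammaGraph.weakFlagPath_of_chain [Finite V] (hM : IsGammaGraph Γ M) {F G : V → M}
    {s : Set V} {y : List (Set V)} (hF : IsFlagIn Γ D F) (hy : ∀ t ∈ y, t ⊂ s)
    (h : Chain (LStep Γ D) F y G) : ∃ w, IsWeakFlagPath Γ D F w G ∧ IsSplitting Γ s w := by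
  induction y generalizing F with
  | nil => obtain rfl := h; exact ⟨[], .nil hF, by simp [IsSplitting]⟩
  | cons t y ih =>
    obtain ⟨H, h1, h2⟩ := h
    obtain ⟨w, hw, hw'⟩ := hM.exists_weakFlagPath h1.1 h1.2.1
    obtain ⟨x, hx, hx'⟩ := ih h1.2.1 (fun t ht => hy t (by simp [ht])) h2
    refine ⟨w ++ x, hw.append hx, fun r hr => ?_⟩
    rcases List.mem_append.1 hr with hr | hr
    · exact ⟨(hw' r hr).1,
        lt_of_le_of_lt ((hw' r hr).2.trans h1.diffSet_subset) (hy t (by simp))⟩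
    · exact hx' r hr

/-- Connectedness of letters and exact difference sets can be dropped: a lazy decomposition refines
to a splitting, and a step along a disconnected set decomposes into its components. -/
theorem IsGammaGraph.isFlagStep_iff [Finite V] (hM : IsGammaGraph Γ M) {F G : V → M}
    {s : Set V} : IsFlagStep Γ D F s G ↔ TStep Γ D F s G := by
  constructor
  · rintro ⟨hF, hG, hs, hd, h⟩
    refine ⟨⟨hF, hG, fun γ hγ => ?_⟩, fun y hy hc => ?_⟩
    · rw [← hd] at hγ; exact by_contra fun h => hγ h
    · obtain ⟨w, hw, hw'⟩ := hM.weakFlagPath_of_chain hF hy hc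
      exact h w hw' hw
  · intro h
    have hd := h.diffSet_eq
    refine ⟨h.1.1, h.1.2.1, ?_, hd, ?_⟩
    · by_contra hs
      obtain ⟨w, hw, hw'⟩ := hM.exists_weakFlagPath h.1.1 h.1.2.1
      refine h.2 w (fun t ht => ?_) hw.chain
      rw [hd] at hw'
      exact lt_of_le_of_ne (hw' t ht).2 fun e => hs (e ▸ (hw' t ht).1)
    · exact fun x hx hw => h.2 x (fun t ht => (hx t ht).2) hw.chain

theorem IsGammaGraph.isFlagPath_iff [Finite V] (hM : IsGammaGraph Γ M) {F G : V → M}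
    {w : List (Set V)} : IsFlagPath Γ D F w G ↔ IsFlagIn Γ D F ∧ Chain (TStep Γ D) F w G := by
  constructor
  · intro h
    induction h with
    | nil hF => exact ⟨hF, rfl⟩
    | cons hs hw ih => exact ⟨hs.1, _, hM.isFlagStep_iff.1 hs, ih.2⟩
  · rintro ⟨hF, h⟩
    induction w generalizing F with
    | nil => obtain rfl := h; exact .nil hF
    | cons s w ih =>
      obtain ⟨H, h1, h2⟩ := h
      exact .cons (hM.isFlagStep_iff.2 h1) (ih h1.1.2.1 h2)

/-- Transport of a lazy decomposition to flags that agree on a letter and its neighbours. -/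
theorem IsGammaGraph.chain_transport (hM : IsGammaGraph Γ M) {s : Set V} {y : List (Set V)}
    {F G F' G' : V → M} (hF' : IsFlagIn Γ D F') (hG' : ∀ γ, γ ∉ s → F' γ = G' γ)
    (hsF : ∀ γ ∈ s, F γ = F' γ) (hsG : ∀ γ ∈ s, G γ = G' γ) (hF : IsFlagIn Γ D F)
    (hadj : ∀ γ ∈ s, ∀ δ, δ ∉ s → Γ.Adj γ δ → F δ = F' δ) (hy : ∀ t ∈ y, t ⊆ s)
    (h : Chain (LStep Γ D) F y G) : Chain (LStep Γ D) F' y G' := by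
  -- Along a path inside `s` only the `s`-parts of the flags move, and these can be implanted into
  -- `F'`.
  have key : ∀ (y : List (Set V)) (K : V → M), (∀ t ∈ y, t ⊆ s) → IsFlagIn Γ D K →
      (∀ δ, δ ∉ s → F δ = K δ) → Chain (LStep Γ D) K y G →
      Chain (LStep Γ D) (splice s K F') y (splice s G F') := by
    intro y
    induction y with
    | nil => rintro K - - - rfl; rfl
    | cons t y ih =>
      rintro K hy hK hKF ⟨H, h1, h2⟩
      have hHF : ∀ δ, δ ∉ s → F δ = H δ := fun δ hδ =>
        (hKF δ hδ).trans (h1.2.2 δ fun h => hδ (hy t (by simp) h))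
      refine ⟨splice s H F', ⟨hM.isFlagIn_splice hF' hK ?_,
        hM.isFlagIn_splice hF' h1.2.1 ?_, ?_⟩, ih H (fun t ht => hy t (by simp [ht])) h1.2.1
          hHF h2⟩
      · exact fun γ hγ δ hδ h => (hKF δ hδ).symm.trans (hadj γ hγ δ hδ h)
      · exact fun γ hγ δ hδ h => (hHF δ hδ).symm.trans (hadj γ hγ δ hδ h)
      · intro γ hγ
        by_cases hs : γ ∈ s
        · rw [splice_of_mem hs, splice_of_mem hs, h1.2.2 γ hγ]
        · rw [splice_of_notMem hs, splice_of_notMem hs]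
  have h3 := key y F hy hF (fun _ _ => rfl) h
  have e1 : splice s F F' = F' := by
    funext γ
    by_cases hs : γ ∈ s
    · rw [splice_of_mem hs, hsF γ hs]
    · rw [splice_of_notMem hs]
  have e2 : splice s G F' = G' := by
    funext γ
    by_cases hs : γ ∈ s
    · rw [splice_of_mem hs, hsG γ hs]
    · rw [splice_of_notMem hs, hG' γ hs]
  rwa [e1, e2] at h3

/-- Truth of a step depends only on the flags on `s` and at the neighbours of `s`: a decomposition
of the second step could be transported back to the first. -/
theorem IsGammaGraph.tstep_transport (hM : IsGammaGraph Γ M) {s : Set V}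
    {F G F' G' : V → M} (h : TStep Γ D F s G) (h' : LStep Γ D F' s G')
    (hsF : ∀ γ ∈ s, F γ = F' γ) (hsG : ∀ γ ∈ s, G γ = G' γ)
    (hadj : ∀ γ ∈ s, ∀ δ, δ ∉ s → Γ.Adj γ δ → F δ = F' δ) : TStep Γ D F' s G' :=
  ⟨h', fun y hy hc => h.2 y hy (hM.chain_transport h.1.1 h.1.2.2 (fun γ hγ => (hsF γ hγ).symm)
    (fun γ hγ => (hsG γ hγ).symm) h'.1 (fun γ hγ δ hδ e => (hadj γ hγ δ hδ e).symm)
    (fun t ht => (hy t ht).subset) hc)⟩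

/-! ### Commuting steps -/

/-- A relation whose steps may be exchanged with commuting lazy steps. -/
structure Swappable (Γ : SimpleGraph V) (D : Set M)
    (R : (V → M) → Set V → (V → M) → Prop) : Prop where
  symm : ∀ {F s G}, R F s G → R G s F
  swap : ∀ {F p G s H}, LettersCommute Γ p s → LStep Γ D F p G → R G s H →
    R F s (splice s H F) ∧ LStep Γ D (splice s H F) p H

/-- The new intermediate flag changes the `s`-part first. It is a flag because a change inside `p`
does not touch the neighbours of `s`. -/
theorem IsGammaGraph.swap_lstep (hM : IsGammaGraph Γ M) {F G H : V → M} {p s : Set V}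
    (hc : LettersCommute Γ p s) (h : LStep Γ D F p G) (h' : LStep Γ D G s H) :
    LStep Γ D F s (splice s H F) ∧ LStep Γ D (splice s H F) p H := by
  have hfl : IsFlagIn Γ D (splice s H F) := by
    refine hM.isFlagIn_splice h.1 h'.2.1 fun γ hγ δ hδ hadj => ?_
    rw [← h'.2.2 δ hδ, h.2.2 δ fun hp => (hc δ hp γ hγ).2 hadj.symm]
  refine ⟨⟨h.1, hfl, fun γ hγ => (splice_of_notMem hγ).symm⟩, hfl, h'.2.1, fun γ hγ => ?_⟩
  by_cases hs : γ ∈ s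
  · rw [splice_of_mem hs]
  · rw [splice_of_notMem hs, h.2.2 γ hγ, h'.2.2 γ hs]

theorem IsGammaGraph.swappable_lstep (hM : IsGammaGraph Γ M) : Swappable Γ D (LStep Γ D) where
  symm := LStep.symm
  swap := hM.swap_lstep

/-- The `p`-step affects neither `s` nor its neighbours, so the truth of the `s`-step is
transported. -/
theorem IsGammaGraph.swappable_tstep (hM : IsGammaGraph Γ M) : Swappable Γ D (TStep Γ D) where
  symm := TStep.symm
  swap := by
    intro F p G s H hc h h'
    obtain ⟨h1, h2⟩ := hM.swap_lstep hc h h'.1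
    refine ⟨hM.tstep_transport h' h1 (fun γ hγ => ?_) (fun γ hγ => ?_) (fun γ hγ δ hδ e => ?_), h2⟩
    · exact (h.2.2 γ fun hp => (hc γ hp γ hγ).1 rfl).symm
    · rw [splice_of_mem hγ]
    · exact (h.2.2 δ fun hp => (hc δ hp γ hγ).2 e.symm).symm

variable {R : (V → M) → Set V → (V → M) → Prop}

theorem Swappable.move_right (hR : Swappable Γ D R) {p : Set V} {w : List (Set V)}
    {F G H : V → M} (hc : ∀ t ∈ w, LettersCommute Γ p t) (h : LStep Γ D F p G)
    (hw : Chain R G w H) : ∃ K, Chain R F w K ∧ LStep Γ D K p H := by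
  induction w generalizing F G with
  | nil => obtain rfl := hw; exact ⟨F, rfl, h⟩
  | cons t w ih =>
    obtain ⟨G', h1, h2⟩ := hw
    obtain ⟨h3, h4⟩ := hR.swap (hc t (by simp)) h h1
    obtain ⟨K, h5, h6⟩ := ih (fun t ht => hc t (by simp [ht])) h4 h2
    exact ⟨K, ⟨_, h3, h5⟩, h6⟩

theorem Swappable.move_left (hR : Swappable Γ D R) {p : Set V} {w : List (Set V)}
    {F G H : V → M} (hc : ∀ t ∈ w, LettersCommute Γ p t) (hw : Chain R F w G)
    (h : LStep Γ D G p H) : ∃ K, LStep Γ D F p K ∧ Chain R K w H := by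
  obtain ⟨K, h1, h2⟩ := hR.move_right (w := w.reverse)
    (fun t ht => hc t (List.mem_reverse.1 ht)) h.symm (hw.reverse fun _ _ _ => hR.symm)
  refine ⟨K, h2.symm, ?_⟩
  have := h1.reverse fun _ _ _ => hR.symm
  rwa [List.reverse_reverse] at this

/-- The `p`-step is moved through the commuting block until it meets the `q`-step, which swallows
it. -/
theorem chain_absorb_right (hM : IsGammaGraph Γ M) {p q : Set V} {a b c : List (Set V)}
    {F G : V → M} (hpq : p ⊆ q) (hc : ∀ t ∈ b, LettersCommute Γ p t)
    (h : Chain (LStep Γ D) F (a ++ p :: (b ++ q :: c)) G) :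
    Chain (LStep Γ D) F (a ++ (b ++ q :: c)) G := by
  obtain ⟨H, h1, K, h2, h3⟩ := chain_append.1 h
  obtain ⟨L, h4, L', h5, h6⟩ := chain_append.1 h3
  obtain ⟨N, h7, h8⟩ := hM.swappable_lstep.move_right hc h2 h4
  exact h1.append (h7.append ⟨L', (h8.weaken hpq).trans h5, h6⟩)

theorem chain_absorb_left (hM : IsGammaGraph Γ M) {p q : Set V} {a b c : List (Set V)}
    {F G : V → M} (hpq : q ⊆ p) (hc : ∀ t ∈ b, LettersCommute Γ q t)
    (h : Chain (LStep Γ D) F (a ++ p :: (b ++ q :: c)) G) :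
    Chain (LStep Γ D) F (a ++ p :: (b ++ c)) G := by
  obtain ⟨H, h1, K, h2, h3⟩ := chain_append.1 h
  obtain ⟨L, h4, L', h5, h6⟩ := chain_append.1 h3
  obtain ⟨N, h7, h8⟩ := hM.swappable_lstep.move_left hc h4 h5
  exact h1.append ⟨N, h2.trans (h7.weaken hpq), h8.append h6⟩

/-- A true step absorbs a lazy step with a properly smaller set. -/
theorem TStep.absorb {F G H : V → M} {p q : Set V} (h : TStep Γ D F p G)
    (h' : LStep Γ D G q H) (hqp : q ⊂ p) : TStep Γ D F p H := by
  refine ⟨h.1.trans (h'.weaken hqp.subset), fun y hy hc => h.2 (y ++ [q]) ?_ ?_⟩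
  · intro t ht
    rcases List.mem_append.1 ht with ht | ht
    · exact hy t ht
    · rwa [List.mem_singleton.1 ht]
  · exact hc.append (chain_singleton.2 h'.symm)

/-- A lazy path consists of true steps, or one of its steps decomposes. -/
theorem chain_true_or_split {F G : V → M} {x : List (Set V)} (h : Chain (LStep Γ D) F x G) :
    Chain (TStep Γ D) F x G ∨ ∃ (a : List (Set V)) (q : Set V)
      (c y : List (Set V)), x = a ++ q :: c ∧ (∀ t ∈ y, t ⊂ q) ∧
      Chain (LStep Γ D) F (a ++ (y ++ c)) G := by
  induction x generalizing F with
  | nil => exact Or.inl h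
  | cons s x ih =>
    obtain ⟨H, h1, h2⟩ := h
    by_cases ht : TStep Γ D F s H
    · rcases ih h2 with h3 | ⟨a, q, c, y, rfl, hy, h3⟩
      · exact Or.inl ⟨H, ht, h3⟩
      · exact Or.inr ⟨s :: a, q, c, y, rfl, hy, H, h1, h3⟩
    · right
      unfold TStep at ht
      push Not at ht
      obtain ⟨y, hy, hc⟩ := ht h1
      exact ⟨[], s, x, y, rfl, hy, hc.append h2⟩

/-- Every lazy path can be replaced by a reduced path of true steps. -/
theorem IsGammaGraph.exists_reduced [Finite V] (hM : IsGammaGraph Γ M) {F G : V → M}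
    {x : List (Set V)} (h : Chain (LStep Γ D) F x G) :
    ∃ w, Chain (TStep Γ D) F w G ∧ WordReduced Γ w ∧ ∀ p ∈ w, ∃ q ∈ x, p ⊆ q := by
  revert h
  -- A step that is not true is replaced by smaller letters, and a redundant letter is absorbed;
  -- both make the word smaller.
  refine wellFounded_wordLT.induction (C := fun x => Chain (LStep Γ D) F x G → ∃ w,
    Chain (TStep Γ D) F w G ∧ WordReduced Γ w ∧ ∀ p ∈ w, ∃ q ∈ x, p ⊆ q) x fun x ih h => ?_
  rcases chain_true_or_split h with ht | ⟨a, q, c, y, rfl, hy, hc⟩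
  · by_cases hr : WordReduced Γ x
    · exact ⟨x, ht, hr, fun p hp => ⟨p, hp, le_rfl⟩⟩
    · unfold WordReduced at hr
      push Not at hr
      obtain ⟨a, p, b, q, c, rfl, ⟨h1, h2⟩ | ⟨h1, h2⟩⟩ := hr
      · obtain ⟨w, hw, hr, hs⟩ := ih _ (wordLT_delete _ _ _) (chain_absorb_right hM h1 h2 h)
        exact ⟨w, hw, hr, fun p hp => by
          obtain ⟨q, hq, h⟩ := hs p hp; exact ⟨q, by simp at hq ⊢; tauto, h⟩⟩
      · obtain ⟨w, hw, hr, hs⟩ := ih (a ++ p :: (b ++ c)) (by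
          simpa using wordLT_delete (a ++ p :: b) c q) (chain_absorb_left hM h1 h2 h)
        exact ⟨w, hw, hr, fun p hp => by
          obtain ⟨q, hq, h⟩ := hs p hp; exact ⟨q, by simp at hq ⊢; tauto, h⟩⟩
  · obtain ⟨w, hw, hr, hs⟩ := ih _ (by simpa using wordLT_replace a c hy) hc
    refine ⟨w, hw, hr, fun p hp => ?_⟩
    obtain ⟨r, hr, h⟩ := hs p hp
    simp only [List.mem_append] at hr
    rcases hr with hr | hr | hr
    · exact ⟨r, by simp [hr], h⟩
    · exact ⟨q, by simp, h.trans (hy r hr).subset⟩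
    · exact ⟨r, by simp [hr], h⟩

end Steps

/-! ### The covering lemma for reduced paths -/

section Covering

variable {V : Type u} {Γ : SimpleGraph V} {M : Type v} [(gammaLang V).Structure M] {D : Set M}

variable (Γ D) in
/-- The subgraph on `D` is simply connected. -/
def SimplyConnectedOn : Prop :=
  ∀ (F : V → M) (w : List (Set V)), IsFlagIn Γ D F → Chain (TStep Γ D) F w F →
    WordReduced Γ w → w = []

theorem IsGammaGraph.isSimplyConnected_iff [Finite V] (hM : IsGammaGraph Γ M) :
    IsSimplyConnected Γ M ↔ SimplyConnectedOn Γ (Set.univ : Set M) := by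
  unfold IsSimplyConnected SimplyConnectedOn
  simp only [hM.isFlagPath_iff, isReduced_iff_wordReduced, and_imp]

/-- `L` assigns to the letters of a word labels of letters of `X` that contain them, reversing the
order of letters that do not commute. -/
structure IsCovering (Γ : SimpleGraph V) (w : List (Set V)) (X L : List (Set V × ℕ)) : Prop where
  word : L.map Prod.fst = w
  le : ∀ a ∈ L, ∃ b ∈ X, a.1 ⊆ b.1 ∧ a.2 = b.2
  order : L.Pairwise fun a b => ¬ LettersCommute Γ a.1 b.1 → b.2 ≤ a.2

theorem IsCovering.of_le {w : List (Set V)} {X X' L : List (Set V × ℕ)} (h : IsCovering Γ w X L)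
    (hX : ∀ a ∈ X, ∃ b ∈ X', a.1 ⊆ b.1 ∧ a.2 = b.2) : IsCovering Γ w X' L := by
  refine ⟨h.word, fun a ha => ?_, h.order⟩
  obtain ⟨b, hb, h1, h2⟩ := h.le a ha
  obtain ⟨c, hc, h3, h4⟩ := hX b hb
  exact ⟨c, hc, h1.trans h3, h2.trans h4⟩

/-- The letter `p` receives the label of `q`. Later letters commute with `p` and impose nothing. An
earlier letter that does not commute with `p` cannot lie inside a letter of `X₁`, so its label comes
from `q` or beyond and is at least `i`. -/
theorem IsCovering.insert {w₁ w₂ : List (Set V)} {p q : Set V} {i : ℕ}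
    {X₁ X₂ L : List (Set V × ℕ)} (h : IsCovering Γ (w₁ ++ w₂) (X₁ ++ (q, i) :: X₂) L)
    (hX : (X₁ ++ (q, i) :: X₂).Pairwise fun a b => a.2 ≤ b.2) (hpq : p ⊆ q)
    (hw : ∀ t ∈ w₂, LettersCommute Γ p t) (hx : ∀ t ∈ X₁, LettersCommute Γ p t.1) :
    ∃ L', IsCovering Γ (w₁ ++ p :: w₂) (X₁ ++ (q, i) :: X₂) L' := by
  obtain ⟨L₁, L₂, rfl, rfl, rfl⟩ := List.map_eq_append_iff.1 h.word
  refine ⟨L₁ ++ (p, i) :: L₂, by simp, ?_, ?_⟩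
  · intro a ha
    simp only [List.mem_append, List.mem_cons] at ha
    rcases ha with ha | rfl | ha
    · exact h.le a (by simp [ha])
    · exact ⟨(q, i), by simp, hpq, rfl⟩
    · exact h.le a (by simp [ha])
  · have ho := h.order
    rw [List.pairwise_append] at ho hX ⊢
    refine ⟨ho.1, List.pairwise_cons.2 ⟨fun a ha hn => ?_, ho.2.1⟩, fun a ha b hb hn => ?_⟩
    · exact absurd (hw a.1 (List.mem_map_of_mem ha)) hn
    · rcases List.mem_cons.1 hb with rfl | hb
      · obtain ⟨c, hc, h1, h2⟩ := h.le a (by simp [ha])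
        rw [h2]
        simp only [List.mem_append, List.mem_cons] at hc
        rcases hc with hc | rfl | hc
        · exact absurd ((hx c hc).symm.mono h1 le_rfl) hn
        · exact le_rfl
        · exact (List.pairwise_cons.1 hX.2.1).1 c hc
      · exact ho.2.2 a ha b hb hn

/-- Simple connectedness says that `w` followed by the return path cannot be a non-trivial reduced
path of true steps. Some reduction therefore applies, inside the return path or between the two
words, and each reduction lets a covering of the smaller situation be carried back. The induction is
on the length of `w` and, for fixed length, on the return word. -/
theorem covering [Finite V] (hM : IsGammaGraph Γ M) (hD : SimplyConnectedOn Γ D)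
    {w : List (Set V)} {X : List (Set V × ℕ)} {F G : V → M} (hF : IsFlagIn Γ D F)
    (hX : X.Pairwise fun a b => a.2 ≤ b.2) (hw : Chain (TStep Γ D) F w G) (hr : WordReduced Γ w)
    (hx : Chain (LStep Γ D) G (X.map Prod.fst) F) : ∃ L, IsCovering Γ w X L := by
  induction hn : w.length using Nat.strong_induction_on generalizing w X F G with
  | _ n ihn =>
  subst hn
  have wf : WellFounded (fun X Y : List (Set V × ℕ) => wordLT (X.map Prod.fst) (Y.map Prod.fst)) :=
    InvImage.wf (fun X : List (Set V × ℕ) => X.map Prod.fst) wellFounded_wordLT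
  revert G
  induction X using wf.induction with
  | _ X ih =>
  intro G hw hx
  rcases chain_true_or_split hx with ht | ⟨a, q, c, y, he, hy, hc⟩
  · by_cases hrX : WordReduced Γ (X.map Prod.fst)
    · by_cases hrr : WordReduced Γ (w ++ X.map Prod.fst)
      -- The closed path is reduced, hence trivial, and nothing has to be covered.
      · have := hD F _ hF (hw.append ht) hrr
        obtain rfl : w = [] := (List.append_eq_nil_iff.1 this).1
        exact ⟨[], rfl, by simp, by simp⟩
      · obtain ⟨w₁, p, w₂, x₁, q, x₂, rfl, he, hc⟩ := exists_of_not_wordReduced_append hr hrX hrr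
        obtain ⟨X₁, Y, rfl, rfl, hY⟩ := List.map_eq_append_iff.1 he
        obtain ⟨⟨q', i⟩, X₂, rfl, rfl, rfl⟩ := List.map_eq_cons_iff.1 hY
        rw [List.map_append, List.map_cons] at hx
        -- The `p`-step is moved to the end of `w` and absorbed by `q'`. The shorter word is covered
        -- by induction, and `p` is inserted with the label of `q'`.
        have case1 : p ⊆ q' → (∀ t ∈ w₂, LettersCommute Γ p t) →
            (∀ t ∈ X₁.map Prod.fst, LettersCommute Γ p t) →
            ∃ L, IsCovering Γ (w₁ ++ p :: w₂) (X₁ ++ (q', i) :: X₂) L := by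
          intro h1 h2 h3
          obtain ⟨H, h4, K, h5, h6⟩ := chain_append.1 hw
          obtain ⟨N, h7, h8⟩ := hM.swappable_tstep.move_right h2 h5.1 h6
          have h9 := chain_absorb_right hM (a := []) h1 h3 ⟨G, h8, hx⟩
          obtain ⟨L, hL⟩ := ihn (w₁ ++ w₂).length (by simp) (X := X₁ ++ (q', i) :: X₂) hF hX
            (h4.append h7) (hr.delete h2) (by simpa using h9) rfl
          exact hL.insert hX h1 h2 fun t ht => h3 _ (List.mem_map_of_mem ht)
        rcases hc with ⟨h1, h2, h3⟩ | ⟨h1, h2, h3⟩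
        · exact case1 h1 h2 h3
        · by_cases hqp : q' = p
          · subst hqp; exact case1 h1 h2 h3
          -- Here the true `p`-step swallows the smaller `q'`-step and stays true: `w` is kept and
          -- the return path loses a letter. The common flag of the two paths moves from `G` to `N`,
          -- so the inner induction must allow `G` to vary.
          · have hss : q' ⊂ p := lt_of_le_of_ne h1 hqp
            obtain ⟨H, h4, K, h5, h6⟩ := chain_append.1 hx
            obtain ⟨N, h7, h8⟩ := hM.swappable_lstep.move_left h3 h4 h5
            obtain ⟨A, k1, B, k2, k3⟩ := chain_append.1 hw
            obtain ⟨C, k4, k5⟩ := hM.swappable_tstep.move_left h2 k3 h7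
            have hw' : Chain (TStep Γ D) F (w₁ ++ p :: w₂) N :=
              k1.append ⟨C, k2.absorb k4 hss, k5⟩
            obtain ⟨L, hL⟩ := ih (X₁ ++ X₂) (by simpa using wordLT_delete _ _ _)
              (hX.sublist (by simp)) hw' (by simpa using h8.append h6)
            refine ⟨L, hL.of_le fun a ha => ⟨a, ?_, le_rfl, rfl⟩⟩
            simp at ha ⊢; tauto
    · unfold WordReduced at hrX
      push Not at hrX
      obtain ⟨a, p, b, q, c, he, hc⟩ := hrX
      obtain ⟨A, Y, rfl, rfl, hY⟩ := List.map_eq_append_iff.1 he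
      obtain ⟨P, Y', rfl, rfl, hY'⟩ := List.map_eq_cons_iff.1 hY
      obtain ⟨B, Y'', rfl, rfl, hY''⟩ := List.map_eq_append_iff.1 hY'
      obtain ⟨Q, C, rfl, rfl, rfl⟩ := List.map_eq_cons_iff.1 hY''
      rw [he] at hx
      rcases hc with ⟨h1, h2⟩ | ⟨h1, h2⟩
      · obtain ⟨L, hL⟩ := ih (A ++ (B ++ Q :: C)) (by simpa using wordLT_delete _ _ _)
          (hX.sublist (by simp)) hw (by simpa using chain_absorb_right hM h1 h2 hx)
        refine ⟨L, hL.of_le fun a ha => ⟨a, ?_, le_rfl, rfl⟩⟩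
        simp at ha ⊢; tauto
      · obtain ⟨L, hL⟩ := ih (A ++ P :: (B ++ C))
          (by simpa using wordLT_delete (A.map Prod.fst ++ P.1 :: B.map Prod.fst) _ _)
          (hX.sublist (by simp)) hw (by simpa using chain_absorb_left hM h1 h2 hx)
        refine ⟨L, hL.of_le fun a ha => ⟨a, ?_, le_rfl, rfl⟩⟩
        simp at ha ⊢; tauto
  -- The pieces of a decomposed step all keep its label, so labels remain monotone and containments
  -- persist.
  · obtain ⟨A, Y, rfl, rfl, hY⟩ := List.map_eq_append_iff.1 he
    obtain ⟨⟨q', i⟩, C, rfl, rfl, rfl⟩ := List.map_eq_cons_iff.1 hY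
    obtain ⟨L, hL⟩ := ih (A ++ (y.map (fun t => (t, i)) ++ C))
      (by simpa [Function.comp_def] using wordLT_replace (A.map Prod.fst) (C.map Prod.fst) hy) (by
        simp only [List.pairwise_append, List.pairwise_cons, List.mem_cons, List.mem_append,
          List.mem_map] at hX ⊢
        refine ⟨hX.1, ⟨?_, hX.2.1.2, ?_⟩, ?_⟩
        · exact List.pairwise_map.2 (List.pairwise_of_forall fun _ _ => le_rfl)
        · rintro _ ⟨t, -, rfl⟩ b hb; exact hX.2.1.1 b hb
        · rintro a ha b (⟨t, -, rfl⟩ | hb)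
          · exact hX.2.2 a ha (q', i) (Or.inl rfl)
          · exact hX.2.2 a ha b (Or.inr hb)) hw (by
        simpa [Function.comp_def] using hc)
    refine ⟨L, hL.of_le fun a ha => ?_⟩
    simp only [List.mem_append, List.mem_map] at ha
    rcases ha with ha | ⟨t, ht, rfl⟩ | ha
    · exact ⟨a, by simp [ha], le_rfl, rfl⟩
    · exact ⟨(q', i), by simp, (hy t ht).subset, rfl⟩
    · exact ⟨a, by simp [ha], le_rfl, rfl⟩

/-- The letters of a reduced path consist of colours at which its end points differ. -/
theorem letter_subset_of_lstep [Finite V] (hM : IsGammaGraph Γ M) (hD : SimplyConnectedOn Γ D)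
    {w : List (Set V)} {F G : V → M} {s : Set V} (hw : Chain (TStep Γ D) F w G)
    (hr : WordReduced Γ w) (h : LStep Γ D F s G) {t : Set V} (ht : t ∈ w) : t ⊆ s := by
  obtain ⟨L, hL⟩ := covering hM hD (X := [(s, 0)]) h.1 (by simp) hw hr
    (by simpa using h.symm)
  rw [← hL.word] at ht
  obtain ⟨a, ha, rfl⟩ := List.mem_map.1 ht
  obtain ⟨b, hb, h1, -⟩ := hL.le a ha
  rw [List.mem_singleton.1 hb] at h1
  exact h1

theorem chain_ne_of_mem {w : List (Set V)} {F G : V → M} {γ : V}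
    (hw : Chain (LStep Γ D) F w G) (h : ∀ t ∈ w, γ ∉ t) : F γ = G γ := by
  induction w generalizing F with
  | nil => rw [hw]
  | cons s w ih =>
    obtain ⟨H, h1, h2⟩ := hw
    exact (h1.2.2 γ (h s (by simp))).trans (ih h2 fun t ht => h t (by simp [ht]))

theorem Chain.lstep {w : List (Set V)} {F G : V → M} (h : Chain (TStep Γ D) F w G) :
    Chain (LStep Γ D) F w G := h.mono fun _ _ _ => And.left

theorem ne_of_mem_letter [Finite V] (hM : IsGammaGraph Γ M) (hD : SimplyConnectedOn Γ D)
    {w : List (Set V)} {F G : V → M} (hF : IsFlagIn Γ D F) (hG : IsFlagIn Γ D G)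
    (hw : Chain (TStep Γ D) F w G) (hr : WordReduced Γ w) {t : Set V} (ht : t ∈ w) {γ : V}
    (hγ : γ ∈ t) : F γ ≠ G γ :=
  letter_subset_of_lstep hM hD hw hr (lstep_of_diffSet hF hG) ht hγ

end Covering

/-! ### Generic extensions of nice sets -/

section SimpleExtension

variable {V : Type u} {Γ : SimpleGraph V} {M : Type v} [(gammaLang V).Structure M]
  {D B : Set M}

theorem IsLetter.induction {s : Set V} (hs : IsLetter Γ s) {P : V → Prop} {γ : V} (hγ : γ ∈ s)
    (h : P γ) (hP : ∀ δ ∈ s, ∀ ε ∈ s, Γ.Adj δ ε → P δ → P ε) : ∀ δ ∈ s, P δ := by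
  have key : ∀ x y : s, (Γ.induce s).Walk x y → P x → P y := by
    intro x y p
    induction p with
    | nil => exact id
    | cons hadj _ ih => exact fun hx => ih (hP _ (Subtype.prop _) _ (Subtype.prop _) hadj hx)
  intro δ hδ
  obtain ⟨p⟩ := hs.preconnected ⟨γ, hγ⟩ ⟨δ, hδ⟩
  exact key _ _ p h

/-- If a reduced path involves the colour `δ` no later than the adjacent colour `γ`, then no
flag contains both the initial vertex of colour `δ` and the final vertex of colour `γ`. -/
theorem no_common_flag [Finite V] (hM : IsGammaGraph Γ M) (hD : SimplyConnectedOn Γ D)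
    {u : List (Set V)} {F G H : V → M} (hF : IsFlagIn Γ D F) (hG : IsFlagIn Γ D G)
    (hH : IsFlagIn Γ D H)
    (hu : Chain (TStep Γ D) F u G) (hr : WordReduced Γ u) {γ δ : V} (hadj : Γ.Adj γ δ)
    (hδ : H δ = F δ) (hγ : H γ = G γ)
    (h : (∃ t ∈ u, γ ∈ t ∧ δ ∈ t) ∨
      ∃ a t b r c, u = a ++ t :: (b ++ r :: c) ∧ δ ∈ t ∧ γ ∈ r) : False := by
  -- The return path goes from `G` to `H` keeping the colour `γ`, and from `H` to `F` keeping `δ`. A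
  -- letter with `γ` thus has label 1 and one with `δ` has label 0, against the reversed order.
  obtain ⟨L, hL⟩ := covering hM hD (X := [(({γ}ᶜ : Set V), 0), (({δ}ᶜ : Set V), 1)]) hF (by simp)
    hu hr (by
      refine ⟨H, ⟨hG, hH, fun ε hε => ?_⟩, F, ⟨hH, hF, fun ε hε => ?_⟩, rfl⟩ <;>
      · simp at hε; subst hε; first | exact hγ.symm | exact hδ)
  have lab : ∀ a ∈ L, (γ ∈ a.1 → a.2 = 1) ∧ (δ ∈ a.1 → a.2 = 0) := by
    intro a ha
    obtain ⟨b, hb, h1, h2⟩ := hL.le a ha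
    simp only [List.mem_cons, List.not_mem_nil, or_false] at hb
    rcases hb with rfl | rfl
    · exact ⟨fun h => absurd rfl (h1 h), fun _ => h2⟩
    · exact ⟨fun _ => h2, fun h => absurd rfl (h1 h)⟩
  rcases h with ⟨t, ht, h1, h2⟩ | ⟨a, t, b, r, c, rfl, h1, h2⟩
  · rw [← hL.word] at ht
    obtain ⟨a, ha, rfl⟩ := List.mem_map.1 ht
    have := (lab a ha).1 h1
    have := (lab a ha).2 h2
    omega
  · obtain ⟨A, Y, rfl, rfl, hY⟩ := List.map_eq_append_iff.1 hL.word
    obtain ⟨P, Y', rfl, rfl, hY'⟩ := List.map_eq_cons_iff.1 hY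
    obtain ⟨B, Y'', rfl, rfl, hY''⟩ := List.map_eq_append_iff.1 hY'
    obtain ⟨Q, C, rfl, rfl, rfl⟩ := List.map_eq_cons_iff.1 hY''
    have ho := hL.order
    rw [List.pairwise_append, List.pairwise_cons] at ho
    have := ho.2.1.1 Q (by simp) (fun hc => (hc δ h1 γ h2).2 hadj.symm)
    have := (lab P (by simp)).2 h1
    have := (lab Q (by simp)).1 h2
    omega

theorem IsNice.tstep [Finite V] (hM : IsGammaGraph Γ M) (hB : IsNice Γ B) {F G : V → M}
    {s : Set V} (h : TStep Γ B F s G) : TStep Γ Set.univ F s G :=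
  hM.isFlagStep_iff.1 (hB.step F G s (hM.isFlagStep_iff.2 h))

theorem IsFlagIn.mono {D' : Set M} (hD : D ⊆ D') {F : V → M} (h : IsFlagIn Γ D F) :
    IsFlagIn Γ D' F := ⟨h.1, fun γ => hD (h.2 γ)⟩

variable (Γ B) in
/-- `G` is a generic extension of the flag `F` of `B` by the letter `s`: it is connected by true
steps to all flags of `B` in the same `s`-residue. -/
structure IsGenericOver (F : V → M) (s : Set V) (G : V → M) : Prop where
  flag : IsFlagIn Γ B F
  step : LStep Γ Set.univ F s G
  far : ∀ F', IsFlagIn Γ B F' → LStep Γ Set.univ F' s G → TStep Γ Set.univ F' s G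

variable {F G : V → M} {s : Set V}

theorem IsGenericOver.tstep (h : IsGenericOver Γ B F s G) : TStep Γ Set.univ F s G :=
  h.far F h.flag h.step

theorem IsGenericOver.change (h : IsGenericOver Γ B F s G) {F' : V → M}
    (h' : LStep Γ B F' s F) : IsGenericOver Γ B F' s G :=
  ⟨h'.1, (h'.mono (Set.subset_univ _)).trans h.step, h.far⟩

/-- The reduced path from a flag of `B` to a generic extension. -/
theorem IsGenericOver.exists_path [Finite V] (hM : IsGammaGraph Γ M) (hB : IsNice Γ B)
    (h : IsGenericOver Γ B F s G) {F' : V → M} (hF' : IsFlagIn Γ B F') :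
    ∃ K u v, LStep Γ B F s K ∧ Chain (TStep Γ B) F' v K ∧ Chain (TStep Γ Set.univ) F' u G ∧
      WordReduced Γ u ∧ (u = v ++ [s] ∨ ∃ v₁ p v₂, u = v ∧ v = v₁ ++ p :: v₂ ∧ s ⊆ p ∧
        ∀ t ∈ v₂, LettersCommute Γ s t) := by
  obtain ⟨v, hv, hr, -⟩ := hM.exists_reduced (chain_singleton.2 (lstep_of_diffSet hF' h.flag))
  induction hn : v.length using Nat.strong_induction_on generalizing F v with
  | _ n ih =>
  subst hn
  have hvu : Chain (TStep Γ Set.univ) F' v F := hv.mono fun _ _ _ => hB.tstep hM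
  -- The path `v` inside `B` is prolonged by the true `s`-step; if the word is not reduced, the
  -- redundancy involves this last `s`.
  by_cases hvs : WordReduced Γ (v ++ [s])
  · exact ⟨F, v ++ [s], v, .refl h.flag _, hv, hvu.append (chain_singleton.2 h.tstep), hvs,
      Or.inl rfl⟩
  · obtain ⟨v₁, p, v₂, x₁, q, x₂, rfl, he, hc⟩ :=
      exists_of_not_wordReduced_append hr (wordReduced_singleton s) hvs
    obtain ⟨rfl, rfl, rfl⟩ : x₁ = [] ∧ q = s ∧ x₂ = [] := by
      cases x₁ with
      | nil => simp at he; simp [he.1, he.2]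
      | cons a x₁ => simp at he
    obtain ⟨A, k1, C, k2, k3⟩ := chain_append.1 hv
    have case1 : p ⊆ q → (∀ t ∈ v₂, LettersCommute Γ p t) →
        ∃ K u v, LStep Γ B F q K ∧ Chain (TStep Γ B) F' v K ∧
          Chain (TStep Γ Set.univ) F' u G ∧ WordReduced Γ u ∧
          (u = v ++ [q] ∨ ∃ v₁ p v₂, u = v ∧ v = v₁ ++ p :: v₂ ∧ q ⊆ p ∧
            ∀ t ∈ v₂, LettersCommute Γ q t) := by
      intro h1 h2
      -- With the `p`-step moved to the end, the flag `N` before it lies in the same residue and is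
      -- another base flag for `G`, reached by a shorter path.
      obtain ⟨N, h7, h8⟩ := hM.swappable_tstep.move_right h2 k2.1 k3
      obtain ⟨K, u, v, h9, h10⟩ := ih (v₁ ++ v₂).length (by simp)
        (h.change (h8.weaken h1)) (v₁ ++ v₂) (k1.append h7) (hr.delete h2) rfl
      exact ⟨K, u, v, (h8.weaken h1).symm.trans h9, h10⟩
    rcases hc with ⟨h1, h2, -⟩ | ⟨h1, h2, -⟩
    · exact case1 h1 h2
    · by_cases hqp : q = p
      · subst hqp; exact case1 h1 h2
      -- Now the `s`-step moves left and disappears in the larger `p`-step: the same word leads to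
      -- `F` inside `B` and to `G` inside `M`.
      · obtain ⟨A, k1, C, k2, k3⟩ := chain_append.1 hvu
        obtain ⟨N, h7, h8⟩ := hM.swappable_tstep.move_left h2 k3 h.step
        exact ⟨F, v₁ ++ p :: v₂, v₁ ++ p :: v₂, .refl h.flag _, hv,
          k1.append ⟨N, k2.absorb h7 (lt_of_le_of_ne h1 hqp), h8⟩, hr,
          Or.inr ⟨v₁, p, v₂, rfl, rfl, h1, h2⟩⟩

/-- The reduced path from `F'` to `G` has a letter containing `s`, and colours of letters of a
reduced path do change between its ends. -/
theorem IsGenericOver.ne_of_flag [Finite V] (hM : IsGammaGraph Γ M)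
    (hsc : SimplyConnectedOn Γ (Set.univ : Set M)) (hB : IsNice Γ B)
    (h : IsGenericOver Γ B F s G) {F' : V → M} (hF' : IsFlagIn Γ B F') {γ : V} (hγ : γ ∈ s) :
    F' γ ≠ G γ := by
  obtain ⟨K, u, v, -, hv, hu, hr, hc⟩ := h.exists_path hM hB hF'
  rcases hc with rfl | ⟨v₁, p, v₂, rfl, rfl, hp, -⟩
  · exact ne_of_mem_letter hM hsc (hF'.mono (Set.subset_univ _)) h.step.2.1 hu hr
      (t := s) (by simp) hγ
  · exact ne_of_mem_letter hM hsc (hF'.mono (Set.subset_univ _)) h.step.2.1 hu hr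
      (t := p) (by simp) (hp hγ)

theorem IsGenericOver.notMem [Finite V] (hM : IsGammaGraph Γ M)
    (hsc : SimplyConnectedOn Γ (Set.univ : Set M)) (hB : IsNice Γ B)
    (h : IsGenericOver Γ B F s G) {γ : V} (hγ : γ ∈ s) : G γ ∉ B := by
  intro hG
  obtain ⟨F', hF', δ, hδ⟩ := hB.vertex_flag _ hG
  obtain rfl : δ = γ := hM.colour_unique (hδ ▸ hF'.1.1 δ) (h.step.2.1.1.1 γ)
  exact h.ne_of_flag hM hsc hB hF' hγ hδ

/-- The edge lies in a common flag `H`. Otherwise the reduced path from a flag of `B` through `b` to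
`G` would change `δ` together with `γ` or before it, which `no_common_flag` excludes. -/
theorem IsGenericOver.eq_of_adj [Finite V] (hM : IsGammaSpace Γ M)
    (hsc : SimplyConnectedOn Γ (Set.univ : Set M)) (hB : IsNice Γ B)
    (h : IsGenericOver Γ B F s G) {γ δ : V} (hγ : γ ∈ s) {b : M} (hb : b ∈ B)
    (hδ : HasColour δ b) (hadj : Adj V (G γ) b) : δ ∉ s ∧ b = F δ := by
  have hM' := hM.toIsGammaGraph
  by_contra hne
  obtain ⟨F', hF', δ', rfl⟩ := hB.vertex_flag _ hb
  obtain rfl : δ' = δ := hM'.colour_unique (hF'.1.1 δ') hδ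
  obtain ⟨H, hH, ⟨ε, hε⟩, ⟨ε', hε'⟩⟩ := hM.edge_flag _ _ hadj
  obtain rfl : ε = γ := hM'.colour_unique (hε ▸ hH.1 ε) (h.step.2.1.1.1 γ)
  obtain rfl : ε' = δ' := hM'.colour_unique (hε' ▸ hH.1 ε') hδ
  have hΓ : Γ.Adj ε ε' := hM'.edge_colour _ _ _ _ (h.step.2.1.1.1 ε) hδ hadj
  obtain ⟨K, u, v, hK, hv, hu, hr, hc⟩ := h.exists_path hM' hB hF'
  refine no_common_flag hM' hsc (hF'.mono (Set.subset_univ _)) h.step.2.1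
    ⟨hH, fun _ => trivial⟩ hu hr hΓ hε' hε ?_
  by_cases hs : ε' ∈ s
  · left
    rcases hc with rfl | ⟨v₁, p, v₂, rfl, rfl, hp, -⟩
    · exact ⟨s, by simp, hγ, hs⟩
    · exact ⟨p, by simp, hp hγ, hp hs⟩
  · have hne' : F' ε' ≠ K ε' := by
      rw [← hK.2.2 ε' hs]; exact fun e => hne ⟨hs, e⟩
    have : ∃ t ∈ v, ε' ∈ t := by
      by_contra hcon
      push Not at hcon
      exact hne' (chain_ne_of_mem hv.lstep hcon)
    obtain ⟨t, ht, hεt⟩ := this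
    rcases hc with rfl | ⟨v₁, p, v₂, rfl, rfl, hp, hcomm⟩
    · obtain ⟨a, b, rfl⟩ := List.append_of_mem ht
      exact Or.inr ⟨a, t, b, s, [], by simp, hεt, hγ⟩
    · simp only [List.mem_append, List.mem_cons] at ht
      rcases ht with ht | rfl | ht
      · obtain ⟨a, b, rfl⟩ := List.append_of_mem ht
        exact Or.inr ⟨a, t, b, p, v₂, by simp, hεt, hp hγ⟩
      · exact Or.inl ⟨t, by simp, hp hγ, hεt⟩
      · exact absurd hΓ (hcomm t ht ε hγ ε' hεt).2

/-- Once a flag contains one new vertex, connectedness of `s` and `IsGenericOver.eq_of_adj` force it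
to contain all of them and to agree with `F` next to `s`. Replacing the `s`-part by that of `F`
retracts it to `B`. -/
theorem IsGenericOver.flagIn_union [Finite V] (hM : IsGammaSpace Γ M)
    (hsc : SimplyConnectedOn Γ (Set.univ : Set M)) (hB : IsNice Γ B)
    (h : IsGenericOver Γ B F s G) {H : V → M} (hH : IsFlagIn Γ (B ∪ Set.range G) H) :
    IsFlagIn Γ B H ∨ (∀ γ ∈ s, H γ = G γ) ∧ (∀ γ ∈ s, ∀ δ, δ ∉ s → Γ.Adj γ δ → H δ = F δ) ∧
      IsFlagIn Γ B (splice s F H) := by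
  have hM' := hM.toIsGammaGraph
  have hs : IsLetter Γ s := (hM'.isFlagStep_iff.2 h.tstep).2.2.1
  have hnB : ∀ γ, H γ ∉ B → H γ = G γ ∧ γ ∈ s := by
    intro γ hγ
    obtain ⟨δ, hδ⟩ := (hH.2 γ).resolve_left hγ
    obtain rfl : δ = γ := hM'.colour_unique (h.step.2.1.1.1 δ) (hδ ▸ hH.1.1 γ)
    refine ⟨hδ.symm, by_contra fun hs => hγ ?_⟩
    rw [← hδ, ← h.step.2.2 δ hs]
    exact h.flag.2 δ
  by_cases hall : ∀ γ, H γ ∈ B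
  · exact Or.inl ⟨hH.1, hall⟩
  right
  push Not at hall
  obtain ⟨γ, hγ⟩ := hall
  have h1 : ∀ δ ∈ s, H δ = G δ := by
    refine hs.induction (hnB γ hγ).2 (hnB γ hγ).1 fun δ hδ ε hε hadj hP => ?_
    by_contra hne
    have hb : H ε ∈ B := by_contra fun hb => hne (hnB ε hb).1
    refine (h.eq_of_adj hM hsc hB hδ hb (hH.1.1 ε) ?_).1 hε
    rw [← hP]; exact (hH.1.2 _ _).2 hadj
  have h2 : ∀ γ ∈ s, ∀ δ, δ ∉ s → Γ.Adj γ δ → H δ = F δ := by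
    intro γ hγ δ hδ hadj
    have hb : H δ ∈ B := by_contra fun hb => hδ (hnB δ hb).2
    refine (h.eq_of_adj hM hsc hB hγ hb (hH.1.1 δ) ?_).2
    rw [← h1 γ hγ]; exact (hH.1.2 _ _).2 hadj
  refine ⟨h1, h2, (hM'.isFlagIn_splice (D := Set.univ) ⟨hH.1, fun _ => trivial⟩
    ⟨h.flag.1, fun _ => trivial⟩ fun γ hγ δ hδ hadj => (h2 γ hγ δ hδ hadj).symm).1, fun δ => ?_⟩
  by_cases hδ : δ ∈ s
  · rw [splice_of_mem hδ]; exact h.flag.2 δ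
  · rw [splice_of_notMem hδ]; exact by_contra fun hb => hδ (hnB δ hb).2

/-- A nice set remains nice after adding a generic extension of one of its flags. -/
theorem IsGenericOver.isNice [Finite V] (hM : IsGammaSpace Γ M)
    (hsc : SimplyConnectedOn Γ (Set.univ : Set M)) (hB : IsNice Γ B)
    (h : IsGenericOver Γ B F s G) : IsNice Γ (B ∪ Set.range G) := by
  have hM' := hM.toIsGammaGraph
  have hBB : B ⊆ B ∪ Set.range G := Set.subset_union_left
  have case2 : ∀ (F₁ F₂ : V → M) (t : Set V), IsFlagIn Γ B F₁ → (∀ γ ∈ s, F₂ γ = G γ) →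
      (∀ γ ∈ s, ∀ δ, δ ∉ s → Γ.Adj γ δ → F₂ δ = F δ) → IsFlagIn Γ B (splice s F F₂) →
      TStep Γ (B ∪ Set.range G) F₁ t F₂ → TStep Γ Set.univ F₁ t F₂ := by
    intro F₁ F₂ t h1 h2 h3 h4 hst
    have hsub : s ⊆ t := by
      intro γ hγ
      rw [← hst.diffSet_eq]
      change F₁ γ ≠ F₂ γ
      rw [h2 γ hγ]
      exact h.ne_of_flag hM' hsc hB h1 hγ
    have hsp : LStep Γ (B ∪ Set.range G) (splice s F F₂) s F₂ :=
      ⟨h4.mono hBB, hst.1.2.1, fun γ hγ => splice_of_notMem hγ⟩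
    by_cases hts : s = t
    · subst hts
      -- This flag of `B` lies in the `s`-residue of `G` and looks like `F₁` on `s` and next to `s`,
      -- so the truth supplied by `far` can be transported.
      have hfl : IsFlagIn Γ B (splice s F₁ F) := hM'.isFlagIn_splice h.flag h1
        fun γ hγ δ hδ hadj => (hst.1.2.2 δ hδ).trans (h3 γ hγ δ hδ hadj)
      have hT := h.far _ hfl ⟨hfl.mono (Set.subset_univ _), h.step.2.1, fun γ hγ => by
        rw [splice_of_notMem hγ, h.step.2.2 γ hγ]⟩
      refine hM'.tstep_transport hT (hst.1.mono (Set.subset_univ _))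
        (fun γ hγ => splice_of_mem hγ) (fun γ hγ => (h2 γ hγ).symm) fun γ hγ δ hδ hadj => ?_
      rw [splice_of_notMem hδ, hst.1.2.2 δ hδ, h3 γ hγ δ hδ hadj]
    -- The flag `F₂` and its retraction to `B` differ by a set properly inside `t`, so the steps
    -- from `F₁` to them decompose together. This comparison is made once in `M` and once in `B ∪
    -- Set.range G`.
    · have hss : s ⊂ t := lt_of_le_of_ne hsub hts
      have happ : ∀ {y : List (Set V)}, (∀ r ∈ y, r ⊂ t) → ∀ r ∈ y ++ [s], r ⊂ t := by
        intro y hy r hr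
        rcases List.mem_append.1 hr with hr | hr
        · exact hy r hr
        · rwa [List.mem_singleton.1 hr]
      refine ⟨hst.1.mono (Set.subset_univ _), fun y hy hc => ?_⟩
      have hnT : ¬ TStep Γ B F₁ t (splice s F F₂) := fun hT =>
        (hB.tstep hM' hT).2 (y ++ [s]) (happ hy)
          (hc.append (chain_singleton.2 (hsp.symm.mono (Set.subset_univ _))))
      unfold TStep at hnT
      push Not at hnT
      obtain ⟨y', hy', hc'⟩ := hnT ⟨h1, h4, fun γ hγ => by
        rw [splice_of_notMem fun h' => hγ (hsub h')]; exact hst.1.2.2 γ hγ⟩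
      exact hst.2 (y' ++ [s]) (happ hy')
        ((hc'.mono fun _ _ _ => LStep.mono hBB).append (chain_singleton.2 hsp))
  refine ⟨hB.nonempty.mono hBB, ?_, ?_⟩
  · rintro a (ha | ha)
    · obtain ⟨F', hF', ha'⟩ := hB.vertex_flag a ha
      exact ⟨F', hF'.mono hBB, ha'⟩
    · refine ⟨G, ⟨h.step.2.1.1, fun γ => Or.inr ⟨γ, rfl⟩⟩, ha⟩
  · intro F₁ F₂ t hst
    rw [hM'.isFlagStep_iff] at hst ⊢
    rcases h.flagIn_union hM hsc hB hst.1.1 with h1 | ⟨h1, h2, h3⟩ <;>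
      rcases h.flagIn_union hM hsc hB hst.1.2.1 with h4 | ⟨h4, h5, h6⟩
    · exact hB.tstep hM' (hst.anti hBB h1 h4)
    · exact case2 _ _ _ h1 h4 h5 h6 hst
    · exact (case2 _ _ _ h4 h1 h2 h3 hst.symm).symm
    -- Both flags contain the new part, so `t` commutes with `s` and the step can be transported to
    -- the retractions in `B` and back.
    · have hdis : ∀ γ ∈ t, γ ∉ s := by
        intro γ hγ hs
        rw [← hst.diffSet_eq] at hγ
        exact hγ ((h1 γ hs).trans (h4 γ hs).symm)
      have hnadj : ∀ γ ∈ t, ∀ δ ∈ s, ¬ Γ.Adj δ γ := by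
        intro γ hγ δ hδ hadj
        have hs := hdis γ hγ
        rw [← hst.diffSet_eq] at hγ
        exact hγ ((h2 δ hδ γ hs hadj).trans (h5 δ hδ γ hs hadj).symm)
      have hl : LStep Γ B (splice s F F₁) t (splice s F F₂) := by
        refine ⟨h3, h6, fun γ hγ => ?_⟩
        by_cases hs : γ ∈ s
        · rw [splice_of_mem hs, splice_of_mem hs]
        · rw [splice_of_notMem hs, splice_of_notMem hs, hst.1.2.2 γ hγ]
      have hadj' : ∀ γ ∈ t, ∀ δ, δ ∉ t → Γ.Adj γ δ → F₁ δ = splice s F F₁ δ := by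
        intro γ hγ δ _ hadj
        rw [splice_of_notMem fun hs => hnadj γ hγ δ hs hadj.symm]
      have hT := hM'.tstep_transport hst (hl.mono hBB)
        (fun γ hγ => (splice_of_notMem (hdis γ hγ)).symm)
        (fun γ hγ => (splice_of_notMem (hdis γ hγ)).symm) hadj'
      refine hM'.tstep_transport (hB.tstep hM' (hT.anti hBB h3 h6))
        (hst.1.mono (Set.subset_univ _))
        (fun γ hγ => splice_of_notMem (hdis γ hγ)) (fun γ hγ => splice_of_notMem (hdis γ hγ))
        fun γ hγ δ hδ hadj => (hadj' γ hγ δ hδ hadj).symm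

end SimpleExtension

/-! ### Flags far away in a residue -/

section Far

variable {V : Type u} {Γ : SimpleGraph V} {M : Type v} [(gammaLang V).Structure M]

/-- A connected finite set of at least two colours is the range of an infinite walk that visits
each colour in every interval of some fixed length. -/
theorem IsLetter.exists_recurrent_walk [Finite V] {s : Set V} (hs : IsLetter Γ s)
    (hn : s.Nontrivial) : ∃ (c : ℕ → V) (R : ℕ), (∀ i, c i ∈ s) ∧ (∀ i, Γ.Adj (c i) (c (i + 1))) ∧
      ∀ δ ∈ s, ∀ i, ∃ j, i ≤ j ∧ j < i + R ∧ c j = δ := by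
  classical
  have := Fintype.ofFinite s
  obtain ⟨v₀⟩ := hs.nonempty
  have key : ∀ T : Finset s, ∃ p : (Γ.induce s).Walk v₀ v₀, ∀ t ∈ T, t ∈ p.support := by
    intro T
    induction T using Finset.induction_on with
    | empty => exact ⟨.nil, by simp⟩
    | insert t T _ ih =>
      obtain ⟨p, hp⟩ := ih
      obtain ⟨q⟩ := hs.preconnected v₀ t
      refine ⟨p.append (q.append q.reverse), fun r hr => ?_⟩
      simp only [SimpleGraph.Walk.mem_support_append_iff]
      rcases Finset.mem_insert.1 hr with rfl | hr
      · exact Or.inr (Or.inl q.end_mem_support)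
      · exact Or.inl (hp r hr)
  obtain ⟨p, hp⟩ := key Finset.univ
  have hpos : 0 < p.length := by
    obtain ⟨a, ha, b, hb, hab⟩ := hn
    by_contra h0
    have h0 : p.length = 0 := by omega
    have hv : ∀ x : s, x = v₀ := by
      intro x
      obtain ⟨n, hn, hnl⟩ := SimpleGraph.Walk.mem_support_iff_exists_getVert.1 (hp x (by simp))
      obtain rfl : n = 0 := by omega
      rw [← hn, SimpleGraph.Walk.getVert_zero]
    exact hab (congrArg Subtype.val ((hv ⟨a, ha⟩).trans (hv ⟨b, hb⟩).symm))
  -- The closed walk is repeated forever. Two periods are allowed because the visit found below lies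
  -- in the period after the one containing `i`.
  refine ⟨fun i => (p.getVert (i % p.length) : s), 2 * p.length, fun i => Subtype.prop _,
    fun i => ?_, fun δ hδ i => ?_⟩
  · have h1 := p.adj_getVert_succ (Nat.mod_lt i hpos)
    have h2 : p.getVert ((i + 1) % p.length) = p.getVert (i % p.length + 1) := by
      rcases Nat.lt_or_ge (i % p.length + 1) p.length with h | h
      · rw [Nat.add_mod, Nat.mod_eq_of_lt (a := 1) (by omega), Nat.mod_eq_of_lt h]
      · have h3 : i % p.length + 1 = p.length := by
          have := Nat.mod_lt i hpos; omega
        have h4 : (i + 1) % p.length = 0 := by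
          rw [← Nat.mod_add_mod, h3, Nat.mod_self]
        rw [h3, h4, SimpleGraph.Walk.getVert_zero, SimpleGraph.Walk.getVert_length]
    change Γ.Adj (p.getVert (i % p.length) : V) (p.getVert ((i + 1) % p.length))
    rw [h2]
    exact h1
  · obtain ⟨n, hn, hnl⟩ := SimpleGraph.Walk.mem_support_iff_exists_getVert.1 (hp ⟨δ, hδ⟩ (by simp))
    obtain ⟨m, hm, hml⟩ : ∃ m, p.getVert m = ⟨δ, hδ⟩ ∧ m < p.length := by
      rcases Nat.lt_or_ge n p.length with h | h
      · exact ⟨n, hn, h⟩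
      · obtain rfl : n = p.length := by omega
        refine ⟨0, ?_, hpos⟩
        rw [← hn, SimpleGraph.Walk.getVert_zero, SimpleGraph.Walk.getVert_length]
    have hdm := Nat.div_add_mod i p.length
    have hmod := Nat.mod_lt i hpos
    refine ⟨p.length * (i / p.length) + p.length + m, by omega, by omega, ?_⟩
    have : (p.length * (i / p.length) + p.length + m) % p.length = m := by
      rw [show p.length * (i / p.length) + p.length + m = m + p.length * (i / p.length + 1) by ring,
        Nat.add_mul_mod_self_left, Nat.mod_eq_of_lt hml]
    simp only [this, hm]

/-- The word of singletons read off from `n` consecutive places of a sequence of colours. -/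
def walkWord (c : ℕ → V) : ℕ → ℕ → List (Set V)
  | _, 0 => []
  | i, n + 1 => {c i} :: walkWord c (i + 1) n

theorem walkWord_eq_append {c : ℕ → V} {i n : ℕ} {a r : List (Set V)} {p : Set V}
    (h : walkWord c i n = a ++ p :: r) :
    ∃ k m, p = {c k} ∧ r = walkWord c (k + 1) m := by
  induction a generalizing i n with
  | nil =>
    cases n with
    | zero => simp [walkWord] at h
    | succ n =>
      simp only [walkWord, List.nil_append, List.cons.injEq] at h
      exact ⟨i, n, h.1.symm, h.2.symm⟩
  | cons b a ih =>
    cases n with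
    | zero => simp [walkWord] at h
    | succ n =>
      simp only [walkWord, List.cons_append, List.cons.injEq] at h
      exact ih h.2

theorem walkWord_length (c : ℕ → V) (i n : ℕ) : (walkWord c i n).length = n := by
  induction n generalizing i with
  | zero => rfl
  | succ n ih => simp [walkWord, ih]

theorem walkWord_getElem (c : ℕ → V) (i n m : ℕ) (h : m < (walkWord c i n).length) :
    (walkWord c i n)[m] = {c (i + m)} := by
  induction n generalizing i m with
  | zero => simp [walkWord] at h
  | succ n ih =>
    cases m with
    | zero => simp [walkWord]
    | succ m =>
      simp only [walkWord, List.getElem_cons_succ]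
      rw [ih]
      congr 2; omega

theorem not_lettersCommute_singleton {γ δ : V} (h : Γ.Adj γ δ) :
    ¬ LettersCommute Γ ({γ} : Set V) {δ} := fun hc => (hc γ rfl δ rfl).2 h

/-- Directly after any occurrence of a colour comes an adjacent one, which differs from it and does
not commute with it, so a later occurrence cannot be brought next to it. -/
theorem wordReduced_walkWord {c : ℕ → V} (hc : ∀ i, Γ.Adj (c i) (c (i + 1))) (i n : ℕ) :
    WordReduced Γ (walkWord c i n) := by
  intro a p b q d h hcon
  obtain ⟨k, m, rfl, h'⟩ := walkWord_eq_append h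
  obtain ⟨l, m', rfl, -⟩ := walkWord_eq_append h'.symm
  have hlk : c l = c k := by
    rcases hcon with ⟨h1, -⟩ | ⟨h1, -⟩
    · exact (h1 rfl).symm
    · exact h1 rfl
  rw [hlk] at hcon h'
  have hcb : ∀ t ∈ b, LettersCommute Γ {c k} t := hcon.elim And.right And.right
  cases b with
  | nil =>
    cases m with
    | zero => simp [walkWord] at h'
    | succ m =>
      simp only [walkWord, List.nil_append, List.cons.injEq] at h'
      exact (hc k).ne (Set.singleton_injective h'.1)
  | cons t b =>
    cases m with
    | zero => simp [walkWord] at h'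
    | succ m =>
      simp only [walkWord, List.cons_append, List.cons.injEq] at h'
      have := hcb t (by simp)
      rw [h'.1] at this
      exact not_lettersCommute_singleton (hc k) this

/-- Segments of a recurrent walk of flags that are long enough cannot be abbreviated. -/
theorem not_chain_of_walk [Finite V] (hM : IsGammaGraph Γ M)
    (hsc : SimplyConnectedOn Γ (Set.univ : Set M)) {s : Set V} {c : ℕ → V} {R : ℕ}
    (hadj : ∀ i, Γ.Adj (c i) (c (i + 1)))
    (hR : ∀ δ ∈ s, ∀ i, ∃ j, i ≤ j ∧ j < i + R ∧ c j = δ) {F G : V → M} {i n : ℕ}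
    (hF : IsFlag Γ F) (hw : Chain (TStep Γ Set.univ) F (walkWord c i n) G) {x : List (Set V)}
    (hx : ∀ t ∈ x, t ⊂ s) (hn : x.length * R < n) : ¬ Chain (LStep Γ Set.univ) G x F := by
  intro hc
  -- Labels are positions in `x`. Consecutive letters of the walk do not commute, so the labels
  -- decrease weakly along it.
  obtain ⟨L, hL⟩ := covering hM hsc (X := x.zipIdx) ⟨hF, fun _ => trivial⟩ (by
      rw [List.pairwise_iff_getElem]
      intro a b ha hb hab
      simp; omega) hw (wordReduced_walkWord hadj i n) (by simpa using hc)
  have hlen : L.length = n := by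
    have := congrArg List.length hL.word
    rwa [List.length_map, walkWord_length] at this
  have hfst : ∀ (m : ℕ) (hm : m < L.length), L[m].1 = {c (i + m)} := by
    intro m hm
    rw [← walkWord_getElem c i n m (by rw [walkWord_length]; omega)]
    simp [← hL.word]
  have hlt : ∀ (m : ℕ) (hm : m < L.length), ∃ h : L[m].2 < x.length, c (i + m) ∈ x[L[m].2] := by
    intro m hm
    obtain ⟨b, hb, h1, h2⟩ := hL.le _ (List.getElem_mem hm)
    obtain ⟨h3, h4⟩ := List.mem_zipIdx' hb
    rw [h2]
    refine ⟨h3, ?_⟩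
    rw [← h4]
    exact h1 (by rw [hfst m hm]; rfl)
  have hmono : ∀ (k m : ℕ) (hm : m + k < L.length), L[m + k].2 ≤ L[m].2 := by
    intro k
    induction k with
    | zero => intro m hm; exact le_rfl
    | succ k ih =>
      intro m hm
      have h1 := (List.pairwise_iff_getElem.1 hL.order) (m + k) (m + (k + 1)) (by omega) hm
        (by omega)
      rw [hfst, hfst] at h1
      exact (h1 (not_lettersCommute_singleton (hadj (i + (m + k))))).trans (ih m (by omega))
  have hdrop : ∀ m (hm : m + R < L.length), L[m + R].2 < L[m].2 := by
    intro m hm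
    obtain ⟨hl, -⟩ := hlt m (by omega)
    -- The covering letter misses a colour `δ` of `s`, and the walk visits `δ` within `R` steps; by
    -- then the label must have dropped.
    obtain ⟨δ, hδ, hδ'⟩ := Set.exists_of_ssubset (hx _ (List.getElem_mem hl))
    obtain ⟨j, hj1, hj2, hj3⟩ := hR δ hδ (i + m)
    obtain ⟨k, rfl⟩ : ∃ k, j = i + (m + k) := ⟨j - i - m, by omega⟩
    have h1 := hmono k m (by omega)
    have h2 := hmono (R - k) (m + k) (by omega)
    have h3 : L[m + k + (R - k)].2 = L[m + R].2 := by congr 2; omega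
    have hne : L[m + k].2 ≠ L[m].2 := by
      intro e
      obtain ⟨h4, h5⟩ := hlt (m + k) (by omega)
      simp only [e, hj3] at h5
      exact hδ' h5
    omega
  have hfin : ∀ j (hj : j * R < L.length), L[j * R].2 + j < x.length := by
    intro j
    induction j with
    | zero => intro hj; simpa using (hlt _ hj).1
    | succ j ih =>
      intro hj
      have e : (j + 1) * R = j * R + R := by ring
      have h1 := ih (by omega)
      have h2 := hdrop (j * R) (by omega)
      have h3 : L[(j + 1) * R].2 = L[j * R + R].2 := by congr 2
      omega
  have := hfin x.length (by omega)
  omega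

/-- Any real change at a single colour is a true step, since only the empty set is properly
contained in a singleton. -/
theorem HasInfiniteResidues.exists_step (hi : HasInfiniteResidues Γ M)
    {F : V → M} (hF : IsFlag Γ F) (γ : V) {S : Set (V → M)} (hS : S.Finite) :
    ∃ G, TStep Γ Set.univ F {γ} G ∧ G ∉ S := by
  obtain ⟨G, ⟨hG, hG'⟩, hGS⟩ := (hi γ F hF).exists_notMem_finite (hS.union (Set.finite_singleton F))
  simp only [Set.union_singleton, Set.mem_insert_iff, not_or] at hGS
  refine ⟨G, ⟨⟨⟨hF, fun _ => trivial⟩, ⟨hG, fun _ => trivial⟩, fun δ hδ => (hG' δ hδ).symm⟩,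
    fun y hy hc => hGS.1 ?_⟩, hGS.2⟩
  funext δ
  refine (chain_ne_of_mem hc fun t ht hδ => ?_).symm
  rw [Set.ssubset_singleton_iff.1 (hy t ht)] at hδ
  exact hδ

/-- In the `s`-residue of a flag there are flags that cannot be reached from a given finite set of
flags by a short lazy path of letters properly contained in `s`. -/
theorem exists_far_flag [Finite V] (hM : IsGammaGraph Γ M)
    (hsc : SimplyConnectedOn Γ (Set.univ : Set M)) (hi : HasInfiniteResidues Γ M) {s : Set V}
    (hs : IsLetter Γ s) {F : V → M} (hF : IsFlag Γ F) {S : Set (V → M)} (hS : S.Finite) (K : ℕ) :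
    ∃ G, LStep Γ Set.univ F s G ∧ ∀ F' ∈ S, ∀ x : List (Set V), x.length ≤ K →
      (∀ t ∈ x, t ⊂ s) → ¬ Chain (LStep Γ Set.univ) F' x G := by
  rcases s.subsingleton_or_nontrivial with h1 | hnt
  · obtain ⟨⟨γ, hγ⟩⟩ := hs.nonempty
    obtain rfl : s = {γ} := h1.eq_singleton_of_mem hγ
    obtain ⟨G, hG, hGS⟩ := hi.exists_step hF γ hS
    refine ⟨G, hG.1, fun F' hF' x _ hx hc => hGS ?_⟩
    convert hF'
    funext δ
    refine (chain_ne_of_mem hc fun t ht hδ => ?_).symm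
    rw [Set.ssubset_singleton_iff.1 (hx t ht)] at hδ
    exact hδ
  · obtain ⟨c, R, hcs, hadj, hR⟩ := hs.exists_recurrent_walk hnt
    have hex : ∀ (H : {H : V → M // IsFlag Γ H}) (γ : V), ∃ G : {H : V → M // IsFlag Γ H},
        TStep Γ Set.univ H.1 {γ} G.1 := by
      intro H γ
      obtain ⟨G, hG, -⟩ := hi.exists_step H.2 γ (Set.finite_empty)
      exact ⟨⟨G, hG.1.2.1.1⟩, hG⟩
    choose f hf using hex
    let P : ℕ → {H : V → M // IsFlag Γ H} := fun n =>
      Nat.rec ⟨F, hF⟩ (fun i H => f H (c i)) n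
    have hP : ∀ i, TStep Γ Set.univ (P i).1 {c i} (P (i + 1)).1 := fun i => hf _ _
    have hPF : ∀ i, LStep Γ Set.univ F s (P i).1 := by
      intro i
      induction i with
      | zero => exact LStep.refl (D := Set.univ) ⟨hF, fun _ => trivial⟩ s
      | succ i ih =>
        exact ih.trans ((hP i).1.weaken (Set.singleton_subset_iff.2 (hcs i)))
    have hPw : ∀ n i, Chain (TStep Γ Set.univ) (P i).1 (walkWord c i n) (P (i + n)).1 := by
      intro n
      induction n with
      | zero => intro i; rfl
      | succ n ih =>
        intro i
        refine ⟨_, hP i, ?_⟩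
        have := ih (i + 1)
        rwa [show i + 1 + n = i + (n + 1) by omega] at this
    by_contra hcon
    push Not at hcon
    -- The walk is sampled at multiples of `2 * K * R + 1`. If every sample were near `S`, two of
    -- them would be near the same member and joined by at most `2 * K` lazy steps, too few for the
    -- stretch of walk between them.
    have hcon' : ∀ n : ℕ, ∃ F' : S, ∃ x : List (Set V), x.length ≤ K ∧ (∀ t ∈ x, t ⊂ s) ∧
        Chain (LStep Γ Set.univ) F'.1 x (P (n * (2 * K * R + 1))).1 := by
      intro n
      obtain ⟨F', hF', x, h⟩ := hcon _ (hPF _)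
      exact ⟨⟨F', hF'⟩, x, h⟩
    choose g hg using hcon'
    have := hS.to_subtype
    obtain ⟨i, j, hne, hij⟩ := Finite.exists_ne_map_eq_of_infinite g
    wlog hlt : i < j generalizing i j
    · exact this j i hne.symm hij.symm (by omega)
    obtain ⟨x, hx1, hx2, hx3⟩ := hg i
    obtain ⟨y, hy1, hy2, hy3⟩ := hg j
    rw [← hij] at hy3
    obtain ⟨d, rfl⟩ : ∃ d, j = i + (d + 1) := ⟨j - i - 1, by omega⟩
    have hw := hPw ((d + 1) * (2 * K * R + 1)) (i * (2 * K * R + 1))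
    rw [← add_mul] at hw
    refine not_chain_of_walk hM hsc hadj hR (x := y.reverse ++ x) (P _).2 hw ?_ ?_
      ((hy3.reverse fun _ _ _ => LStep.symm).append hx3)
    · intro t ht
      rcases List.mem_append.1 ht with ht | ht
      · exact hy2 t (List.mem_reverse.1 ht)
      · exact hx2 t ht
    · rw [List.length_append, List.length_reverse]
      have h1 : (y.length + x.length) * R ≤ 2 * K * R := Nat.mul_le_mul_right _ (by omega)
      have h2 : 2 * K * R + 1 ≤ (d + 1) * (2 * K * R + 1) := Nat.le_mul_of_pos_left _ (by omega)
      omega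

end Far

/-! ### Unsplit cycles: a first-order form of simple connectedness -/

section Unsplit

variable {V : Type u} {Γ : SimpleGraph V} {M : Type v} [(gammaLang V).Structure M]

variable (Γ) in
/-- The flags `F` and `G` are not connected by three lazy steps with sets properly contained
in `s`. -/
def IsUnsplit (F : V → M) (s : Set V) (G : V → M) : Prop :=
  ¬ ∃ H₁ H₂ : V → M, IsFlag Γ H₁ ∧ IsFlag Γ H₂ ∧ diffSet F H₁ ⊂ s ∧ diffSet H₁ H₂ ⊂ s ∧
    diffSet H₂ G ⊂ s

variable (Γ) in
/-- A closed path with a reduced word of length `n` all of whose steps are unsplit. -/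
structure IsUnsplitCycle (n : ℕ) (s : ℕ → Set V) (F : ℕ → V → M) : Prop where
  flag : ∀ i ≤ n, IsFlag Γ (F i)
  letter : ∀ i < n, IsLetter Γ (s i)
  diff : ∀ i < n, diffSet (F i) (F (i + 1)) = s i
  unsplit : ∀ i < n, IsUnsplit Γ (F i) (s i) (F (i + 1))
  closed : F n = F 0
  reduced_left : ∀ i j, i < j → j < n → s i ⊆ s j →
    ¬ ∀ k, i < k → k < j → LettersCommute Γ (s i) (s k)
  reduced_right : ∀ i j, i < j → j < n → s j ⊆ s i →
    ¬ ∀ k, i < k → k < j → LettersCommute Γ (s j) (s k)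

variable (Γ) in
/-- The colours that can be exchanged between the positions `a` and `b` of a word. -/
def exchangeSet (s : ℕ → Set V) (a b : ℕ) : Set V :=
  {γ | γ ∈ s a ∧ γ ∈ s b ∧ ∀ k, a < k → k < b → ∀ δ ∈ s k, γ ≠ δ ∧ ¬ Γ.Adj γ δ}

variable (Γ) in
/-- The colours that can be exchanged across the flag with index `i`. -/
def cutSet (n : ℕ) (s : ℕ → Set V) (i : ℕ) : Set V :=
  {γ | ∃ a b, a < i ∧ i ≤ b ∧ b < n ∧ γ ∈ exchangeSet Γ s a b}

theorem cutSet_left {n : ℕ} {s : ℕ → Set V} {i : ℕ} {γ : V} (h : γ ∈ cutSet Γ n s i) :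
    (∃ a < i, γ ∈ exchangeSet Γ s a i) ∨ ∀ δ ∈ s i, γ ≠ δ ∧ ¬ Γ.Adj γ δ := by
  obtain ⟨a, b, h1, h2, h3, h4⟩ := h
  rcases h2.eq_or_lt with rfl | h2
  · exact Or.inl ⟨a, h1, h4⟩
  · exact Or.inr (h4.2.2 i h1 h2)

theorem cutSet_right {n : ℕ} {s : ℕ → Set V} {i : ℕ} {γ : V} (h : γ ∈ cutSet Γ n s (i + 1)) :
    (∃ b, i < b ∧ b < n ∧ γ ∈ exchangeSet Γ s i b) ∨ ∀ δ ∈ s i, γ ≠ δ ∧ ¬ Γ.Adj γ δ := by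
  obtain ⟨a, b, h1, h2, h3, h4⟩ := h
  rcases (Nat.le_of_lt_succ h1).eq_or_lt with rfl | h1
  · exact Or.inl ⟨b, h2, h3, h4⟩
  · exact Or.inr (h4.2.2 i h1 h2)

variable (Γ) in
/-- A configuration: a deformation of the flags `F i` within the cut sets, together with lazy
paths that connect consecutive flags. -/
structure IsConfig (n : ℕ) (s : ℕ → Set V) (F H : ℕ → V → M) (x : ℕ → List (Set V)) : Prop where
  flag : ∀ i ≤ n, IsFlag Γ (H i)
  cut : ∀ i ≤ n, ∀ γ, γ ∉ cutSet Γ n s i → H i γ = F i γ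
  chain : ∀ i < n, Chain (LStep Γ Set.univ) (H i) (x i) (H (i + 1))
  le : ∀ i < n, ∀ t ∈ x i, t ⊆ s i

/-- The total word of a configuration as a multiset. -/
def totalWord (n : ℕ) (x : ℕ → List (Set V)) : Multiset (Set V) :=
  ∑ i ∈ Finset.range n, (x i : Multiset (Set V))

theorem totalWord_lt {n : ℕ} {x x' : ℕ → List (Set V)} {i : ℕ} (hi : i < n)
    (h : wordLT (x' i) (x i)) (hx : ∀ k, k ≠ i → x' k = x k) :
    Relation.TransGen (Relation.CutExpand (fun s t : Set V => s ⊂ t)) (totalWord n x')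
      (totalWord n x) := by
  classical
  have hi' : i ∈ Finset.range n := Finset.mem_range.2 hi
  unfold totalWord
  rw [← Finset.add_sum_erase _ _ hi', ← Finset.add_sum_erase _ _ hi',
    Finset.sum_congr rfl fun k hk => by rw [hx k (Finset.ne_of_mem_erase hk)] ]
  exact Relation.TransGen.lift (· + ∑ k ∈ (Finset.range n).erase i, (x k : Multiset (Set V)))
    (fun a b hab => (Relation.cutExpand_add_right _).2 hab) _ _ h

variable {n : ℕ} {s : ℕ → Set V} {F H : ℕ → V → M} {x : ℕ → List (Set V)}

theorem IsUnsplitCycle.isConfig (h : IsUnsplitCycle Γ n s F) :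
    IsConfig Γ n s F F fun i => [s i] where
  flag := h.flag
  cut _ _ _ _ := rfl
  chain i hi := chain_singleton.2 ⟨⟨h.flag i hi.le, fun _ => trivial⟩,
    ⟨h.flag _ hi, fun _ => trivial⟩, fun γ hγ => by
      rw [← h.diff i hi] at hγ; exact by_contra fun h => hγ h⟩
  le i _ t ht := by rw [List.mem_singleton.1 ht]

theorem IsConfig.eq_of_notMem (h : IsConfig Γ n s F H x) {i : ℕ} (hi : i < n) {γ : V}
    (hγ : γ ∉ s i) : H i γ = H (i + 1) γ :=
  chain_ne_of_mem (h.chain i hi) fun t ht h' => hγ (h.le i hi t ht h')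

/-- Deformation within the cut sets does not make the steps smaller. -/
theorem IsConfig.diffSet_eq (hM : IsGammaGraph Γ M) (hF : IsUnsplitCycle Γ n s F)
    (h : IsConfig Γ n s F H x) {i : ℕ} (hi : i < n) : diffSet (H i) (H (i + 1)) = s i := by
  have hsub : diffSet (H i) (H (i + 1)) ⊆ s i := fun γ hγ =>
    by_contra fun h' => hγ (h.eq_of_notMem hi h')
  by_contra hne
  have hs := hF.letter i hi
  have hL : ∀ δ, F i δ ≠ H i δ → (∃ a < i, δ ∈ exchangeSet Γ s a i) ∨
      ∀ γ ∈ s i, δ ≠ γ ∧ ¬ Γ.Adj δ γ := fun δ hδ =>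
    cutSet_left (by_contra fun hc => hδ (h.cut i hi.le δ hc).symm)
  have hR : ∀ δ, F (i + 1) δ ≠ H (i + 1) δ → (∃ b, i < b ∧ b < n ∧ δ ∈ exchangeSet Γ s i b) ∨
      ∀ γ ∈ s i, δ ≠ γ ∧ ¬ Γ.Adj δ γ := fun δ hδ =>
    cutSet_right (by_contra fun hc => hδ (h.cut (i + 1) hi δ hc).symm)
  have f1 : IsFlagIn Γ Set.univ (splice (s i) (H i) (F i)) :=
    hM.isFlagIn_splice ⟨hF.flag i hi.le, fun _ => trivial⟩ ⟨h.flag i hi.le, fun _ => trivial⟩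
      fun γ hγ δ hδ hadj => by
        by_contra hne
        rcases hL δ (Ne.symm hne) with ⟨a, -, ha⟩ | hc
        · exact hδ ha.2.1
        · exact (hc γ hγ).2 hadj.symm
  have f2 : IsFlagIn Γ Set.univ (splice (s i) (H (i + 1)) (F (i + 1))) :=
    hM.isFlagIn_splice ⟨hF.flag _ hi, fun _ => trivial⟩ ⟨h.flag _ hi, fun _ => trivial⟩
      fun γ hγ δ hδ hadj => by
        by_contra hne
        rcases hR δ (Ne.symm hne) with ⟨a, -, -, ha⟩ | hc
        · exact hδ ha.1
        · exact (hc γ hγ).2 hadj.symm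
  -- If the deformed step became smaller, deforming the `s i`-part, making that step and undoing the
  -- deformation would be three smaller steps from `F i` to `F (i + 1)`.
  refine hF.unsplit i hi ⟨_, _, f1.1, f2.1, ?_, ?_, ?_⟩
  · refine lt_of_le_of_ne (fun γ hγ => by_contra fun h' => hγ (splice_of_notMem h').symm) ?_
    intro e
    have hex : ∀ γ ∈ s i, ∃ a < i, γ ∈ exchangeSet Γ s a i := by
      intro γ hγ
      have h1 : F i γ ≠ H i γ := by
        have : γ ∈ diffSet (F i) (splice (s i) (H i) (F i)) := e.ge hγ
        simpa [diffSet, splice_of_mem hγ] using this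
      exact (hL γ h1).resolve_right fun hc => (hc γ hγ).1 rfl
    obtain ⟨⟨γ, hγ⟩⟩ := hs.nonempty
    obtain ⟨a, hai, ha⟩ := hex γ hγ
    -- Adjacent colours of `s i` cannot be exchanged with different positions, since the later of
    -- the two positions would block the exchange with the earlier. As `s i` is connected, it is
    -- exchangeable as a whole with one `s a`, against reducedness.
    have hall := hs.induction hγ (P := fun γ => γ ∈ exchangeSet Γ s a i) ha (by
      intro δ hδ ε hε hadj hP
      obtain ⟨a', hai', ha'⟩ := hex ε hε
      rcases lt_trichotomy a a' with hlt | rfl | hlt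
      · exact absurd hadj (hP.2.2 a' hlt hai' ε ha'.1).2
      · exact ha'
      · exact absurd hadj.symm (ha'.2.2 a hlt hai δ hP.1).2)
    exact hF.reduced_right a i hai hi (fun γ hγ => (hall γ hγ).1)
      fun k h1 h2 γ hγ δ hδ => (hall γ hγ).2.2 k h1 h2 δ hδ
  · refine lt_of_le_of_lt (fun γ hγ => ?_) (lt_of_le_of_ne hsub hne)
    by_cases hγs : γ ∈ s i
    · simpa [diffSet, splice_of_mem hγs] using hγ
    · exfalso
      refine hγs ?_
      rw [← hF.diff i hi]
      simpa [diffSet, splice_of_notMem hγs] using hγ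
  · refine lt_of_le_of_ne (fun γ hγ => by_contra fun h' => hγ (splice_of_notMem h')) ?_
    intro e
    have hex : ∀ γ ∈ s i, ∃ b, i < b ∧ b < n ∧ γ ∈ exchangeSet Γ s i b := by
      intro γ hγ
      have h1 : F (i + 1) γ ≠ H (i + 1) γ := by
        have : γ ∈ diffSet (splice (s i) (H (i + 1)) (F (i + 1))) (F (i + 1)) := e.ge hγ
        simpa [diffSet, splice_of_mem hγ, eq_comm] using this
      exact (hR γ h1).resolve_right fun hc => (hc γ hγ).1 rfl
    obtain ⟨⟨γ, hγ⟩⟩ := hs.nonempty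
    obtain ⟨b, hib, hbn, hb⟩ := hex γ hγ
    have hall := hs.induction hγ (P := fun γ => γ ∈ exchangeSet Γ s i b) hb (by
      intro δ hδ ε hε hadj hP
      obtain ⟨b', hib', -, hb'⟩ := hex ε hε
      rcases lt_trichotomy b b' with hlt | rfl | hlt
      · exact absurd hadj.symm (hb'.2.2 b hib hlt δ hP.2.1).2
      · exact hb'
      · exact absurd hadj (hP.2.2 b' hib' hlt ε hb'.2.1).2)
    exact hF.reduced_left i b hib hbn (fun γ hγ => (hall γ hγ).2.1)
      fun k h1 h2 γ hγ δ hδ => (hall γ hγ).2.2 k h1 h2 δ hδ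

theorem IsConfig.update (h : IsConfig Γ n s F H x) {i : ℕ} {y : List (Set V)}
    (hc : Chain (LStep Γ Set.univ) (H i) y (H (i + 1))) (hy : ∀ t ∈ y, t ⊆ s i) :
    IsConfig Γ n s F H (Function.update x i y) where
  flag := h.flag
  cut := h.cut
  chain k hk := by
    by_cases hki : k = i
    · subst hki; simpa using hc
    · rw [Function.update_of_ne hki]; exact h.chain k hk
  le k hk := by
    by_cases hki : k = i
    · subst hki; simpa using hy
    · rw [Function.update_of_ne hki]; exact h.le k hk

/-- Along a path that commutes with `p`, the `p`-part of the flags can be exchanged. -/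
theorem IsGammaGraph.chain_splice (hM : IsGammaGraph Γ M) {p : Set V} {y : List (Set V)}
    {A E C : V → M} (hC : IsFlag Γ C) (hA : IsFlag Γ A)
    (hAC : ∀ γ ∈ p, ∀ δ, δ ∉ p → Γ.Adj γ δ → C δ = A δ)
    (hy : ∀ t ∈ y, LettersCommute Γ p t) (h : Chain (LStep Γ Set.univ) A y E) :
    Chain (LStep Γ Set.univ) (splice p C A) y (splice p C E) := by
  induction y generalizing A with
  | nil => obtain rfl := h; rfl
  | cons t y ih =>
    obtain ⟨B, h1, h2⟩ := h
    have hBC : ∀ γ ∈ p, ∀ δ, δ ∉ p → Γ.Adj γ δ → C δ = B δ := fun γ hγ δ hδ hadj =>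
      (hAC γ hγ δ hδ hadj).trans
        (h1.2.2 δ fun ht => (hy t (by simp) γ hγ δ ht).2 hadj)
    refine ⟨splice p C B, ⟨hM.isFlagIn_splice h1.1 ⟨hC, fun _ => trivial⟩ hAC,
      hM.isFlagIn_splice h1.2.1 ⟨hC, fun _ => trivial⟩ hBC, fun γ hγ => ?_⟩,
      ih h1.2.1.1 hBC (fun r hr => hy r (by simp [hr])) h2⟩
    by_cases hp : γ ∈ p
    · rw [splice_of_mem hp, splice_of_mem hp]
    · rw [splice_of_notMem hp, splice_of_notMem hp, h1.2.2 γ hγ]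

theorem chain_agree {p : Set V} {y : List (Set V)} {A E : V → M}
    (hy : ∀ t ∈ y, LettersCommute Γ p t) (h : Chain (LStep Γ Set.univ) A y E) {γ δ : V}
    (hγ : γ ∈ p) (hδ : δ = γ ∨ Γ.Adj γ δ) : A δ = E δ := by
  refine chain_ne_of_mem h fun t ht hδt => ?_
  rcases hδ with rfl | hadj
  · exact (hy t ht _ hγ _ hδt).1 rfl
  · exact (hy t ht _ hγ _ hδt).2 hadj

/-- The `p`-part of `C` is implanted into all flags strictly after `i` and up to `m`. The cut sets
permit this because `p` is exchangeable, and the blocks in between commute with `p`, so only the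
blocks `i` and `m` need new words. -/
theorem IsConfig.exchange (hM : IsGammaGraph Γ M) (h : IsConfig Γ n s F H x) {i m : ℕ}
    (him : i < m) (hm : m < n) {p : Set V} (hp : p ⊆ exchangeSet Γ s i m) {C : V → M}
    (hC : IsFlag Γ C)
    (hCH : ∀ k, i < k → k ≤ m → ∀ γ ∈ p, ∀ δ, δ ∉ p → Γ.Adj γ δ → C δ = H k δ)
    (hcomm : ∀ k, i < k → k < m → ∀ t ∈ x k, LettersCommute Γ p t)
    {x' : ℕ → List (Set V)} (hx : ∀ k, k ≠ i → k ≠ m → x' k = x k)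
    (hx' : ∀ k < n, ∀ t ∈ x' k, t ⊆ s k)
    (hi : Chain (LStep Γ Set.univ) (H i) (x' i) (splice p C (H (i + 1))))
    (hm' : Chain (LStep Γ Set.univ) (splice p C (H m)) (x' m) (H (m + 1))) :
    IsConfig Γ n s F (fun k => if i < k ∧ k ≤ m then splice p C (H k) else H k) x' where
  flag k hk := by
    by_cases hc : i < k ∧ k ≤ m
    · simp only [hc, and_self, if_true]
      exact (hM.isFlagIn_splice (D := Set.univ) ⟨h.flag k hk, fun _ => trivial⟩
        ⟨hC, fun _ => trivial⟩ (hCH k hc.1 hc.2)).1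
    · simp only [hc, if_false]; exact h.flag k hk
  cut k hk γ hγ := by
    by_cases hc : i < k ∧ k ≤ m
    · simp only [hc, and_self, if_true]
      rw [splice_of_notMem fun hγp => hγ ⟨i, m, hc.1, hc.2, hm, hp hγp⟩]
      exact h.cut k hk γ hγ
    · simp only [hc, if_false]; exact h.cut k hk γ hγ
  chain k hk := by
    by_cases hki : k = i
    · subst hki
      simpa [show k + 1 ≤ m by omega] using hi
    by_cases hkm : k = m
    · subst hkm
      simpa [him] using hm'
    rw [hx k hki hkm]
    by_cases hc : i < k ∧ k ≤ m
    · have hc' : i < k + 1 ∧ k + 1 ≤ m := by omega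
      simp only [hc, hc', and_self, if_true]
      exact hM.chain_splice hC (h.flag k hk.le) (hCH k hc.1 hc.2) (hcomm k hc.1 (by omega))
        (h.chain k hk)
    · have hc' : ¬ (i < k + 1 ∧ k + 1 ≤ m) := by omega
      simp only [hc, hc', if_false]
      exact h.chain k hk
  le := hx'

/-- The exchange set refers to the letters `s k`, while commutation is known for the letters of `x
k`. These cover `s k`, because a deformed step still changes every colour of `s k`. -/
theorem subset_exchangeSet (hM : IsGammaGraph Γ M) (hF : IsUnsplitCycle Γ n s F)
    (h : IsConfig Γ n s F H x) {i m : ℕ} (hm : m < n) {p : Set V} (hpi : p ⊆ s i)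
    (hpm : p ⊆ s m) (hcomm : ∀ k, i < k → k < m → ∀ t ∈ x k, LettersCommute Γ p t) :
    p ⊆ exchangeSet Γ s i m := by
  refine fun γ hγ => ⟨hpi hγ, hpm hγ, fun k h1 h2 δ hδ => ?_⟩
  have hk : k < n := by omega
  rw [← h.diffSet_eq hM hF hk] at hδ
  have : ∃ t ∈ x k, δ ∈ t := by
    by_contra hcon
    push Not at hcon
    exact hδ (chain_ne_of_mem (h.chain k hk) hcon)
  obtain ⟨t, ht, hδt⟩ := this
  exact hcomm k h1 h2 t ht γ hγ δ hδt

/-- The concatenation of the first `m` words. -/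
def blockWord (x : ℕ → List (Set V)) : ℕ → List (Set V)
  | 0 => []
  | m + 1 => blockWord x m ++ x m

theorem blockWord_eq_append {m : ℕ} {w₁ w₂ : List (Set V)} {p : Set V}
    (h : blockWord x m = w₁ ++ p :: w₂) :
    ∃ i < m, ∃ y y', x i = y ++ p :: y' ∧ (∀ t ∈ y', t ∈ w₂) ∧
      ∀ k, i < k → k < m → ∀ t ∈ x k, t ∈ w₂ := by
  induction m generalizing w₂ with
  | zero => simp [blockWord] at h
  | succ m ih =>
    rw [blockWord, List.append_eq_append_iff] at h
    rcases h with ⟨a', rfl, hx⟩ | ⟨c', h, hc⟩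
    · exact ⟨m, by omega, a', w₂, hx, fun _ => id, fun k h1 h2 => by omega⟩
    · cases c' with
      | nil =>
        simp only [List.nil_append] at hc
        exact ⟨m, by omega, [], w₂, by simp [hc], fun _ => id, fun k h1 h2 => by omega⟩
      | cons q c' =>
        simp only [List.cons_append, List.cons.injEq] at hc
        obtain ⟨rfl, rfl⟩ := hc
        obtain ⟨i, hi, y, y', h1, h2, h3⟩ := ih h
        refine ⟨i, by omega, y, y', h1, fun t ht => by simp [h2 t ht], fun k hk hkm t ht => ?_⟩
        rcases (Nat.lt_succ_iff.1 hkm).eq_or_lt with rfl | hkm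
        · simp [ht]
        · simp [h3 k hk hkm t ht]

/-- A simply connected graph has no unsplit cycles. -/
theorem not_isUnsplitCycle [Finite V] (hM : IsGammaGraph Γ M)
    (hsc : SimplyConnectedOn Γ (Set.univ : Set M)) (hn : 0 < n) :
    ¬ IsUnsplitCycle Γ n s F := by
  intro hF
  let P : Set ((ℕ → V → M) × (ℕ → List (Set V))) := {c | IsConfig Γ n s F c.1 c.2}
  -- A deformation with minimal total word is chosen: minimality makes all its steps true and the
  -- concatenated word reduced.
  obtain ⟨⟨H, x⟩, hc, hmin⟩ := (InvImage.wf (fun c : (ℕ → V → M) × (ℕ → List (Set V)) =>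
    totalWord n c.2) wellFounded_cutExpand_ssubset).has_min P ⟨(F, _), hF.isConfig⟩
  have hc : IsConfig Γ n s F H x := hc
  have hmin : ∀ (H' : ℕ → V → M) (x' : ℕ → List (Set V)) (i : ℕ), i < n →
      (∀ k, k ≠ i → x' k = x k) → wordLT (x' i) (x i) → ¬ IsConfig Γ n s F H' x' :=
    fun H' x' i hi hx h hc' => hmin (H', x') hc' (totalWord_lt hi h hx)
  have hmin' : ∀ i < n, ∀ y : List (Set V), (∀ t ∈ y, t ⊆ s i) → wordLT y (x i) →
      ¬ Chain (LStep Γ Set.univ) (H i) y (H (i + 1)) := fun i hi y hy hlt hcy =>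
    hmin H (Function.update x i y) i hi (fun k hk => Function.update_of_ne hk _ _)
      (by simpa using hlt) (hc.update hcy hy)
  have htrue : ∀ i < n, Chain (TStep Γ Set.univ) (H i) (x i) (H (i + 1)) := by
    intro i hi
    refine (chain_true_or_split (hc.chain i hi)).resolve_right ?_
    rintro ⟨a, q, c, y, he, hy, hch⟩
    refine hmin' i hi (a ++ (y ++ c)) (fun t ht => ?_)
      (by rw [he, ← List.append_assoc]; exact wordLT_replace a c hy) hch
    have hle := hc.le i hi
    rw [he] at hle
    simp only [List.mem_append, List.mem_cons] at ht hle
    rcases ht with ht | ht | ht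
    · exact hle t (Or.inl ht)
    · exact (hy t ht).subset.trans (hle q (Or.inr (Or.inl rfl)))
    · exact hle t (Or.inr (Or.inr ht))
  have hred1 : ∀ i < n, WordReduced Γ (x i) := by
    rintro i hi a p b q c he hcon
    have hle := hc.le i hi
    have hch := hc.chain i hi
    rw [he] at hle hch
    simp only [List.mem_append, List.mem_cons] at hle
    rcases hcon with ⟨h1, h2⟩ | ⟨h1, h2⟩
    · refine hmin' i hi _ (fun t ht => hle t ?_) (he ▸ wordLT_delete a _ p)
        (chain_absorb_right hM h1 h2 hch)
      simp only [List.mem_append, List.mem_cons] at ht; tauto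
    · refine hmin' i hi _ (fun t ht => hle t ?_) ?_ (chain_absorb_left hM h1 h2 hch)
      · simp only [List.mem_append, List.mem_cons] at ht; tauto
      · rw [he]; simpa using wordLT_delete (a ++ p :: b) c q
  have hred : ∀ m ≤ n, WordReduced Γ (blockWord x m) := by
    intro m
    induction m with
    | zero => intro _; exact wordReduced_nil
    | succ m ih =>
      intro hmn
      have hm : m < n := hmn
      by_contra hcon
      -- A redundancy across blocks pairs a letter `p` of some block `i` with a letter `q` of block
      -- `m`. The smaller one is carried over the blocks between them and absorbed, contradicting
      -- minimality.
      obtain ⟨w₁, p, w₂, z, q, z', hw, hz, hcon⟩ :=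
        exists_of_not_wordReduced_append (ih hm.le) (hred1 m hm) hcon
      obtain ⟨i, him, y, y', hy, hyw, hkw⟩ := blockWord_eq_append hw
      have hi : i < n := by omega
      have hpi : p ⊆ s i := hc.le i hi p (by simp [hy])
      have hqm : q ⊆ s m := hc.le m hm q (by simp [hz])
      have hci := hc.chain i hi
      have hcm := hc.chain m hm
      rw [hy] at hci
      rw [hz] at hcm
      obtain ⟨K, k1, K', k2, k3⟩ := chain_append.1 hci
      obtain ⟨Z, z1, Z', z2, z3⟩ := chain_append.1 hcm
      have hagree : ∀ r : Set V, (∀ k, i < k → k < m → ∀ t ∈ x k, LettersCommute Γ r t) →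
          ∀ d, i + 1 + d ≤ m → ∀ γ ∈ r, ∀ δ, Γ.Adj γ δ → H (i + 1) δ = H (i + 1 + d) δ := by
        intro r hr d
        induction d with
        | zero => intros; rfl
        | succ d ihd =>
          intro hd γ hγ δ hadj
          rw [ihd (by omega) γ hγ δ hadj]
          exact chain_agree (hr (i + 1 + d) (by omega) (by omega))
            (hc.chain (i + 1 + d) (by omega)) hγ (Or.inr hadj)
      have hagree' : ∀ r : Set V, (∀ k, i < k → k < m → ∀ t ∈ x k, LettersCommute Γ r t) →
          ∀ k, i < k → k ≤ m → ∀ γ ∈ r, ∀ δ, Γ.Adj γ δ → H (i + 1) δ = H k δ := by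
        intro r hr k h1 h2 γ hγ δ hadj
        obtain ⟨d, rfl⟩ : ∃ d, k = i + 1 + d := ⟨k - i - 1, by omega⟩
        exact hagree r hr d h2 γ hγ δ hadj
      rcases hcon with ⟨h1, h2, h3⟩ | ⟨h1, h2, h3⟩
      -- The `p`-part of `K`, the flag before the `p`-step, is kept until block `m`, where the
      -- `q`-step makes up for the omitted change.
      · have hcomm : ∀ k, i < k → k < m → ∀ t ∈ x k, LettersCommute Γ p t :=
          fun k a b t ht => h2 t (hkw k a b t ht)
        have hpy : ∀ t ∈ y', LettersCommute Γ p t := fun t ht => h2 t (hyw t ht)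
        have hCH : ∀ k, i < k → k ≤ m → ∀ γ ∈ p, ∀ δ, δ ∉ p → Γ.Adj γ δ → K δ = H k δ := by
          intro k a b γ hγ δ hδ hadj
          rw [k2.2.2 δ hδ, chain_agree hpy k3 hγ (Or.inr hadj)]
          exact hagree' p hcomm k a b γ hγ δ hadj
        refine hmin _ (Function.update x i (y ++ y')) i hi
          (fun k hk => Function.update_of_ne hk _ _)
          (by rw [Function.update_self, hy]; exact wordLT_delete _ _ _)
          (hc.exchange hM him hm
            (subset_exchangeSet hM hF hc hm hpi (h1.trans hqm) hcomm) k2.1.1 hCH hcomm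
            (fun k hk _ => Function.update_of_ne hk _ _) ?_ ?_ ?_)
        · intro k hk t ht
          by_cases hki : k = i
          · subst hki
            rw [Function.update_self] at ht
            refine hc.le k hk t ?_
            rw [hy]
            simp only [List.mem_append, List.mem_cons] at ht ⊢; tauto
          · rw [Function.update_of_ne hki] at ht
            exact hc.le k hk t ht
        · rw [Function.update_self]
          refine k1.append ?_
          have := hM.chain_splice (C := K) k2.1.1 k2.2.1.1
            (fun γ _ δ hδ _ => k2.2.2 δ hδ) hpy k3
          rwa [show splice p K K' = K from funext fun γ => by
            by_cases hγ : γ ∈ p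
            · rw [splice_of_mem hγ]
            · rw [splice_of_notMem hγ, k2.2.2 γ hγ] ] at this
        · rw [Function.update_of_ne (by omega), hz]
          have hzc := hM.chain_splice (C := K) k2.1.1 (hc.flag m hm.le)
            (hCH m him le_rfl) h3 z1
          refine hzc.append ⟨Z', ⟨?_, z2.2.1, fun γ hγ => ?_⟩, z3⟩
          · refine hM.isFlagIn_splice z2.1 k2.1 fun γ hγ δ hδ hadj => ?_
            rw [hCH m him le_rfl γ hγ δ hδ hadj]
            exact chain_agree h3 z1 hγ (Or.inr hadj)
          · rw [splice_of_notMem fun hp => hγ (h1 hp), z2.2.2 γ hγ]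
      -- The `q`-part of `Z'`, the flag after the `q`-step, is introduced already in block `i` as
      -- part of the `p`-step.
      · have hcomm : ∀ k, i < k → k < m → ∀ t ∈ x k, LettersCommute Γ q t :=
          fun k a b t ht => h2 t (hkw k a b t ht)
        have hqy : ∀ t ∈ y', LettersCommute Γ q t := fun t ht => h2 t (hyw t ht)
        have hCH1 : ∀ γ ∈ q, ∀ δ, δ ∉ q → Γ.Adj γ δ → Z' δ = H (i + 1) δ := by
          intro γ hγ δ hδ hadj
          rw [hagree' q hcomm m him le_rfl γ hγ δ hadj, ← z2.2.2 δ hδ]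
          exact (chain_agree h3 z1 hγ (Or.inr hadj)).symm
        have hCH : ∀ k, i < k → k ≤ m → ∀ γ ∈ q, ∀ δ, δ ∉ q → Γ.Adj γ δ → Z' δ = H k δ :=
          fun k a b γ hγ δ hδ hadj => (hCH1 γ hγ δ hδ hadj).trans
            (hagree' q hcomm k a b γ hγ δ hadj)
        have hCK : ∀ γ ∈ q, ∀ δ, δ ∉ q → Γ.Adj γ δ → Z' δ = K' δ := fun γ hγ δ hδ hadj =>
          (hCH1 γ hγ δ hδ hadj).trans (chain_agree hqy k3 hγ (Or.inr hadj)).symm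
        refine hmin _ (Function.update x m (z ++ z')) m hm
          (fun k hk => Function.update_of_ne hk _ _)
          (by rw [Function.update_self, hz]; exact wordLT_delete _ _ _)
          (hc.exchange hM him hm
            (subset_exchangeSet hM hF hc hm (h1.trans hpi) hqm hcomm) z2.2.1.1 hCH hcomm
            (fun k _ hk => Function.update_of_ne hk _ _) ?_ ?_ ?_)
        · intro k hk t ht
          by_cases hkm : k = m
          · subst hkm
            rw [Function.update_self] at ht
            refine hc.le k hk t ?_
            rw [hz]
            simp only [List.mem_append, List.mem_cons] at ht ⊢; tauto
          · rw [Function.update_of_ne hkm] at ht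
            exact hc.le k hk t ht
        · rw [Function.update_of_ne (by omega), hy]
          refine k1.append ⟨splice q Z' K', ⟨k2.1, ?_, fun γ hγ => ?_⟩,
            hM.chain_splice z2.2.1.1 k2.2.1.1 hCK hqy k3⟩
          · exact hM.isFlagIn_splice k2.2.1 z2.2.1 hCK
          · rw [splice_of_notMem fun hq => hγ (h1 hq), k2.2.2 γ hγ]
        · rw [Function.update_self]
          refine Chain.append ?_ z3
          have := hM.chain_splice (C := Z') z2.2.1.1 (hc.flag m hm.le) (hCH m him le_rfl) h3 z1
          rwa [show splice q Z' Z = Z' from funext fun γ => by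
            by_cases hγ : γ ∈ q
            · rw [splice_of_mem hγ]
            · rw [splice_of_notMem hγ, z2.2.2 γ hγ] ] at this
  have hchain : ∀ m ≤ n, Chain (TStep Γ Set.univ) (H 0) (blockWord x m) (H m) := by
    intro m
    induction m with
    | zero => intro _; rfl
    | succ m ih => intro hm; exact (ih (by omega)).append (htrue m hm)
  -- No position lies before `0` or after `n - 1`, so both end cut sets are empty and the deformed
  -- path is still closed.
  have h0 : H 0 = F 0 := funext fun γ => hc.cut 0 (by omega) γ fun ⟨a, b, h1, _⟩ => by omega
  have hn' : H n = F n := funext fun γ => hc.cut n le_rfl γ fun ⟨a, b, _, h1, h2, _⟩ => by omega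
  have hcl := hchain n le_rfl
  rw [hn', hF.closed, ← h0] at hcl
  have hnil := hsc _ _ ⟨hc.flag 0 (by omega), fun _ => trivial⟩ hcl (hred n le_rfl)
  have hx0 : x 0 = [] := by
    have key : ∀ m, 0 < m → blockWord x m = [] → x 0 = [] := by
      intro m
      induction m with
      | zero => intro h; omega
      | succ m ih =>
        intro _ he
        rw [blockWord, List.append_eq_nil_iff] at he
        rcases Nat.eq_zero_or_pos m with rfl | hm
        · exact he.2
        · exact ih hm he.1
    exact key n hn hnil
  -- An empty first block forces `H 0 = H 1`, although this step must change all colours of `s 0`.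
  have hd := hc.diffSet_eq hM hF hn
  have hch := hc.chain 0 hn
  rw [hx0] at hch
  obtain ⟨⟨γ, hγ⟩⟩ := (hF.letter 0 hn).nonempty
  rw [← hd] at hγ
  exact hγ (congrFun hch γ)

end Unsplit

/-! ### Adding a freely attached vertex -/

section OneVertex

variable {V : Type u} {Γ : SimpleGraph V} {M : Type v} [(gammaLang V).Structure M] {D : Set M}

variable (Γ D) in
/-- The vertex `b` of colour `γ` is joined to `D` only through the flag `F` of `D`. -/
structure IsFreeVertex (F : V → M) (γ : V) (b : M) : Prop where
  flag : IsFlagIn Γ D F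
  colour : HasColour γ b
  adj : ∀ x ∈ D, ∀ δ, HasColour δ x → Adj V b x → x = F δ

variable {F : V → M} {γ : V} {b : M}

theorem IsFreeVertex.flagIn_of_ne (hM : IsGammaGraph Γ M) (h : IsFreeVertex Γ D F γ b)
    {H : V → M} (hH : IsFlagIn Γ (insert b D) H) (hne : H γ ≠ b) : IsFlagIn Γ D H := by
  refine ⟨hH.1, fun δ => (hH.2 δ).resolve_left fun e => hne ?_⟩
  obtain rfl : δ = γ := hM.colour_unique (hH.1.1 δ) (e ▸ h.colour)
  exact e

theorem IsFreeVertex.eq_of_adj (hM : IsGammaGraph Γ M) (h : IsFreeVertex Γ D F γ b)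
    {H : V → M} (hH : IsFlagIn Γ (insert b D) H) (he : H γ = b) {δ : V} (hadj : Γ.Adj γ δ) :
    H δ = F δ := by
  refine h.adj _ ((hH.2 δ).resolve_left fun e => ?_) δ (hH.1.1 δ) ?_
  · exact hadj.ne (hM.colour_unique h.colour (e ▸ hH.1.1 δ))
  · rw [← he]; exact (hH.1.2 _ _).2 hadj

open Classical in
/-- The retraction that replaces the vertex `b` of a flag by the vertex of `F`. -/
noncomputable def retractFlag (F : V → M) (γ : V) (b : M) (H : V → M) : V → M :=
  if H γ = b then splice {γ} F H else H

theorem IsFreeVertex.flagIn_splice (hM : IsGammaGraph Γ M) (h : IsFreeVertex Γ D F γ b)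
    {H : V → M} (hH : IsFlagIn Γ (insert b D) H) (he : H γ = b) :
    IsFlagIn Γ D (splice {γ} F H) := by
  refine ⟨(hM.isFlagIn_splice hH (h.flag.mono (Set.subset_insert _ _)) ?_).1, fun δ => ?_⟩
  · rintro _ rfl δ - hadj; exact (h.eq_of_adj hM hH he hadj).symm
  · by_cases hδ : δ = γ
    · rw [splice_of_mem (by simpa using hδ)]; exact h.flag.2 δ
    · rw [splice_of_notMem (by simpa using hδ)]
      refine (hH.2 δ).resolve_left fun e => hδ (hM.colour_unique (hH.1.1 δ) (e ▸ h.colour))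

theorem IsFreeVertex.mem_of_step {H H' : V → M} {s : Set V} (he : H γ ≠ b) (he' : H' γ = b)
    (hs : LStep Γ (insert b D) H s H') : γ ∈ s :=
  by_contra fun hγ => he ((hs.2.2 γ hγ).trans he')

/-- Passing from the retracted flag to `H'` costs only the proper part `{γ}` of `s`, so a
decomposition of the retracted step would decompose the given one. -/
theorem IsFreeVertex.tstep_enter (hM : IsGammaGraph Γ M) (h : IsFreeVertex Γ D F γ b)
    {H H' : V → M} {s : Set V} (hs : TStep Γ (insert b D) H s H') (he : H γ ≠ b)
    (he' : H' γ = b) (hγ : s ≠ {γ}) : TStep Γ D H s (splice {γ} F H') := by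
  have hγs : γ ∈ s := IsFreeVertex.mem_of_step he he' hs.1
  have hsub : ({γ} : Set V) ⊂ s := lt_of_le_of_ne (Set.singleton_subset_iff.2 hγs) hγ.symm
  have hfl := h.flagIn_splice hM hs.1.2.1 he'
  refine ⟨⟨h.flagIn_of_ne hM hs.1.1 he, hfl, fun δ hδ => ?_⟩, fun y hy hc => ?_⟩
  · rw [splice_of_notMem (by rintro rfl; exact hδ hγs)]; exact hs.1.2.2 δ hδ
  · refine hs.2 (y ++ [{γ}]) (fun t ht => ?_)
      ((hc.mono fun _ _ _ => LStep.mono (Set.subset_insert _ _)).append (chain_singleton.2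
        ⟨hfl.mono (Set.subset_insert _ _), hs.1.2.1, fun δ hδ => splice_of_notMem hδ⟩))
    rcases List.mem_append.1 ht with ht | ht
    · exact hy t ht
    · rwa [List.mem_singleton.1 ht]

/-- A step between flags that contain `b` commutes with the colour of `b`. -/
theorem IsFreeVertex.commute (hM : IsGammaGraph Γ M) (h : IsFreeVertex Γ D F γ b)
    {H H' : V → M} {s : Set V} (hs : TStep Γ (insert b D) H s H') (he : H γ = b)
    (he' : H' γ = b) : LettersCommute Γ {γ} s := by
  rintro _ rfl δ hδ
  rw [← hs.diffSet_eq] at hδ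
  refine ⟨?_, fun hadj => hδ ?_⟩
  · rintro rfl; exact hδ (he.trans he'.symm)
  · rw [h.eq_of_adj hM hs.1.1 he hadj, h.eq_of_adj hM hs.1.2.1 he' hadj]

theorem IsFreeVertex.tstep_retract (hM : IsGammaGraph Γ M) (h : IsFreeVertex Γ D F γ b)
    {H H' : V → M} {s : Set V} (hs : TStep Γ (insert b D) H s H')
    (hγ : ¬ (s = {γ} ∧ (H γ ≠ b ∧ H' γ = b ∨ H γ = b ∧ H' γ ≠ b))) :
    TStep Γ D (retractFlag F γ b H) s (retractFlag F γ b H') := by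
  unfold retractFlag
  by_cases he : H γ = b <;> by_cases he' : H' γ = b
  · rw [if_pos he, if_pos he']
    have hc := h.commute hM hs he he'
    have hγs : γ ∉ s := fun hγ => (hc γ rfl γ hγ).1 rfl
    have hne : ∀ δ ∈ s, δ ∉ ({γ} : Set V) := by rintro _ hδ rfl; exact hγs hδ
    have h1 := h.flagIn_splice hM hs.1.1 he
    have h2 := h.flagIn_splice hM hs.1.2.1 he'
    refine (hM.tstep_transport hs (F' := splice {γ} F H) (G' := splice {γ} F H')
      ⟨h1.mono (Set.subset_insert _ _), h2.mono (Set.subset_insert _ _), fun δ hδ => ?_⟩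
      (fun δ hδ => (splice_of_notMem (hne δ hδ)).symm)
      (fun δ hδ => (splice_of_notMem (hne δ hδ)).symm)
      fun δ hδ ε _ hadj => (splice_of_notMem ?_).symm).anti (Set.subset_insert _ _) h1 h2
    · by_cases hδγ : δ ∈ ({γ} : Set V)
      · rw [splice_of_mem hδγ, splice_of_mem hδγ]
      · rw [splice_of_notMem hδγ, splice_of_notMem hδγ]; exact hs.1.2.2 δ hδ
    · rintro rfl; exact (hc ε rfl δ hδ).2 hadj.symm
  · rw [if_pos he, if_neg he']
    exact (h.tstep_enter hM hs.symm he' he fun e => hγ ⟨e, Or.inr ⟨he, he'⟩⟩).symm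
  · rw [if_neg he, if_pos he']
    exact h.tstep_enter hM hs he he' fun e => hγ ⟨e, Or.inl ⟨he, he'⟩⟩
  · rw [if_neg he, if_neg he']
    exact hs.anti (Set.subset_insert _ _) (h.flagIn_of_ne hM hs.1.1 he)
      (h.flagIn_of_ne hM hs.1.2.1 he')

/-- Retraction keeps every step true except a `{γ}`-step that enters or leaves `b`. Either the whole
path retracts with the same word, or such a step is isolated. -/
theorem IsFreeVertex.chain_retract_or (hM : IsGammaGraph Γ M) (h : IsFreeVertex Γ D F γ b)
    {A E : V → M} {w : List (Set V)} (hw : Chain (TStep Γ (insert b D)) A w E) :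
    Chain (TStep Γ D) (retractFlag F γ b A) w (retractFlag F γ b E) ∨
    ∃ a c H H', w = a ++ {γ} :: c ∧ Chain (TStep Γ (insert b D)) A a H ∧
      TStep Γ (insert b D) H {γ} H' ∧ Chain (TStep Γ (insert b D)) H' c E ∧
      (H γ ≠ b ∧ H' γ = b ∨ H γ = b ∧ H' γ ≠ b) := by
  induction w generalizing A with
  | nil => left; rw [hw]; rfl
  | cons s w ih =>
    obtain ⟨K, h1, h2⟩ := hw
    by_cases hb : s = {γ} ∧ (A γ ≠ b ∧ K γ = b ∨ A γ = b ∧ K γ ≠ b)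
    · obtain ⟨rfl, hb⟩ := hb
      exact Or.inr ⟨[], w, A, K, rfl, rfl, h1, h2, hb⟩
    · rcases ih h2 with h3 | ⟨a, c, H, H', rfl, k1, k2, k3, k4⟩
      · exact Or.inl ⟨_, h.tstep_retract hM h1 hb, h3⟩
      · exact Or.inr ⟨s :: a, c, H, H', rfl, ⟨K, h1, k1⟩, k2, k3, k4⟩

/-- After entering the flags through `b` by the letter `{γ}`, a reduced path stays there. -/
theorem IsFreeVertex.stay (hM : IsGammaGraph Γ M) (h : IsFreeVertex Γ D F γ b)
    {H E : V → M} {y c z : List (Set V)} (hr : WordReduced Γ (z ++ {γ} :: (c ++ y)))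
    (hc : ∀ t ∈ c, LettersCommute Γ {γ} t)
    (hw : Chain (TStep Γ (insert b D)) H y E) (he : H γ = b) :
    E γ = b := by
  induction y generalizing H c with
  | nil => rw [← hw, he]
  | cons t y ih =>
    obtain ⟨K, h1, h2⟩ := hw
    have hK : K γ = b := by
      by_contra hK
      refine hr z {γ} c t y rfl (Or.inl ⟨Set.singleton_subset_iff.2 ?_, hc⟩)
      exact IsFreeVertex.mem_of_step hK he h1.1.symm
    refine ih (c := c ++ [t]) (by simpa using hr) (fun r hr => ?_) h2 hK
    rcases List.mem_append.1 hr with hr | hr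
    · exact hc r hr
    · rw [List.mem_singleton.1 hr]; exact h.commute hM h1 he hK

/-- The first occurrence of `{γ}` after the initial one is separated from it only by letters that
commute with `{γ}`. -/
theorem not_wordReduced_of_singleton {z a c : List (Set V)}
    (ha : ∀ t ∈ a, t = {γ} ∨ LettersCommute Γ {γ} t) :
    ¬ WordReduced Γ (z ++ {γ} :: (a ++ {γ} :: c)) := by
  have key : ∀ (a d : List (Set V)), (∀ t ∈ a, t = {γ} ∨ LettersCommute Γ {γ} t) →
      (∀ t ∈ d, LettersCommute Γ {γ} t) →
      ¬ WordReduced Γ (z ++ {γ} :: (d ++ (a ++ {γ} :: c))) := by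
    intro a
    induction a with
    | nil => exact fun d _ hd hr => hr z {γ} d {γ} c rfl (Or.inl ⟨le_rfl, hd⟩)
    | cons t a ih =>
      intro d ha hd hr
      rcases ha t (by simp) with rfl | ht
      · exact hr z {γ} d {γ} _ rfl (Or.inl ⟨le_rfl, hd⟩)
      · refine ih (d ++ [t]) (fun r hr => ha r (by simp [hr])) (fun r hr => ?_) (by simpa using hr)
        rcases List.mem_append.1 hr with hr | hr
        · exact hd r hr
        · rwa [List.mem_singleton.1 hr]
  exact key a [] ha (by simp)

/-- Both flags agree with `F` at the neighbours of `γ`, so they are joined by two lazy steps: one at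
`γ` and one along the remaining colours not adjacent to `γ`. By `covering` every letter lies in one
of these two sets. -/
theorem IsFreeVertex.letters [Finite V] (hM : IsGammaGraph Γ M) (h : IsFreeVertex Γ D F γ b)
    (hD : SimplyConnectedOn Γ D) {A E : V → M} (hA : IsFlagIn Γ D A) (hE : IsFlagIn Γ D E)
    (hAF : ∀ δ, Γ.Adj γ δ → A δ = F δ) (hEF : ∀ δ, Γ.Adj γ δ → E δ = F δ) {a : List (Set V)}
    (ha : Chain (TStep Γ D) A a E) (hr : WordReduced Γ a) :
    ∀ t ∈ a, t = {γ} ∨ LettersCommute Γ {γ} t := by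
  have hN : IsFlagIn Γ D (splice {γ} A E) := by
    refine hM.isFlagIn_splice hE hA ?_
    rintro _ rfl δ - hadj
    rw [hAF δ hadj, hEF δ hadj]
  obtain ⟨L, hL⟩ := covering hM hD
    (X := [(({γ} : Set V), 0), ({δ | γ ≠ δ ∧ ¬ Γ.Adj γ δ}, 1)]) hA (by simp) ha hr (by
      refine ⟨splice {γ} A E, ⟨hE, hN, fun δ hδ => (splice_of_notMem hδ).symm⟩, A,
        ⟨hN, hA, fun δ hδ => ?_⟩, rfl⟩
      by_cases hδγ : δ ∈ ({γ} : Set V)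
      · rw [splice_of_mem hδγ]
      · rw [splice_of_notMem hδγ]
        have hadj : Γ.Adj γ δ := by
          by_contra hn
          exact hδ ⟨fun e => hδγ e.symm, hn⟩
        rw [hAF δ hadj, hEF δ hadj])
  have hne : ∀ t ∈ a, t.Nonempty := by
    clear hr hL hN hAF hA
    induction a generalizing A with
    | nil => simp
    | cons s a ih =>
      obtain ⟨K, k1, k2⟩ := ha
      intro t ht
      rcases List.mem_cons.1 ht with rfl | ht
      · exact k1.nonempty
      · exact ih k2 t ht
  intro t ht
  have ht' := ht
  rw [← hL.word] at ht
  obtain ⟨r, hr', rfl⟩ := List.mem_map.1 ht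
  obtain ⟨x, hx, h1, -⟩ := hL.le r hr'
  simp only [List.mem_cons, List.not_mem_nil, or_false] at hx
  rcases hx with rfl | rfl
  · left
    exact (Set.Nonempty.subset_singleton_iff (hne _ ht')).1 h1
  · right
    rintro _ rfl δ hδ
    exact h1 hδ

/-- After entering through `b` a reduced path stays there, so the closed path also starts at `b` and
must leave it before `H`. Between a letter `{γ}` occurring before `H` and the later entrance, all
letters are `{γ}` or commute with it, which contradicts reducedness. -/
theorem IsFreeVertex.not_enter [Finite V] (hM : IsGammaGraph Γ M) (h : IsFreeVertex Γ D F γ b)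
    (hD : SimplyConnectedOn Γ D) {A H H' : V → M} {a c : List (Set V)}
    (hr : WordReduced Γ (a ++ {γ} :: c)) (ha : Chain (TStep Γ (insert b D)) A a H)
    (hs : TStep Γ (insert b D) H {γ} H') (hc : Chain (TStep Γ (insert b D)) H' c A)
    (he : H γ ≠ b) (he' : H' γ = b) : False := by
  have hAb : A γ = b := h.stay hM (c := []) (by simpa using hr) (by simp) hc he'
  have hra : WordReduced Γ a := hr.of_append_left
  have hH := h.flagIn_of_ne hM hs.1.1 he
  have hA : IsFlagIn Γ (insert b D) A := hc.of_prop (fun _ _ _ h _ => h.1.2.1) hs.1.2.1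
  have hHF : ∀ δ, Γ.Adj γ δ → H δ = F δ := fun δ hadj =>
    (hs.1.2.2 δ fun e => hadj.ne (Set.mem_singleton_iff.1 e).symm).trans
      (h.eq_of_adj hM hs.1.2.1 he' hadj)
  rcases h.chain_retract_or hM ha with hg | ⟨a₁, a₂, K, K', rfl, k1, k2, k3, hb⟩
  · rw [retractFlag, if_pos hAb, retractFlag, if_neg he] at hg
    have hlet := h.letters hM hD (h.flagIn_splice hM hA hAb) hH (fun δ hadj => by
      rw [splice_of_notMem fun e => hadj.ne (Set.mem_singleton_iff.1 e).symm]
      exact h.eq_of_adj hM hA hAb hadj) hHF hg hra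
    have hmem : ({γ} : Set V) ∈ a := by
      by_contra hcon
      refine he ?_
      rw [← chain_ne_of_mem ha.lstep fun t ht hγ => ?_, hAb]
      rcases hlet t ht with rfl | hcm
      · exact hcon ht
      · exact (hcm γ rfl γ hγ).1 rfl
    obtain ⟨a₁, a₂, rfl⟩ := List.append_of_mem hmem
    exact not_wordReduced_of_singleton (z := a₁) (a := a₂) (c := c)
      (fun t ht => hlet t (by simp [ht])) (by simpa using hr)
  · rcases hb with ⟨-, hb⟩ | ⟨hK, hK'⟩
    · exact he (h.stay hM (c := []) (by simpa using hra) (by simp) k3 hb)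
    · have hK'D := h.flagIn_of_ne hM k2.1.2.1 hK'
      have hra₂ : WordReduced Γ a₂ := by
        rw [show a₁ ++ {γ} :: a₂ = (a₁ ++ [{γ}]) ++ a₂ by simp] at hra
        exact hra.of_append_right
      rcases h.chain_retract_or hM k3 with hg | ⟨c₁, c₂, L, L', rfl, l1, l2, l3, hb⟩
      · rw [retractFlag, if_neg hK', retractFlag, if_neg he] at hg
        have hlet := h.letters hM hD hK'D hH (fun δ hadj => by
          rw [← k2.1.2.2 δ fun e => hadj.ne (Set.mem_singleton_iff.1 e).symm]
          exact h.eq_of_adj hM k2.1.1 hK hadj) hHF hg hra₂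
        exact not_wordReduced_of_singleton (z := a₁) (a := a₂) (c := c) hlet (by simpa using hr)
      · rcases hb with ⟨-, hb⟩ | ⟨hb, -⟩
        · refine he (h.stay hM (z := []) (c := []) ?_ (by simp) l3 hb)
          exact hra₂.of_append_right
        · refine hK' (h.stay hM (z := []) (c := []) (y := c₁.reverse) ?_ (by simp)
            (l1.reverse fun _ _ _ => TStep.symm) hb)
          have := hra₂.reverse
          simp only [List.reverse_append, List.reverse_cons, List.append_assoc,
            List.singleton_append] at this
          exact this.of_append_right

/-- A free vertex can be added without destroying simple connectedness. -/
theorem IsFreeVertex.simplyConnectedOn [Finite V] (hM : IsGammaGraph Γ M)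
    (h : IsFreeVertex Γ D F γ b) (hD : SimplyConnectedOn Γ D) :
    SimplyConnectedOn Γ (insert b D) := by
  intro A w hA hw hr
  rcases h.chain_retract_or hM hw with hg | ⟨a, c, H, H', rfl, k1, k2, k3, hb⟩
  · refine hD _ w ?_ hg hr
    unfold retractFlag
    split_ifs with he
    · exact h.flagIn_splice hM hA he
    · exact h.flagIn_of_ne hM hA he
  · exfalso
    rcases hb with ⟨h1, h2⟩ | ⟨h1, h2⟩
    · exact h.not_enter hM hD hr k1 k2 k3 h1 h2
    · have := hr.reverse
      simp only [List.reverse_append, List.reverse_cons, List.append_assoc,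
        List.singleton_append] at this
      exact h.not_enter hM hD this (k3.reverse fun _ _ _ => TStep.symm) k2.symm
        (k1.reverse fun _ _ _ => TStep.symm) h2 h1

end OneVertex

/-! ### The free model -/

section FreeModel

/-- Names for the vertices of the free model: the vertices of a first flag, and vertices that are
joined freely to a given family of vertices. -/
inductive FreeVertex (V : Type u) : Type u
  | base (γ : V) : FreeVertex V
  | new (γ : V) (k : ℕ) (F : V → FreeVertex V) : FreeVertex V

namespace FreeVertex

variable {V : Type u} (Γ : SimpleGraph V)

/-- The colour of a vertex. -/
def colour : FreeVertex V → V
  | base γ => γ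
  | new γ _ _ => γ

/-- Edges, directed from new vertices to older ones. -/
inductive Arrow : FreeVertex V → FreeVertex V → Prop
  | base {γ δ : V} : Γ.Adj γ δ → Arrow (base γ) (base δ)
  | new {γ δ : V} {k : ℕ} {F : V → FreeVertex V} : Γ.Adj γ δ → Arrow (new γ k F) (F δ)

/-- The edge relation. -/
def Edge (a b : FreeVertex V) : Prop := Arrow Γ a b ∨ Arrow Γ b a

/-- A vertex is admissible if it is hereditarily joined to flags. -/
def Admissible : FreeVertex V → Prop
  | base _ => True
  | new _ _ F => (∀ δ, (F δ).colour = δ) ∧ (∀ δ ε, Γ.Adj δ ε → Edge Γ (F δ) (F ε)) ∧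
      ∀ δ, Admissible (F δ)

/-- The height of a vertex. -/
noncomputable def height [Finite V] : FreeVertex V → ℕ
  | base _ => 0
  | new _ _ F => (letI := Fintype.ofFinite V; Finset.univ.sup fun δ => (F δ).height) + 1

theorem height_lt [Finite V] (γ : V) (k : ℕ) (F : V → FreeVertex V) (δ : V) :
    (F δ).height < (new γ k F).height := by
  let := Fintype.ofFinite V
  rw [height, Nat.lt_succ_iff]
  exact Finset.le_sup (f := fun δ => (F δ).height) (Finset.mem_univ δ)

/-- All vertices that are needed to construct a vertex. -/
def support : FreeVertex V → Set (FreeVertex V)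
  | base γ => {base γ}
  | new γ k F => insert (new γ k F) (⋃ δ, (F δ).support)

theorem mem_support (a : FreeVertex V) : a ∈ a.support := by
  cases a <;> simp [support]

theorem finite_support [Finite V] (a : FreeVertex V) : a.support.Finite := by
  induction a with
  | base γ => exact Set.finite_singleton _
  | new γ k F ih => exact (Set.finite_iUnion ih).insert _

theorem support_closed {a : FreeVertex V} {γ : V} {k : ℕ} {F : V → FreeVertex V}
    (h : new γ k F ∈ a.support) (δ : V) : F δ ∈ a.support := by
  induction a with
  | base γ => simp [support] at h
  | new γ' k' F' ih =>
    simp only [support, Set.mem_insert_iff, new.injEq, Set.mem_iUnion] at h ⊢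
    right
    rcases h with ⟨rfl, rfl, rfl⟩ | ⟨ε, h⟩
    · exact ⟨δ, mem_support _⟩
    · exact ⟨ε, ih ε h⟩

end FreeVertex

variable {V : Type u} (Γ : SimpleGraph V)

/-- The free model. -/
def FreeModel : Type u := {a : FreeVertex V // a.Admissible Γ}

instance : (gammaLang V).Structure (FreeModel Γ) where
  funMap f := Empty.elim f
  RelMap {n} r x := match n, r, x with
    | _, GammaRel.edge, x => FreeVertex.Edge Γ (x 0).1 (x 1).1
    | _, GammaRel.colour γ, x => (x 0).1.colour = γ

namespace FreeModel

variable {Γ}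

theorem hasColour_iff {a : FreeModel Γ} {γ : V} : HasColour γ a ↔ a.1.colour = γ := Iff.rfl

theorem colour_adj {a b : FreeVertex V} (ha : a.Admissible Γ) (hab : FreeVertex.Arrow Γ a b) :
    Γ.Adj a.colour b.colour := by
  cases hab with
  | base h => exact h
  | @new γ δ k F h => rw [ha.1 δ]; exact h

theorem isGammaGraph : IsGammaGraph Γ (FreeModel Γ) where
  symm a b h := Or.symm h
  irrefl a h := by
    rcases h with h | h <;> exact (colour_adj a.2 h).ne rfl
  colour a := ⟨a.1.colour, rfl, fun _ h => h.symm⟩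
  edge_colour a b γ δ ha hb h := by
    rw [hasColour_iff] at ha hb
    subst ha hb
    rcases h with h | h
    · exact colour_adj a.2 h
    · exact (colour_adj b.2 h).symm

variable (Γ) in
/-- The first flag. -/
def baseFlag : V → FreeModel Γ := fun γ => ⟨.base γ, trivial⟩

theorem isFlag_baseFlag : IsFlag Γ (baseFlag Γ) :=
  isGammaGraph.isFlag (fun _ => rfl) fun _ _ h => Or.inl (.base h)

/-- A new vertex over a flag. -/
def newVertex {F : V → FreeModel Γ} (hF : IsFlag Γ F) (γ : V) (k : ℕ) : FreeModel Γ :=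
  ⟨.new γ k fun δ => (F δ).1, hF.1, fun δ ε h => (hF.2 δ ε).2 h, fun δ => (F δ).2⟩

open Classical in
theorem isFlag_update {F : V → FreeModel Γ} (hF : IsFlag Γ F) (γ : V) (k : ℕ) :
    IsFlag Γ (Function.update F γ (newVertex hF γ k)) := by
  refine isGammaGraph.isFlag (fun δ => ?_) fun δ ε h => ?_
  · by_cases hδ : δ = γ
    · subst hδ; rw [Function.update_self]; rfl
    · rw [Function.update_of_ne hδ]; exact hF.1 δ
  · by_cases hδ : δ = γ
    · subst hδ
      rw [Function.update_self, Function.update_of_ne h.ne']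
      exact Or.inl (.new (F := fun δ => (F δ).1) h)
    · rw [Function.update_of_ne hδ]
      by_cases hε : ε = γ
      · subst hε
        rw [Function.update_self]
        exact Or.inr (.new (F := fun δ => (F δ).1) h.symm)
      · rw [Function.update_of_ne hε]; exact (hF.2 δ ε).2 h

theorem exists_eq_newVertex {γ : V} {k : ℕ} {F : V → FreeVertex V}
    (h : (FreeVertex.new γ k F).Admissible Γ) :
    ∃ (F' : V → FreeModel Γ) (hF : IsFlag Γ F'), (∀ δ, (F' δ).1 = F δ) ∧
      newVertex hF γ k = ⟨.new γ k F, h⟩ :=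
  ⟨fun δ => ⟨F δ, h.2.2 δ⟩, isGammaGraph.isFlag h.1 h.2.1, fun _ => rfl, rfl⟩

theorem isGammaSpace : IsGammaSpace Γ (FreeModel Γ) where
  toIsGammaGraph := isGammaGraph
  vertex_flag := by
    classical
    rintro ⟨a, ha⟩
    cases a with
    | base γ => exact ⟨_, isFlag_baseFlag, γ, rfl⟩
    | new γ k F =>
      obtain ⟨F', hF, -, he⟩ := exists_eq_newVertex ha
      exact ⟨_, isFlag_update hF γ k, γ, by rw [Function.update_self, he]⟩
  edge_flag := by
    classical
    have key : ∀ a b : FreeModel Γ, FreeVertex.Arrow Γ a.1 b.1 →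
        ∃ F : V → FreeModel Γ, IsFlag Γ F ∧ a ∈ Set.range F ∧ b ∈ Set.range F := by
      rintro ⟨a, ha⟩ ⟨b, hb⟩ hab
      cases hab with
      | @base γ δ h => exact ⟨_, isFlag_baseFlag, ⟨γ, rfl⟩, ⟨δ, rfl⟩⟩
      | @new γ δ k F h =>
        obtain ⟨F', hF, hF', he⟩ := exists_eq_newVertex ha
        refine ⟨_, isFlag_update hF γ k, ⟨γ, by rw [Function.update_self, he]⟩, ⟨δ, ?_⟩⟩
        rw [Function.update_of_ne h.ne']
        exact Subtype.ext (hF' δ)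
    rintro a b (h | h)
    · exact key a b h
    · obtain ⟨F, hF, h1, h2⟩ := key b a h
      exact ⟨F, hF, h2, h1⟩

theorem hasInfiniteResidues : HasInfiniteResidues Γ (FreeModel Γ) := by
  classical
  intro γ F hF
  refine Set.infinite_of_injective_forall_mem
    (f := fun k : ℕ => Function.update F γ (newVertex hF γ k)) ?_ ?_
  · intro k l h
    have := congrFun h γ
    simp only [Function.update_self] at this
    have := congrArg Subtype.val this
    simp only [newVertex, FreeVertex.new.injEq] at this
    exact this.2.1
  · exact fun k => ⟨isFlag_update hF γ k, fun δ hδ => Function.update_of_ne hδ _ _⟩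

variable (Γ) in
/-- Sets of vertices that contain the first flag and, with each new vertex, the flag over which it
was constructed. -/
structure IsClosedSet (D : Set (FreeModel Γ)) : Prop where
  base : ∀ γ, baseFlag Γ γ ∈ D
  new : ∀ (F : V → FreeModel Γ) (hF : IsFlag Γ F) (γ : V) (k : ℕ), newVertex hF γ k ∈ D →
    ∀ δ, F δ ∈ D

/-- A new vertex of maximal height can be removed: no other vertex of `D` is built over it, so it is
free over the rest, which is again closed. When no new vertex remains, the first flag is the only
flag and there are no steps. -/
theorem IsClosedSet.simplyConnectedOn [Finite V] {D : Set (FreeModel Γ)} (hD : IsClosedSet Γ D)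
    (hfin : D.Finite) : SimplyConnectedOn Γ D := by
  induction hn : D.ncard using Nat.strong_induction_on generalizing D with
  | _ n ih =>
  subst hn
  by_cases hb : ∃ (F : V → FreeModel Γ) (hF : IsFlag Γ F) (γ : V) (k : ℕ), newVertex hF γ k ∈ D
  · obtain ⟨F₀, hF₀, γ₀, k₀, h₀⟩ := hb
    obtain ⟨b, hbD, hmax⟩ := hfin.exists_maximalFor (fun a : FreeModel Γ => a.1.height) D ⟨_, h₀⟩
    have hmax : ∀ a ∈ D, a.1.height ≤ b.1.height := fun a ha => by
      by_contra hlt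
      exact hlt (hmax ha (le_of_lt (not_le.1 hlt)))
    have hbn : ∃ (F : V → FreeModel Γ) (hF : IsFlag Γ F) (γ : V) (k : ℕ),
        newVertex hF γ k = b := by
      obtain ⟨b, hb⟩ := b
      cases b with
      | base γ =>
        have := hmax _ h₀
        simp [FreeVertex.height, newVertex] at this
      | new γ k F =>
        obtain ⟨F', hF', -, he⟩ := exists_eq_newVertex hb
        exact ⟨F', hF', γ, k, he⟩
    obtain ⟨F, hF, γ, k, rfl⟩ := hbn
    have hlow : ∀ (F' : V → FreeModel Γ) (hF' : IsFlag Γ F') (γ' : V) (k' : ℕ),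
        newVertex hF' γ' k' ∈ D → ∀ δ, F' δ ≠ newVertex hF γ k := by
      intro F' hF' γ' k' h' δ e
      have h1 := hmax _ h'
      have h2 := FreeVertex.height_lt γ' k' (fun δ => (F' δ).1) δ
      rw [← e] at h1
      exact absurd h2 (not_lt.2 h1)
    have hD' : IsClosedSet Γ (D \ {newVertex hF γ k}) := by
      refine ⟨fun δ => ⟨hD.base δ, fun e => ?_⟩, fun F' hF' γ' k' h' δ =>
        ⟨hD.new F' hF' γ' k' h'.1 δ, hlow F' hF' γ' k' h'.1 δ⟩⟩
      have := congrArg Subtype.val (Set.mem_singleton_iff.1 e)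
      simp [baseFlag, newVertex] at this
    have hfree : IsFreeVertex Γ (D \ {newVertex hF γ k}) F γ (newVertex hF γ k) := by
      refine ⟨⟨hF, fun δ => ⟨hD.new F hF γ k hbD δ, hlow F hF γ k hbD δ⟩⟩, rfl,
        fun x hx δ hδ hadj => ?_⟩
      rw [hasColour_iff] at hδ
      subst hδ
      obtain ⟨x, hxa⟩ := x
      replace hadj : FreeVertex.Edge Γ (newVertex hF γ k).1 x := hadj
      generalize hv : (newVertex hF γ k).1 = v at hadj
      rcases hadj with hadj | hadj
      · cases hadj with
        | base h => simp [newVertex] at hv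
        | @new γ' δ' k' F' h =>
          simp only [newVertex, FreeVertex.new.injEq] at hv
          obtain ⟨rfl, rfl, rfl⟩ := hv
          refine Subtype.ext ?_
          have : (F δ').1.colour = δ' := hF.1 δ'
          simp only [this]
      · cases hadj with
        | base h => simp [newVertex] at hv
        | @new γ' δ' k' F' h =>
          exfalso
          obtain ⟨F'', hF'', he1, he2⟩ := exists_eq_newVertex hxa
          refine hlow F'' hF'' γ' k' (by rw [he2]; exact hx.1) δ' (Subtype.ext ?_)
          rw [he1, hv]
    have := hfree.simplyConnectedOn isGammaGraph (ih _
      (Set.ncard_sdiff_singleton_lt_of_mem hbD hfin) hD' (hfin.subset Set.sdiff_subset) rfl)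
    rwa [Set.insert_sdiff_singleton, Set.insert_eq_of_mem hbD] at this
  · have huniq : ∀ H : V → FreeModel Γ, IsFlagIn Γ D H → H = baseFlag Γ := by
      intro H hH
      funext γ
      have h1 : (H γ).1.colour = γ := hH.1.1 γ
      have h2 := hH.2 γ
      generalize H γ = a at h1 h2
      obtain ⟨a, ha⟩ := a
      cases a with
      | base δ => obtain rfl : δ = γ := h1; rfl
      | new δ k F =>
        obtain ⟨F', hF', -, he⟩ := exists_eq_newVertex ha
        exact absurd ⟨F', hF', δ, k, by rw [he]; exact h2⟩ hb
    intro A w hA hw hr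
    cases w with
    | nil => rfl
    | cons s w =>
      obtain ⟨K, k1, -⟩ := hw
      obtain ⟨γ, hγ⟩ := k1.nonempty
      rw [← k1.diffSet_eq, huniq A k1.1.1, huniq K k1.1.2.1] at hγ
      exact absurd rfl hγ

theorem exists_closedSet [Finite V] {S : Set (FreeModel Γ)} (hS : S.Finite) :
    ∃ D, S ⊆ D ∧ D.Finite ∧ IsClosedSet Γ D := by
  let D : Set (FreeVertex V) := (⋃ γ, {FreeVertex.base γ}) ∪ ⋃ a ∈ S, a.1.support
  have hD : D.Finite := (Set.finite_iUnion fun _ => Set.finite_singleton _).union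
    (hS.biUnion fun a _ => a.1.finite_support)
  refine ⟨Subtype.val ⁻¹' D, fun a ha => Or.inr (Set.mem_biUnion ha a.1.mem_support),
    hD.preimage Subtype.val_injective.injOn, fun γ => Or.inl (Set.mem_iUnion.2 ⟨γ, rfl⟩), ?_⟩
  rintro F hF γ k (h | h) δ
  · obtain ⟨γ', h⟩ := Set.mem_iUnion.1 h
    simp [newVertex] at h
  · simp only [Set.mem_iUnion] at h
    obtain ⟨a, ha, h⟩ := h
    exact Or.inr (Set.mem_biUnion ha (FreeVertex.support_closed h δ))

/-- A path meets finitely many vertices, which lie in a finite closed set. True steps stay true in a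
smaller vertex set, where fewer decompositions are available. -/
theorem simplyConnectedOn [Finite V] : SimplyConnectedOn Γ (Set.univ : Set (FreeModel Γ)) := by
  have key : ∀ (w : List (Set V)) (A E : V → FreeModel Γ), Chain (TStep Γ Set.univ) A w E →
      IsFlag Γ A → ∃ S : Set (FreeModel Γ), S.Finite ∧ ∀ D, S ⊆ D →
        IsFlagIn Γ D A ∧ Chain (TStep Γ D) A w E := by
    intro w
    induction w with
    | nil =>
      intro A E h hA
      exact ⟨Set.range A, Set.finite_range A, fun D hD => ⟨⟨hA, fun γ => hD ⟨γ, rfl⟩⟩, h⟩⟩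
    | cons s w ih =>
      rintro A E ⟨K, h1, h2⟩ hA
      obtain ⟨S, hS, hSD⟩ := ih K E h2 h1.1.2.1.1
      refine ⟨Set.range A ∪ S, (Set.finite_range A).union hS, fun D hD => ?_⟩
      obtain ⟨h3, h4⟩ := hSD D (Set.subset_union_right.trans hD)
      have hA' : IsFlagIn Γ D A := ⟨hA, fun γ => hD (Or.inl ⟨γ, rfl⟩)⟩
      exact ⟨hA', K, h1.anti (Set.subset_univ _) hA' h3, h4⟩
  intro A w hA hw hr
  obtain ⟨S, hS, hSD⟩ := key w A A hw hA.1
  obtain ⟨D, hSD', hD, hc⟩ := exists_closedSet hS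
  obtain ⟨h1, h2⟩ := hSD D hSD'
  exact hc.simplyConnectedOn hD A w h1 h2 hr

theorem isPSSpace [Finite V] : IsPSSpace Γ (FreeModel Γ) where
  toIsGammaSpace := isGammaSpace
  simply_connected := isGammaGraph.isSimplyConnected_iff.2 simplyConnectedOn
  infinite_residues := hasInfiniteResidues

end FreeModel

end FreeModel

open FirstOrder FirstOrder.Language FirstOrder.Language.Structure

/-! ### First-order formulas for flags and paths -/

section Formulas

variable {V : Type u} (Γ : SimpleGraph V) {M : Type v} [(gammaLang V).Structure M] {α : Type w}

variable (V) in
/-- The formula `Adj a b`. -/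
def edgeFormula (a b : α) : (gammaLang V).Formula α :=
  Relations.formula₂ (L := gammaLang V) (GammaRel.edge (V := V)) (.var a) (.var b)

/-- The formula `HasColour γ a`. -/
def colourFormula (γ : V) (a : α) : (gammaLang V).Formula α :=
  Relations.formula₁ (L := gammaLang V) (GammaRel.colour γ) (.var a)

variable (V) in
/-- The formula `a = b`. -/
def eqFormula (a b : α) : (gammaLang V).Formula α :=
  Term.equal (L := gammaLang V) (.var a) (.var b)

open scoped Classical in
variable (V) in
/-- The formula `φ` if `p` holds, and otherwise a tautology. -/
noncomputable def guardFormula (p : Prop) (φ : (gammaLang V).Formula α) :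
    (gammaLang V).Formula α := if p then φ else ⊤

@[simp] theorem realize_edgeFormula {a b : α} {x : α → M} :
    (edgeFormula V a b).Realize x ↔ Adj V (x a) (x b) := by
  exact Formula.realize_rel₂

@[simp] theorem realize_colourFormula {γ : V} {a : α} {x : α → M} :
    (colourFormula γ a).Realize x ↔ HasColour γ (x a) := by
  exact Formula.realize_rel₁

@[simp] theorem realize_eqFormula {a b : α} {x : α → M} :
    (eqFormula V a b).Realize x ↔ x a = x b := by
  simp [eqFormula]

@[simp] theorem realize_guardFormula {p : Prop} {φ : (gammaLang V).Formula α} {x : α → M} :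
    (guardFormula V p φ).Realize x ↔ (p → φ.Realize x) := by
  unfold guardFormula
  split_ifs with h <;> simp [h]

variable [Finite V]

/-- The variables `f` form a flag. -/
noncomputable def flagFormula (f : V → α) : (gammaLang V).Formula α :=
  (Formula.iInf fun γ => colourFormula γ (f γ)) ⊓ Formula.iInf fun γ => Formula.iInf fun δ =>
    guardFormula V (Γ.Adj γ δ) (edgeFormula V (f γ) (f δ)) ⊓
      guardFormula V (¬ Γ.Adj γ δ) (edgeFormula V (f γ) (f δ)).not

@[simp] theorem realize_flagFormula {f : V → α} {x : α → M} :
    (flagFormula Γ f).Realize x ↔ IsFlag Γ (fun γ => x (f γ)) := by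
  simp only [flagFormula, Formula.realize_inf, Formula.realize_iInf, realize_colourFormula,
    realize_guardFormula, realize_edgeFormula, Formula.realize_not, IsFlag]
  refine and_congr Iff.rfl (forall_congr' fun γ => forall_congr' fun δ => ?_)
  tauto

/-- The families `f` and `g` agree outside `s`. -/
noncomputable def agreeFormula (f : V → α) (s : Set V) (g : V → α) : (gammaLang V).Formula α :=
  Formula.iInf fun γ => guardFormula V (γ ∉ s) (eqFormula V (f γ) (g γ))

@[simp] theorem realize_agreeFormula {f g : V → α} {s : Set V} {x : α → M} :
    (agreeFormula f s g).Realize x ↔ ∀ γ ∉ s, x (f γ) = x (g γ) := by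
  simp [agreeFormula]

/-- The families `f` and `g` are flags that agree outside `s`. -/
noncomputable def lstepFormula (f : V → α) (s : Set V) (g : V → α) : (gammaLang V).Formula α :=
  flagFormula Γ f ⊓ flagFormula Γ g ⊓ agreeFormula f s g

@[simp] theorem realize_lstepFormula {f g : V → α} {s : Set V} {x : α → M} :
    (lstepFormula Γ f s g).Realize x ↔
      LStep Γ Set.univ (fun γ => x (f γ)) s (fun γ => x (g γ)) := by
  simp [lstepFormula, LStep, IsFlagIn, and_assoc]

/-- There is a lazy path with the sets in `w` between two families of variables. -/
noncomputable def chainFormula : List (Set V) → (gammaLang V).Formula (V ⊕ V)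
  | [] => agreeFormula Sum.inl ∅ Sum.inr
  | s :: w => Formula.iExs V (lstepFormula Γ (fun γ => Sum.inl (Sum.inl γ)) s Sum.inr ⊓
      (chainFormula w).relabel (Sum.elim Sum.inr fun γ => Sum.inl (Sum.inr γ)))

@[simp] theorem realize_chainFormula {w : List (Set V)} {x : V ⊕ V → M} :
    (chainFormula Γ w).Realize x ↔
      Chain (LStep Γ Set.univ) (fun γ => x (Sum.inl γ)) w (fun γ => x (Sum.inr γ)) := by
  induction w generalizing x with
  | nil => simp [chainFormula, funext_iff]
  | cons s w ih =>
    simp only [chainFormula, Formula.realize_iExs, Formula.realize_inf, realize_lstepFormula,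
      Formula.realize_relabel, ih, chain_cons, Function.comp_def, Sum.elim_inl, Sum.elim_inr]

/-- The set of colours at which `f` and `g` differ is properly contained in `s`. -/
noncomputable def ssubsetFormula (f : V → α) (s : Set V) (g : V → α) :
    (gammaLang V).Formula α :=
  agreeFormula f s g ⊓
    (Formula.iInf fun γ => guardFormula V (γ ∈ s) (eqFormula V (f γ) (g γ)).not).not

@[simp] theorem realize_ssubsetFormula {f g : V → α} {s : Set V} {x : α → M} :
    (ssubsetFormula f s g).Realize x ↔ diffSet (fun γ => x (f γ)) (fun γ => x (g γ)) ⊂ s := by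
  simp only [ssubsetFormula, Formula.realize_inf, realize_agreeFormula, Formula.realize_not,
    Formula.realize_iInf, realize_guardFormula, realize_eqFormula, Set.ssubset_def,
    Set.subset_def, diffSet, Set.mem_ofPred_eq]
  refine and_congr (forall_congr' fun γ => ?_) Iff.rfl
  tauto

/-- The families `f` and `g` differ exactly at the colours in `s`. -/
noncomputable def diffFormula (f : V → α) (s : Set V) (g : V → α) : (gammaLang V).Formula α :=
  agreeFormula f s g ⊓ Formula.iInf fun γ => guardFormula V (γ ∈ s) (eqFormula V (f γ) (g γ)).not

@[simp] theorem realize_diffFormula {f g : V → α} {s : Set V} {x : α → M} :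
    (diffFormula f s g).Realize x ↔ diffSet (fun γ => x (f γ)) (fun γ => x (g γ)) = s := by
  simp only [diffFormula, Formula.realize_inf, realize_agreeFormula, Formula.realize_not,
    Formula.realize_iInf, realize_guardFormula, realize_eqFormula, Set.Subset.antisymm_iff,
    Set.subset_def, diffSet, Set.mem_ofPred_eq]
  refine and_congr (forall_congr' fun γ => ?_) Iff.rfl
  tauto

/-- The step from `f` to `g` with letter `s` is not split. -/
noncomputable def unsplitFormula (f : V → α) (s : Set V) (g : V → α) : (gammaLang V).Formula α :=
  (Formula.iExs (V ⊕ V)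
    (flagFormula Γ (fun γ => Sum.inr (Sum.inl γ)) ⊓ (flagFormula Γ (fun γ => Sum.inr (Sum.inr γ)) ⊓
    (ssubsetFormula (fun γ => Sum.inl (f γ)) s (fun γ => Sum.inr (Sum.inl γ)) ⊓
    (ssubsetFormula (fun γ => Sum.inr (Sum.inl γ)) s (fun γ => Sum.inr (Sum.inr γ)) ⊓
    ssubsetFormula (fun γ => Sum.inr (Sum.inr γ)) s (fun γ => Sum.inl (g γ))))))).not

@[simp] theorem realize_unsplitFormula {f g : V → α} {s : Set V} {x : α → M} :
    (unsplitFormula Γ f s g).Realize x ↔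
      IsUnsplit Γ (fun γ => x (f γ)) s (fun γ => x (g γ)) := by
  simp only [unsplitFormula, Formula.realize_not, Formula.realize_iExs, Formula.realize_inf,
    realize_flagFormula, realize_ssubsetFormula, Sum.elim_inl, Sum.elim_inr, IsUnsplit]
  refine not_congr ⟨?_, ?_⟩
  · rintro ⟨y, h⟩
    exact ⟨fun γ => y (Sum.inl γ), fun γ => y (Sum.inr γ), h⟩
  · rintro ⟨H₁, H₂, h⟩
    exact ⟨Sum.elim H₁ H₂, h⟩

end Formulas

/-! ### An axiomatisation of the class -/

section Axioms

variable {V : Type u} (Γ : SimpleGraph V) {M : Type v} [(gammaLang V).Structure M]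
variable {β : Type w} [Finite β]

/-- The universal closure of a formula. -/
noncomputable def forallClosure (φ : (gammaLang V).Formula β) : (gammaLang V).Sentence :=
  Formula.iAlls β (φ.relabel Sum.inr)

@[simp] theorem realize_forallClosure {φ : (gammaLang V).Formula β} :
    M ⊨ forallClosure φ ↔ ∀ x : β → M, φ.Realize x := by
  simp only [forallClosure, Sentence.Realize, Formula.realize_iAlls, Formula.realize_relabel,
    Sum.elim_comp_inr]

variable [Finite V]

variable (V) in
/-- Edges are symmetric. -/
noncomputable def symmAxiom : (gammaLang V).Sentence :=
  forallClosure ((edgeFormula V (0 : Fin 2) 1).imp (edgeFormula V 1 0))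

variable (V) in
/-- There are no loops. -/
noncomputable def irreflAxiom : (gammaLang V).Sentence :=
  forallClosure (edgeFormula V () ()).not

variable (V) in
/-- Every vertex has exactly one colour. -/
noncomputable def uniqueColourAxiom : (gammaLang V).Sentence :=
  forallClosure (Formula.iSup fun γ : V => colourFormula γ () ⊓
    Formula.iInf fun δ => guardFormula V (δ ≠ γ) (colourFormula δ ()).not)

/-- Adjacent vertices have adjacent colours. -/
noncomputable def edgeColourAxiom : (gammaLang V).Sentence :=
  forallClosure (Formula.iInf fun γ : V => Formula.iInf fun δ : V => guardFormula V (¬ Γ.Adj γ δ)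
    (colourFormula γ (0 : Fin 2) ⊓ (colourFormula δ 1 ⊓ edgeFormula V 0 1)).not)

/-- Every vertex lies in a flag. -/
noncomputable def vertexFlagAxiom : (gammaLang V).Sentence :=
  forallClosure (Formula.iExs V (flagFormula Γ (Sum.inr : V → Unit ⊕ V) ⊓
    Formula.iSup fun γ : V => eqFormula V (Sum.inr γ) (Sum.inl ())))

/-- Adjacent vertices lie in a common flag. -/
noncomputable def edgeFlagAxiom : (gammaLang V).Sentence :=
  forallClosure ((edgeFormula V (0 : Fin 2) 1).imp
    (Formula.iExs V (flagFormula Γ (Sum.inr : V → Fin 2 ⊕ V) ⊓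
      ((Formula.iSup fun γ : V => eqFormula V (Sum.inr γ) (Sum.inl 0)) ⊓
        Formula.iSup fun γ : V => eqFormula V (Sum.inr γ) (Sum.inl 1)))))

/-- There is no closed path with the word `s 0, …, s (n - 1)` all of whose steps are unsplit. -/
noncomputable def cycleAxiom (n : ℕ) (s : ℕ → Set V) : (gammaLang V).Sentence :=
  forallClosure ((Formula.iInf fun i : Fin (n + 1) => flagFormula Γ fun γ => (i, γ)) ⊓
    ((Formula.iInf fun i : Fin n => diffFormula (fun γ => (Fin.ofNat (n + 1) i, γ)) (s i)
      (fun γ => (Fin.ofNat (n + 1) (i + 1), γ)) ⊓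
      unsplitFormula Γ (fun γ => (Fin.ofNat (n + 1) i, γ)) (s i)
      (fun γ => (Fin.ofNat (n + 1) (i + 1), γ))) ⊓
    agreeFormula (fun γ => (Fin.ofNat (n + 1) n, γ)) ∅ (fun γ => (Fin.ofNat (n + 1) 0, γ)))).not

open scoped Classical in
/-- Every flag has `k` modifications at the colour `γ`. -/
noncomputable def residueAxiom (γ : V) (k : ℕ) : (gammaLang V).Sentence :=
  forallClosure ((flagFormula Γ (id : V → V)).imp (Formula.iExs (Fin k)
    ((Formula.iInf fun i : Fin k => flagFormula Γ
      fun δ => if δ = γ then Sum.inr i else Sum.inl δ) ⊓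
    Formula.iInf fun i : Fin k => Formula.iInf fun j : Fin k =>
      guardFormula V (i ≠ j) (eqFormula V (Sum.inr i) (Sum.inr j)).not)))

/-- The conditions on a word that are part of `IsUnsplitCycle`. -/
structure IsReducedLetterSequence (n : ℕ) (s : ℕ → Set V) : Prop where
  letter : ∀ i < n, IsLetter Γ (s i)
  reduced_left : ∀ i j, i < j → j < n → s i ⊆ s j →
    ¬ ∀ k, i < k → k < j → LettersCommute Γ (s i) (s k)
  reduced_right : ∀ i j, i < j → j < n → s j ⊆ s i →
    ¬ ∀ k, i < k → k < j → LettersCommute Γ (s j) (s k)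

/-- Axioms for the simply connected `Γ`-spaces with infinite residues. -/
noncomputable def psAxioms : (gammaLang V).Theory :=
  {symmAxiom V, irreflAxiom V, uniqueColourAxiom V, edgeColourAxiom Γ, vertexFlagAxiom Γ,
    edgeFlagAxiom Γ} ∪
  {φ | ∃ n s, 0 < n ∧ IsReducedLetterSequence Γ n s ∧ φ = cycleAxiom Γ n s} ∪
  {φ | ∃ γ k, φ = residueAxiom Γ γ k}

variable {Γ}

theorem realize_gammaSpaceAxioms : M ⊨ ({symmAxiom V, irreflAxiom V, uniqueColourAxiom V,
    edgeColourAxiom Γ, vertexFlagAxiom Γ, edgeFlagAxiom Γ} : (gammaLang V).Theory) ↔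
    IsGammaSpace Γ M := by
  simp only [Theory.model_iff, Set.mem_insert_iff, Set.mem_singleton_iff, forall_eq_or_imp,
    forall_eq, symmAxiom, irreflAxiom, uniqueColourAxiom, edgeColourAxiom, vertexFlagAxiom,
    edgeFlagAxiom, realize_forallClosure, Formula.realize_imp, realize_edgeFormula,
    Formula.realize_not, Formula.realize_iSup, Formula.realize_iInf, Formula.realize_inf,
    Formula.realize_iExs, realize_guardFormula, realize_colourFormula, realize_flagFormula,
    realize_eqFormula, Sum.elim_inl, Sum.elim_inr]
  constructor
  · rintro ⟨h1, h2, h3, h4, h5, h6⟩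
    refine ⟨⟨fun a b => h1 ![a, b], fun a => h2 fun _ => a, fun a => ?_,
        fun a b γ δ ha hb hab => ?_⟩,
      fun a => ?_, fun a b hab => ?_⟩
    · obtain ⟨γ, hγ, h⟩ := h3 fun _ => a
      exact ⟨γ, hγ, fun δ hδ => by_contra fun hne => h δ hne hδ⟩
    · by_contra hn
      exact h4 ![a, b] γ δ hn ⟨ha, hb, hab⟩
    · obtain ⟨F, hF, h⟩ := h5 fun _ => a
      exact ⟨F, hF, h⟩
    · obtain ⟨F, hF, h⟩ := h6 ![a, b] hab
      exact ⟨F, hF, h⟩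
  · intro h
    refine ⟨fun x => h.symm _ _, fun x => h.irrefl _, fun x => ?_, fun x γ δ hn hx => ?_,
      fun x => ?_, fun x hx => ?_⟩
    · obtain ⟨γ, hγ, h'⟩ := h.colour (x ())
      exact ⟨γ, hγ, fun δ hne hδ => hne (h' δ hδ)⟩
    · exact hn (h.edge_colour _ _ _ _ hx.1 hx.2.1 hx.2.2)
    · obtain ⟨F, hF, h'⟩ := h.vertex_flag (x ())
      exact ⟨F, hF, h'⟩
    · obtain ⟨F, hF, h'⟩ := h.edge_flag _ _ hx
      exact ⟨F, hF, h'⟩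

theorem realize_cycleAxiom {n : ℕ} {s : ℕ → Set V} (hs : IsReducedLetterSequence Γ n s) :
    M ⊨ cycleAxiom Γ n s ↔ ∀ F : ℕ → V → M, ¬ IsUnsplitCycle Γ n s F := by
  simp only [cycleAxiom, realize_forallClosure, Formula.realize_not, Formula.realize_inf,
    Formula.realize_iInf, realize_flagFormula, realize_diffFormula, realize_unsplitFormula,
    realize_agreeFormula]
  -- All indices used in the axiom are at most `n`, so the reduction modulo `n + 1` has no effect.
  have hval : ∀ i ≤ n, (Fin.ofNat (n + 1) i).val = i := fun i hi => by
    simp [Nat.mod_eq_of_lt (Nat.lt_succ_of_le hi)]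
  constructor
  · intro h F hF
    refine h (fun p => F p.1 p.2) ⟨fun i => hF.flag i (Nat.le_of_lt_succ i.2), fun i => ?_,
      fun γ _ => ?_⟩
    · simp only [hval i i.2.le, hval (i + 1) i.2]
      exact ⟨hF.diff i i.2, hF.unsplit i i.2⟩
    · simp only [hval n le_rfl, hval 0 n.zero_le]
      exact congrFun hF.closed γ
  · rintro h x ⟨h1, h2, h3⟩
    exact h (fun i γ => x (Fin.ofNat (n + 1) i, γ)) ⟨fun i _ => h1 _, hs.letter,
      fun i hi => (h2 ⟨i, hi⟩).1, fun i hi => (h2 ⟨i, hi⟩).2,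
      funext fun γ => h3 γ (Set.notMem_empty γ), hs.reduced_left, hs.reduced_right⟩

theorem realize_residueAxiom :
    (∀ γ k, M ⊨ residueAxiom Γ γ k) ↔ HasInfiniteResidues Γ M := by
  classical
  refine forall_congr' fun γ => ?_
  simp only [residueAxiom, realize_forallClosure, Formula.realize_imp, Formula.realize_iExs,
    Formula.realize_inf, Formula.realize_iInf, realize_flagFormula, realize_guardFormula,
    Formula.realize_not, realize_eqFormula, Sum.elim_inr, id]
  have hu : ∀ {k : ℕ} (F : V → M) (y : Fin k → M) (i : Fin k),
      (fun δ => Sum.elim F y (if δ = γ then Sum.inr i else Sum.inl δ)) =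
        Function.update F γ (y i) := fun F y i => funext fun δ => by
    by_cases h : δ = γ
    · subst h; simp
    · simp [h]
  simp only [hu]
  rw [forall_comm]
  refine forall_congr' fun F => ?_
  rw [forall_comm]
  refine forall_congr' fun hF => ?_
  -- A modification at `γ` is determined by its vertex of colour `γ`, so flags can be counted by
  -- single elements of `M`.
  have hS : {G : V → M | IsFlag Γ G ∧ ∀ δ, δ ≠ γ → G δ = F δ} =
      Function.update F γ '' {b | IsFlag Γ (Function.update F γ b)} := by
    ext G
    constructor
    · rintro ⟨hG, h⟩
      have : Function.update F γ (G γ) = G := by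
        funext δ
        by_cases hδ : δ = γ
        · subst hδ; simp
        · simp [hδ, h δ hδ]
      exact ⟨G γ, by rwa [Set.mem_ofPred_eq, this], this⟩
    · rintro ⟨b, hb, rfl⟩
      exact ⟨hb, fun δ hδ => Function.update_of_ne hδ _ _⟩
  rw [hS, Set.infinite_image_iff (Function.update_injective F γ).injOn]
  constructor
  · intro h hfin
    obtain ⟨y, hy, hne⟩ := h (hfin.toFinset.card + 1)
    have hinj : Function.Injective y := fun i j hij => by
      by_contra hn
      exact hne i j hn hij
    have := Finset.card_le_card_of_injOn (s := Finset.univ) (t := hfin.toFinset) y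
      (fun i _ => by simpa using hy i) hinj.injOn
    simp at this
  · intro h k
    obtain ⟨t, ht, hk⟩ := h.exists_subset_card_eq k
    refine ⟨fun i => (t.equivFin.symm (Fin.cast hk.symm i)).1, fun i => ht (Subtype.prop _),
      fun i j hne he => hne ?_⟩
    have := Fin.cast_injective _ (t.equivFin.symm.injective (Subtype.ext he))
    exact this

omit [Finite V] in
theorem TStep.isUnsplit {F G : V → M} {s : Set V} (h : TStep Γ Set.univ F s G) :
    IsUnsplit Γ F s G := by
  rintro ⟨H₁, H₂, h1, h2, d1, d2, d3⟩
  have u1 : IsFlagIn Γ Set.univ H₁ := ⟨h1, fun _ => trivial⟩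
  have u2 : IsFlagIn Γ Set.univ H₂ := ⟨h2, fun _ => trivial⟩
  refine h.2 [diffSet F H₁, diffSet H₁ H₂, diffSet H₂ G] (by simp [d1, d2, d3])
    ⟨H₁, lstep_of_diffSet h.1.1 u1, H₂, lstep_of_diffSet u1 u2, G, lstep_of_diffSet u2 h.1.2.1,
      rfl⟩

omit [Finite V] in
theorem IsFlagPath.exists_sequence {D : Set M} {F G : V → M} {w : List (Set V)}
    (h : IsFlagPath Γ D F w G) : ∃ H : ℕ → V → M, H 0 = F ∧ H w.length = G ∧
      (∀ i ≤ w.length, IsFlagIn Γ D (H i)) ∧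
      ∀ i < w.length, IsFlagStep Γ D (H i) (w.getD i ∅) (H (i + 1)) := by
  induction h with
  | @nil F hF => exact ⟨fun _ => F, rfl, rfl, fun _ _ => hF, by simp⟩
  | @cons F K G s w hs hw ih =>
    obtain ⟨H, h0, hl, hf, hst⟩ := ih
    refine ⟨fun i => Nat.casesOn i F H, rfl, hl, fun i hi => ?_, fun i hi => ?_⟩
    · cases i with
      | zero => exact hs.1
      | succ i => exact hf i (by simpa using hi)
    · cases i with
      | zero => simpa [h0] using hs
      | succ i => simpa using hst i (by simpa using hi)

/-- True steps are in particular unsplit, so a non-trivial closed reduced flag path is itself an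
unsplit cycle. -/
theorem isSimplyConnected_of_forall_not_isUnsplitCycle (hM : IsGammaGraph Γ M)
    (h : ∀ n s, 0 < n → IsReducedLetterSequence Γ n s → ∀ F : ℕ → V → M,
      ¬ IsUnsplitCycle Γ n s F) : IsSimplyConnected Γ M := by
  intro F w hw hr
  by_contra hne
  obtain ⟨H, h0, hl, hf, hst⟩ := hw.exists_sequence
  have hseq : IsReducedLetterSequence Γ w.length (fun i => w.getD i ∅) := by
    refine ⟨fun i hi => (hst i hi).2.2.1, fun i j hij hj hsub hcom => ?_,
      fun i j hij hj hsub hcom => ?_⟩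
    · refine hr ⟨⟨i, hij.trans hj⟩, ⟨j, hj⟩, by simpa using hij.ne, ?_, fun k hk => ?_⟩
      · simpa [hj, hij.trans hj] using hsub
      · rcases hk with hk | hk
        · have := hcom k hk.1 hk.2
          simpa [hij.trans hj] using this
        · exact absurd (hk.1.trans hk.2) (by simpa using hij.le)
    · refine hr ⟨⟨j, hj⟩, ⟨i, hij.trans hj⟩, by simpa using hij.ne', ?_, fun k hk => ?_⟩
      · simpa [hj, hij.trans hj] using hsub
      · rcases hk with hk | hk
        · exact absurd (hk.1.trans hk.2) (by simpa using hij.le)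
        · have := hcom k hk.1 hk.2
          simpa [hj] using this
  exact h _ _ (List.length_pos_iff.2 hne) hseq H ⟨fun i hi => (hf i hi).1, hseq.letter,
    fun i hi => (hst i hi).2.2.2.1, fun i hi => (hM.isFlagStep_iff.1 (hst i hi)).isUnsplit,
    hl.trans h0.symm, hseq.reduced_left, hseq.reduced_right⟩

theorem realize_psAxioms : M ⊨ psAxioms Γ ↔ IsPSSpace Γ M := by
  have hsplit : M ⊨ psAxioms Γ ↔ IsGammaSpace Γ M ∧
      (∀ n s, 0 < n → IsReducedLetterSequence Γ n s → M ⊨ cycleAxiom Γ n s) ∧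
      HasInfiniteResidues Γ M := by
    rw [← realize_gammaSpaceAxioms, ← realize_residueAxiom]
    simp only [Theory.model_iff, psAxioms]
    constructor
    · intro h
      exact ⟨fun φ hφ => h φ (Or.inl (Or.inl hφ)), fun n s hn hs =>
        h _ (Or.inl (Or.inr ⟨n, s, hn, hs, rfl⟩)), fun γ k => h _ (Or.inr ⟨γ, k, rfl⟩)⟩
    · rintro ⟨h1, h2, h3⟩ φ ((hφ | ⟨n, s, hn, hs, rfl⟩) | ⟨γ, k, rfl⟩)
      · exact h1 φ hφ
      · exact h2 n s hn hs
      · exact h3 γ k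
  rw [hsplit]
  constructor
  · rintro ⟨h1, h2, h3⟩
    exact ⟨h1, isSimplyConnected_of_forall_not_isUnsplitCycle h1.toIsGammaGraph
      fun n s hn hs => (realize_cycleAxiom hs).1 (h2 n s hn hs), h3⟩
  · intro h
    exact ⟨h.toIsGammaSpace, fun n s hn hs => (realize_cycleAxiom hs).2 fun F =>
      not_isUnsplitCycle h.toIsGammaGraph
        (h.toIsGammaGraph.isSimplyConnected_iff.1 h.simply_connected) hn, h.infinite_residues⟩

theorem psAxioms_subset : psAxioms Γ ⊆ PS Γ := fun φ hφ _ _ _ hM =>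
  (Theory.model_iff _).1 (realize_psAxioms.2 hM) φ hφ

end Axioms

/-! ### Independence of the universe -/

section Transfer

variable {V : Type u} {Γ : SimpleGraph V} {M : Type v} [(gammaLang V).Structure M]

instance [Countable V] (n : ℕ) : Countable (GammaRel V n) := by
  have : Function.Injective (fun r : GammaRel V n => match n, r with
    | _, .edge => (none : Option V)
    | _, .colour γ => some γ) := by
    intro r r' h
    cases r <;> cases r' <;> simp_all
  exact this.countable

theorem card_gammaLang_le [Countable V] : (gammaLang V).card ≤ Cardinal.aleph0 := by
  have h1 : Countable (Σ n, (gammaLang V).Functions n) :=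
    inferInstanceAs (Countable (Σ _ : ℕ, Empty))
  have h2 : Countable (Σ n, (gammaLang V).Relations n) :=
    inferInstanceAs (Countable (Σ n : ℕ, GammaRel V n))
  exact Cardinal.mk_le_aleph0_iff.2 inferInstance

theorem HasInfiniteResidues.infinite [Nonempty V] [Nonempty M] (hM : IsPSSpace Γ M) :
    Infinite M := by
  classical
  obtain ⟨F, hF, -⟩ := hM.vertex_flag (Classical.arbitrary M)
  by_contra hfin
  rw [not_infinite_iff_finite] at hfin
  have γ := Classical.arbitrary V
  refine hM.infinite_residues γ F hF (Set.Finite.subset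
    ((Set.toFinite (Set.univ : Set M)).image fun b => Function.update F γ b) ?_)
  rintro G ⟨-, hG⟩
  refine ⟨G γ, trivial, funext fun δ => ?_⟩
  by_cases h : δ = γ
  · subst h; simp
  · simp [h, hG δ h]

/-- The explicit axioms belong to `PS Γ`, which gives one direction. For the other, `PS Γ` only
tests structures in `Type`; a space in any universe has a countably infinite elementary
substructure, which is copied onto `ℕ`. -/
theorem model_PS_iff [Finite V] [Nonempty V] [Nonempty M] : M ⊨ PS Γ ↔ IsPSSpace Γ M := by
  refine ⟨fun h => realize_psAxioms.1 (h.mono psAxioms_subset), fun hM =>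
    (Theory.model_iff _).2 fun φ hφ => ?_⟩
  have hinf := HasInfiniteResidues.infinite hM
  obtain ⟨S, -, hS⟩ := exists_elementarySubstructure_card_eq (gammaLang V) (M := M) ∅
    Cardinal.aleph0.{v} le_rfl (by simp) (by simpa using card_gammaLang_le)
    (by simp)
  have e : Nonempty (S ≃ ℕ) := by
    have : Cardinal.mk S = Cardinal.aleph0 := by simpa using hS
    obtain ⟨_⟩ := Cardinal.denumerable_iff.2 this
    exact ⟨Denumerable.eqv S⟩
  obtain ⟨e⟩ := e
  let _ : (gammaLang V).Structure ℕ := e.inducedStructure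
  let f : S ≃[gammaLang V] ℕ := e.inducedStructureEquiv
  let g : ℕ ↪ₑ[gammaLang V] M := S.subtype.comp f.symm.toElementaryEmbedding
  rw [← g.map_sentence]
  exact hφ ℕ (realize_psAxioms.1 ((g.theory_model_iff _).2 (realize_psAxioms.2 hM)))

end Transfer

/-! ### Realising types in several variables; saturated ultrapowers -/

section Saturation

variable {L : FirstOrder.Language.{0, u}} {M : Type v} [L.Structure M]

variable (L M) in
/-- Finitely satisfiable sets of formulas with parameters indexed by `α` and variables indexed by
`β` are realised in `M`. -/
def RealizesTypes (α β : Type*) : Prop :=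
  ∀ (a : α → M) (p : Set (L.Formula (α ⊕ β))),
    (∀ q : Finset (L.Formula (α ⊕ β)), (q : Set _) ⊆ p →
      ∃ b : β → M, ∀ φ ∈ q, φ.Realize (Sum.elim a b)) →
    ∃ b : β → M, ∀ φ ∈ p, φ.Realize (Sum.elim a b)

theorem RealizesTypes.comp {α β γ : Type*} (h : RealizesTypes L M α β) (g : γ → α ⊕ β)
    (a : α → M) (p : Set (L.Formula γ))
    (hp : ∀ q : Finset (L.Formula γ), (q : Set _) ⊆ p →
      ∃ b : β → M, ∀ φ ∈ q, φ.Realize (Sum.elim a b ∘ g)) :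
    ∃ b : β → M, ∀ φ ∈ p, φ.Realize (Sum.elim a b ∘ g) := by
  classical
  obtain ⟨b, hb⟩ := h a ((fun φ => φ.relabel g) '' p) (fun q hq => by
    obtain ⟨q', hq', rfl⟩ := Finset.subset_set_image_iff.1 hq
    obtain ⟨b, hb⟩ := hp q' hq'
    refine ⟨b, fun φ hφ => ?_⟩
    obtain ⟨ψ, hψ, rfl⟩ := Finset.mem_image.1 hφ
    exact Formula.realize_relabel.2 (hb ψ hψ))
  exact ⟨b, fun φ hφ => Formula.realize_relabel.1 (hb _ ⟨φ, hφ, rfl⟩)⟩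

theorem RealizesTypes.congr {α β α' β' : Type*} (h : RealizesTypes L M α β) (e : α ≃ α')
    (f : β ≃ β') : RealizesTypes L M α' β' := by
  intro a p hp
  have key : ∀ b : β → M, Sum.elim (a ∘ e) b ∘ Sum.map e.symm f.symm =
      Sum.elim a (b ∘ f.symm) := fun b => by
    funext x; cases x <;> simp
  obtain ⟨b, hb⟩ := h.comp (Sum.map e.symm f.symm) (a ∘ e) p (fun q hq => by
    obtain ⟨b, hb⟩ := hp q hq
    refine ⟨b ∘ f, fun φ hφ => ?_⟩
    rw [key]
    simpa [Function.comp_assoc] using hb φ hφ)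
  exact ⟨b ∘ f.symm, fun φ hφ => by simpa [key] using hb φ hφ⟩

theorem IsOmegaSaturated.realizesTypes_unit (hM : IsOmegaSaturated L M) (α : Type w) [Finite α] :
    RealizesTypes L M α Unit := by
  obtain ⟨n, ⟨e⟩⟩ := Finite.exists_equiv_fin α
  refine RealizesTypes.congr (α := Fin n) ?_ e.symm (Equiv.refl Unit)
  intro a p hp
  obtain ⟨b, hb⟩ := hM n a p fun q hq => by
    obtain ⟨b, hb⟩ := hp q hq
    exact ⟨b (), hb⟩
  exact ⟨fun _ => b, hb⟩

/-- In an `ω`-saturated structure, types in finitely many variables are realised. -/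
theorem IsOmegaSaturated.realizesTypes (hM : IsOmegaSaturated L M) (β : Type w) [Finite β] :
    ∀ (α : Type w) [Finite α], RealizesTypes L M α β := by
  classical
  refine Finite.induction_empty_option
    (P := fun β : Type w => ∀ (α : Type w) [Finite α], RealizesTypes L M α β) ?_ ?_ ?_ β
  · intro β β' e h α _
    exact (h α).congr (Equiv.refl α) e
  · intro α _ a p hp
    refine ⟨PEmpty.elim, fun φ hφ => ?_⟩
    obtain ⟨b, hb⟩ := hp {φ} (by simpa using hφ)
    obtain rfl : b = PEmpty.elim := funext fun x => x.elim
    exact hb φ (by simp)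
  · intro β _ ih α _ a p hp
    let g : α ⊕ Option β → (α ⊕ Unit) ⊕ β := Sum.elim (fun x => Sum.inl (Sum.inl x))
      fun y => y.elim (Sum.inl (Sum.inr ())) Sum.inr
    -- The variable `none` is realised first, by the existential projections of all finite parts of
    -- `p`; the realisation then serves as a further parameter for the other variables.
    let ex : Finset (L.Formula (α ⊕ Option β)) → L.Formula (α ⊕ Unit) := fun q =>
      Formula.iExs β (Formula.iInf fun φ : q => φ.1.relabel g)
    have hex : ∀ q (y : Unit → M), (ex q).Realize (Sum.elim a y) ↔
        ∃ b : β → M, ∀ φ ∈ q, φ.Realize (Sum.elim a fun z => z.elim (y ()) b) := by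
      intro q y
      simp only [ex, Formula.realize_iExs, Formula.realize_iInf, Formula.realize_relabel,
        Subtype.forall]
      refine exists_congr fun b => forall₂_congr fun φ _ => ?_
      rw [iff_eq_eq]
      congr 1
      funext z
      rcases z with z | _ | z <;> rfl
    obtain ⟨y, hy⟩ := hM.realizesTypes_unit α a (ex '' {q | (q : Set _) ⊆ p}) (fun r hr => by
      obtain ⟨r', hr', rfl⟩ := Finset.subset_set_image_iff.1 hr
      obtain ⟨b, hb⟩ := hp (r'.biUnion id) (fun φ hφ => by
        obtain ⟨q, hq, hφ⟩ := Finset.mem_biUnion.1 (Finset.mem_coe.1 hφ)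
        exact hr' hq hφ)
      refine ⟨fun _ => b none, fun φ hφ => ?_⟩
      obtain ⟨q, hq, rfl⟩ := Finset.mem_image.1 hφ
      refine (hex _ _).2 ⟨fun z => b (some z), fun φ hφ => ?_⟩
      convert! hb φ (Finset.mem_biUnion.2 ⟨q, hq, hφ⟩) using 2
      funext z
      cases z <;> rfl)
    let g' : α ⊕ Option β → (Option α) ⊕ β := Sum.elim (fun x => Sum.inl (some x))
      fun y => y.elim (Sum.inl none) Sum.inr
    have hg' : ∀ b : β → M, Sum.elim (fun x : Option α => x.elim (y ()) a) b ∘ g' =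
        Sum.elim a fun z => z.elim (y ()) b := fun b => by
      funext z
      rcases z with z | _ | z <;> rfl
    obtain ⟨b, hb⟩ := (ih (Option α)).comp g' (fun x => x.elim (y ()) a) p (fun q hq => by
      obtain ⟨b, hb⟩ := (hex _ _).1 (hy _ ⟨q, hq, rfl⟩)
      exact ⟨b, fun φ hφ => by rw [hg']; exact hb φ hφ⟩)
    exact ⟨_, fun φ hφ => by rw [← hg']; exact hb φ hφ⟩

variable (M) in
/-- An ultrapower of `M` with respect to a non-principal ultrafilter on the natural numbers. -/
abbrev UltraPower : Type v := ((Filter.hyperfilter ℕ : Ultrafilter ℕ) : Filter ℕ).Product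
  fun _ : ℕ => M

variable [Nonempty M]

variable (L M) in
/-- The diagonal embedding. -/
noncomputable def diagonal : M ↪ₑ[L] UltraPower M where
  toFun m := ((fun _ => m : ℕ → M) : UltraPower M)
  map_formula' n φ x := by
    have := Ultraproduct.realize_formula_cast (u := Filter.hyperfilter ℕ) φ
      (fun i (_ : ℕ) => x i)
    rw [Filter.eventually_const] at this
    exact this

/-- The type is enumerated, and each coordinate of the ultrapower realises as long an initial
segment as it can. Any fixed formula is then satisfied at almost all coordinates. -/
theorem isOmegaSaturated_ultraPower (hL : ∀ n, Countable (L.Formula (Fin n ⊕ Unit))) :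
    IsOmegaSaturated L (UltraPower M) := by
  classical
  intro n a p hp
  have := hL n
  rcases p.eq_empty_or_nonempty with rfl | hne
  · obtain ⟨b, -⟩ := hp ∅ (by simp)
    exact ⟨b, by simp⟩
  have : Nonempty p := hne.to_subtype
  obtain ⟨e, he⟩ := exists_surjective_nat p
  have hlift : ∀ y : UltraPower M, ∃ z : ℕ → M, (z : UltraPower M) = y := Quotient.exists_rep
  choose a' ha' using fun i => hlift (a i)
  obtain rfl : (fun i => (a' i : UltraPower M)) = a := funext ha'
  have hcast : ∀ (b : ℕ → M) (φ : L.Formula (Fin n ⊕ Unit)),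
      φ.Realize (Sum.elim (fun i => (a' i : UltraPower M)) fun _ => (b : UltraPower M)) ↔
        ∀ᶠ t in Filter.hyperfilter ℕ, φ.Realize (Sum.elim (fun i => a' i t) fun _ => b t) := by
    intro b φ
    have := Ultraproduct.realize_formula_cast (u := Filter.hyperfilter ℕ) φ
      (Sum.elim a' fun _ => b)
    convert! this using 2
    · funext z
      cases z <;> rfl
    · funext t
      congr 1
      funext z
      cases z <;> rfl
  let P : ℕ → ℕ → Prop := fun t k => ∃ m : M, ∀ i < k,
    (e i).1.Realize (Sum.elim (fun i => a' i t) fun _ => m)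
  have hP : ∀ k, ∀ᶠ t in Filter.hyperfilter ℕ, P t k := by
    intro k
    obtain ⟨b, hb⟩ := hp ((Finset.range k).image fun i => (e i).1) (fun φ hφ => by
      obtain ⟨i, -, rfl⟩ := Finset.mem_image.1 (Finset.mem_coe.1 hφ)
      exact (e i).2)
    obtain ⟨b, rfl⟩ := hlift b
    have : ∀ᶠ t in Filter.hyperfilter ℕ, ∀ i ∈ Finset.range k,
        (e i).1.Realize (Sum.elim (fun i => a' i t) fun _ => b t) :=
      (Filter.eventually_all_finset _).2 fun i hi =>
        (hcast b _).1 (hb _ (Finset.mem_image_of_mem _ hi))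
    exact this.mono fun t ht => ⟨b t, fun i hi => ht i (Finset.mem_range.2 hi)⟩
  -- The search is capped at `t` because a coordinate may satisfy arbitrarily long segments. The cap
  -- is harmless: non-principality makes it exceed any fixed bound almost everywhere.
  have hw : ∀ t, P t (Nat.findGreatest (P t) t) := fun t =>
    Nat.findGreatest_spec (P := P t) (Nat.zero_le t)
      ⟨Classical.arbitrary M, fun i hi => absurd hi (Nat.not_lt_zero i)⟩
  choose b hb using hw
  refine ⟨(b : UltraPower M), fun φ hφ => (hcast b φ).2 ?_⟩
  obtain ⟨i, hi⟩ := he ⟨φ, hφ⟩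
  have hge : ∀ᶠ t in Filter.hyperfilter ℕ, i + 1 ≤ t := by
    have : ∀ᶠ t : ℕ in Filter.cofinite, i + 1 ≤ t := by
      rw [Nat.cofinite_eq_atTop]; exact Filter.eventually_ge_atTop _
    exact Filter.hyperfilter_le_cofinite this
  filter_upwards [hge, hP (i + 1)] with t ht ht'
  have := hb t i (Nat.lt_of_succ_le (Nat.le_findGreatest ht ht'))
  rwa [hi] at this

end Saturation

theorem countable_formula {V : Type u} [Countable V] (α : Type) [Countable α] :
    Countable ((gammaLang V).Formula α) := by
  have h := BoundedFormula.card_le (L := gammaLang V) (α := α)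
  have h2 : Cardinal.mk (Σ n, (gammaLang V).BoundedFormula α n) ≤ Cardinal.aleph0 := by
    refine h.trans (max_le le_rfl (Cardinal.add_le_aleph0.2 ⟨?_, ?_⟩))
    · simp
    · simpa using card_gammaLang_le
  have : Countable (Σ n, (gammaLang V).BoundedFormula α n) := Cardinal.mk_le_aleph0_iff.1 h2
  exact (sigma_mk_injective (β := fun n => (gammaLang V).BoundedFormula α n) (i := 0)).countable

/-! ### Nice sets under elementary embeddings -/

section Image

variable {V : Type u} {Γ : SimpleGraph V} {M : Type v} {N : Type w} [(gammaLang V).Structure M]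
  [(gammaLang V).Structure N]

theorem map_adj (e : M ↪ₑ[gammaLang V] N) (a b : M) : Adj V (e a) (e b) ↔ Adj V a b := by
  have := e.map_formula (edgeFormula V (0 : Fin 2) 1) ![a, b]
  rwa [realize_edgeFormula, realize_edgeFormula] at this

theorem map_hasColour (e : M ↪ₑ[gammaLang V] N) (γ : V) (a : M) :
    HasColour γ (e a) ↔ HasColour γ a := by
  have := e.map_formula (colourFormula γ ()) fun _ => a
  rwa [realize_colourFormula, realize_colourFormula] at this

theorem map_isFlag (e : M ↪ₑ[gammaLang V] N) {F : V → M} :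
    IsFlag Γ (e ∘ F) ↔ IsFlag Γ F := by
  simp [IsFlag, map_adj, map_hasColour]

theorem map_lazyChain [Finite V] (e : M ↪ₑ[gammaLang V] N) {F G : V → M} {x : List (Set V)} :
    Chain (LStep Γ Set.univ) (e ∘ F) x (e ∘ G) ↔ Chain (LStep Γ Set.univ) F x G := by
  have := e.map_formula (chainFormula Γ x) (Sum.elim F G)
  simpa [Function.comp_def] using this

/-- The absence of a lazy path with one fixed word is first-order, so it is preserved word by word,
although truth of a step refers to infinitely many words. -/
theorem IsNice.image [Finite V] (hM : IsGammaGraph Γ M) (hN : IsGammaGraph Γ N) {A : Set M}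
    (hA : IsNice Γ A) (e : M ↪ₑ[gammaLang V] N) : IsNice Γ (e '' A) := by
  have hflag : ∀ {F : V → N}, IsFlagIn Γ (e '' A) F → ∃ F', IsFlagIn Γ A F' ∧ F = e ∘ F' := by
    intro F hF
    choose F' hF' he using hF.2
    obtain rfl : e ∘ F' = F := funext he
    exact ⟨F', ⟨(map_isFlag e).1 hF.1, hF'⟩, rfl⟩
  have hup : ∀ {F : V → M}, IsFlagIn Γ A F → IsFlagIn Γ (e '' A) (e ∘ F) := fun hF =>
    ⟨(map_isFlag e).2 hF.1, fun γ => ⟨_, hF.2 γ, rfl⟩⟩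
  have hchain : ∀ (x : List (Set V)) {F G : V → M}, Chain (LStep Γ A) F x G →
      Chain (LStep Γ (e '' A)) (e ∘ F) x (e ∘ G) := by
    intro x
    induction x with
    | nil => intro F G h; exact congrArg (e ∘ ·) h
    | cons s x ih =>
      rintro F G ⟨K, h1, h2⟩
      exact ⟨e ∘ K, ⟨hup h1.1, hup h1.2.1, fun γ hγ => congrArg e (h1.2.2 γ hγ)⟩, ih h2⟩
  refine ⟨hA.nonempty.image e, ?_, fun F G s h => ?_⟩
  · rintro _ ⟨a, ha, rfl⟩
    obtain ⟨F, hF, γ, rfl⟩ := hA.vertex_flag a ha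
    exact ⟨e ∘ F, hup hF, γ, rfl⟩
  · rw [hN.isFlagStep_iff] at h ⊢
    obtain ⟨F, hF, rfl⟩ := hflag h.1.1
    obtain ⟨G, hG, rfl⟩ := hflag h.1.2.1
    have h' : TStep Γ A F s G := ⟨⟨hF, hG, fun γ hγ => e.injective (h.1.2.2 γ hγ)⟩,
      fun y hy hc => h.2 y hy (hchain y hc)⟩
    exact ⟨h.1.mono (Set.subset_univ _), fun y hy hc =>
      (hA.tstep hM h').2 y hy ((map_lazyChain e).1 hc)⟩

end Image

/-! ### Back-and-forth with indexed families -/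

section BackAndForth

variable {V : Type u} {Γ : SimpleGraph V} {M : Type v} {N : Type w} [(gammaLang V).Structure M]
  [(gammaLang V).Structure N] {κ : Type u} {a : κ → M} {b : κ → N}

variable (V) in
/-- The map `a i ↦ b i` is an isomorphism between the ranges of the families `a` and `b`. -/
structure SameType (a : κ → M) (b : κ → N) : Prop where
  eq_iff : ∀ i j, a i = a j ↔ b i = b j
  adj_iff : ∀ i j, Adj V (a i) (a j) ↔ Adj V (b i) (b j)
  colour_iff : ∀ (γ : V) i, HasColour γ (a i) ↔ HasColour γ (b i)

theorem SameType.symm (h : SameType V a b) : SameType V b a :=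
  ⟨fun i j => (h.eq_iff i j).symm, fun i j => (h.adj_iff i j).symm,
    fun γ i => (h.colour_iff γ i).symm⟩

theorem SameType.isFlag_iff (h : SameType V a b) (i : V → κ) :
    IsFlag Γ (a ∘ i) ↔ IsFlag Γ (b ∘ i) := by
  simp [IsFlag, h.adj_iff, h.colour_iff]

theorem SameType.of_isFlag (hM : IsGammaGraph Γ M) (hN : IsGammaGraph Γ N) {F : V → M}
    {G : V → N} (hF : IsFlag Γ F) (hG : IsFlag Γ G) : SameType V F G where
  eq_iff γ δ := by
    constructor
    · intro h
      rw [hM.colour_unique (hF.1 γ) (h ▸ hF.1 δ)]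
    · intro h
      rw [hN.colour_unique (hG.1 γ) (h ▸ hG.1 δ)]
  adj_iff γ δ := by rw [hF.2, hG.2]
  colour_iff γ δ := by
    constructor
    · intro h
      rw [hM.colour_unique h (hF.1 δ)]; exact hG.1 δ
    · intro h
      rw [hN.colour_unique h (hG.1 δ)]; exact hF.1 δ

theorem isFlagIn_range {i : V → κ} (h : IsFlag Γ (a ∘ i)) : IsFlagIn Γ (Set.range a) (a ∘ i) :=
  ⟨h, fun γ => ⟨i γ, rfl⟩⟩

theorem IsFlagIn.exists_index {F : V → M} (h : IsFlagIn Γ (Set.range a) F) :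
    ∃ i : V → κ, F = a ∘ i := by
  choose i hi using h.2
  exact ⟨i, (funext hi).symm⟩

variable [Finite V]

/-- The range contains no flag other than `F`, so the condition on steps is vacuous. -/
theorem isNice_range_flag (hM : IsGammaGraph Γ M) [Nonempty V] {F : V → M} (hF : IsFlag Γ F) :
    IsNice Γ (Set.range F) := by
  have huniq : ∀ H : V → M, IsFlagIn Γ (Set.range F) H → H = F := by
    intro H hH
    funext γ
    obtain ⟨δ, hδ⟩ := hH.2 γ
    rw [← hδ, hM.colour_unique (hH.1.1 γ) (hδ ▸ hF.1 δ)]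
  refine ⟨Set.range_nonempty F, ?_, fun G H s h => ?_⟩
  · rintro _ ⟨γ, rfl⟩
    exact ⟨F, ⟨hF, fun γ => ⟨γ, rfl⟩⟩, γ, rfl⟩
  · rw [hM.isFlagStep_iff] at h
    obtain ⟨γ, hγ⟩ := h.nonempty
    rw [← h.diffSet_eq, huniq G h.1.1, huniq H h.1.2.1] at hγ
    exact absurd rfl hγ

/-- A generic extension by a given letter exists in an `ω`-saturated space. -/
theorem exists_isGenericOver (hN : IsPSSpace Γ N) (hsat : IsOmegaSaturated (gammaLang V) N)
    [Finite κ] {i : V → κ} (hF : IsFlag Γ (b ∘ i)) {s : Set V} (hs : IsLetter Γ s) :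
    ∃ G, IsGenericOver Γ (Set.range b) (b ∘ i) s G := by
  classical
  have hN' := hN.toIsGammaGraph
  have hsc := hN'.isSimplyConnected_iff.1 hN.simply_connected
  let p : Set ((gammaLang V).Formula (κ ⊕ V)) := {lstepFormula Γ (Sum.inl ∘ i) s Sum.inr} ∪
    {φ | ∃ (j : V → κ) (x : List (Set V)), (∀ t ∈ x, t ⊂ s) ∧
      φ = ((chainFormula Γ x).relabel (Sum.elim (Sum.inl ∘ j) Sum.inr)).not}
  -- Each formula of the type excludes paths of one length only, so a sufficiently far flag
  -- satisfies any finite part.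
  have hp : ∀ φ ∈ p, ∃ K : ℕ, ∀ G : V → N, LStep Γ Set.univ (b ∘ i) s G →
      (∀ F' ∈ Set.range (fun j : V → κ => b ∘ j), ∀ x : List (Set V), x.length ≤ K →
        (∀ t ∈ x, t ⊂ s) → ¬ Chain (LStep Γ Set.univ) F' x G) → φ.Realize (Sum.elim b G) := by
    rintro φ (rfl | ⟨j, x, hx, rfl⟩)
    · exact ⟨0, fun G hG _ => (realize_lstepFormula Γ).2 (by simpa [Function.comp_def] using hG)⟩
    · refine ⟨x.length, fun G _ h => ?_⟩
      rw [Formula.realize_not, Formula.realize_relabel, realize_chainFormula]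
      exact h _ ⟨j, rfl⟩ x le_rfl hx
  choose! K hK using hp
  obtain ⟨G, hG⟩ := hsat.realizesTypes V κ b p (fun q hq => by
    obtain ⟨G, h1, h2⟩ := exists_far_flag hN' hsc hN.infinite_residues hs hF
      (Set.finite_range (fun j : V → κ => b ∘ j)) (q.sup K)
    exact ⟨G, fun φ hφ => hK φ (hq hφ) G h1 fun F' hF' x hx =>
      h2 F' hF' x (hx.trans (Finset.le_sup hφ))⟩)
  refine ⟨G, isFlagIn_range hF, ?_, fun F' hF' h' => ⟨h', fun y hy hc => ?_⟩⟩
  · have := (realize_lstepFormula Γ).1 (hG _ (Or.inl rfl))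
    simpa [Function.comp_def] using this
  · obtain ⟨j, rfl⟩ := hF'.exists_index
    have := hG _ (Or.inr ⟨j, y, hy, rfl⟩)
    rw [Formula.realize_not, Formula.realize_relabel, realize_chainFormula] at this
    exact this hc

/-- A new vertex is not old, and its old neighbours lie in the base flag outside `s`; all equalities
and edges of the extension are thus determined by the base flag. The converse implications come from
exchanging the two sides. -/
theorem IsGenericOver.eq_imp (hM : IsPSSpace Γ M) (hN : IsPSSpace Γ N) (h : SameType V a b)
    (hA : IsNice Γ (Set.range a)) {i : V → κ} {s : Set V} {F : V → M}
    {G : V → N} (hF : IsGenericOver Γ (Set.range a) (a ∘ i) s F)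
    (hG : IsGenericOver Γ (Set.range b) (b ∘ i) s G) (x y : κ ⊕ V) :
    (Sum.elim a F x = Sum.elim a F y → Sum.elim b G x = Sum.elim b G y) ∧
    (Adj V (Sum.elim a F x) (Sum.elim a F y) → Adj V (Sum.elim b G x) (Sum.elim b G y)) := by
  have hM' := hM.toIsGammaGraph
  have hsc := hM'.isSimplyConnected_iff.1 hM.simply_connected
  have hN' := hN.toIsGammaGraph
  have hfl := SameType.of_isFlag hM' hN' hF.step.2.1.1 hG.step.2.1.1
  have heq : ∀ k γ, a k = F γ → b k = G γ := by
    intro k γ hk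
    by_cases hγ : γ ∈ s
    · exact absurd ⟨k, hk⟩ (hF.notMem hM' hsc hA hγ)
    · rw [← hF.step.2.2 γ hγ] at hk
      rw [← hG.step.2.2 γ hγ]
      exact (h.eq_iff _ _).1 hk
  have hadj : ∀ k γ, Adj V (F γ) (a k) → Adj V (G γ) (b k) := by
    intro k γ hk
    by_cases hγ : γ ∈ s
    · obtain ⟨δ, hδ, -⟩ := hM'.colour (a k)
      obtain ⟨hδs, hk'⟩ := hF.eq_of_adj hM.toIsGammaSpace hsc hA hγ ⟨k, rfl⟩ hδ hk
      have hb : b k = G δ := by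
        rw [← hG.step.2.2 δ hδs]
        exact (h.eq_iff _ _).1 hk'
      rw [hb, hG.step.2.1.1.2]
      rwa [hk', hF.step.2.2 δ hδs, hF.step.2.1.1.2] at hk
    · rw [← hF.step.2.2 γ hγ] at hk
      rw [← hG.step.2.2 γ hγ]
      exact (h.adj_iff _ _).1 hk
  rcases x with k | γ <;> rcases y with l | δ <;>
    simp only [Sum.elim_inl, Sum.elim_inr]
  · exact ⟨(h.eq_iff _ _).1, (h.adj_iff _ _).1⟩
  · exact ⟨heq k δ, fun e => hN'.symm _ _ (hadj k δ (hM'.symm _ _ e))⟩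
  · exact ⟨fun e => (heq l γ e.symm).symm, hadj l γ⟩
  · exact ⟨(hfl.eq_iff _ _).1, (hfl.adj_iff _ _).1⟩

theorem SameType.extend (hM : IsPSSpace Γ M) (hN : IsPSSpace Γ N) (h : SameType V a b)
    (hA : IsNice Γ (Set.range a)) (hB : IsNice Γ (Set.range b)) {i : V → κ} {s : Set V}
    {F : V → M} {G : V → N} (hF : IsGenericOver Γ (Set.range a) (a ∘ i) s F)
    (hG : IsGenericOver Γ (Set.range b) (b ∘ i) s G) :
    SameType V (Sum.elim a F) (Sum.elim b G) where
  eq_iff x y := ⟨(hF.eq_imp hM hN h hA hG x y).1, (hG.eq_imp hN hM h.symm hB hF x y).1⟩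
  adj_iff x y := ⟨(hF.eq_imp hM hN h hA hG x y).2, (hG.eq_imp hN hM h.symm hB hF x y).2⟩
  colour_iff γ x := by
    have hfl := SameType.of_isFlag hM.toIsGammaGraph hN.toIsGammaGraph hF.step.2.1.1
      hG.step.2.1.1
    cases x
    · exact h.colour_iff _ _
    · exact hfl.colour_iff _ _

variable (Γ) in
/-- An isomorphism between nice sets, given by indexed families. -/
structure IsNiceMatch (a : κ → M) (b : κ → N) : Prop where
  sameType : SameType V a b
  left : IsNice Γ (Set.range a)
  right : IsNice Γ (Set.range b)

omit [Finite V] in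
theorem IsNiceMatch.symm (h : IsNiceMatch Γ a b) : IsNiceMatch Γ b a :=
  ⟨h.sameType.symm, h.right, h.left⟩

/-- If the first step is true from every matched flag in its residue, it is a generic extension; it
is copied in `N`, and the word gets shorter. Otherwise `F₁` is reached from some matched flag by
smaller letters, which replace the first letter. Both words are smaller in the multiset order. -/
theorem IsNiceMatch.exists_extension_of_chain (hM : IsPSSpace Γ M) (hN : IsPSSpace Γ N)
    (hsat : IsOmegaSaturated (gammaLang V) N) {G : V → M} (x : List (Set V)) :
    ∀ (κ : Type u) [Finite κ] (a : κ → M) (b : κ → N), IsNiceMatch Γ a b → ∀ F : V → M,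
      IsFlagIn Γ (Set.range a) F → Chain (LStep Γ Set.univ) F x G →
      ∃ (κ' : Type u) (_ : Finite κ') (a' : κ' → M) (b' : κ' → N) (j : κ → κ'),
        IsNiceMatch Γ a' b' ∧ a' ∘ j = a ∧ b' ∘ j = b ∧ Set.range G ⊆ Set.range a' := by
  have hM' := hM.toIsGammaGraph
  have hscM := hM'.isSimplyConnected_iff.1 hM.simply_connected
  have hN' := hN.toIsGammaGraph
  have hscN := hN'.isSimplyConnected_iff.1 hN.simply_connected
  refine wellFounded_wordLT.induction (C := fun x => ∀ (κ : Type u) [Finite κ] (a : κ → M)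
    (b : κ → N), IsNiceMatch Γ a b → ∀ F : V → M,
      IsFlagIn Γ (Set.range a) F → Chain (LStep Γ Set.univ) F x G →
      ∃ (κ' : Type u) (_ : Finite κ') (a' : κ' → M) (b' : κ' → N) (j : κ → κ'),
        IsNiceMatch Γ a' b' ∧ a' ∘ j = a ∧ b' ∘ j = b ∧ Set.range G ⊆ Set.range a') x ?_
  intro x ih κ _ a b h F hF hx
  cases x with
  | nil =>
    obtain rfl : F = G := hx
    refine ⟨κ, inferInstance, a, b, id, h, rfl, rfl, ?_⟩
    rintro _ ⟨γ, rfl⟩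
    exact hF.2 γ
  | cons s x =>
    obtain ⟨F₁, h1, h2⟩ := hx
    by_cases hfar : ∀ F', IsFlagIn Γ (Set.range a) F' → LStep Γ Set.univ F' s F₁ →
        TStep Γ Set.univ F' s F₁
    · have hgen : IsGenericOver Γ (Set.range a) F s F₁ := ⟨hF, h1, hfar⟩
      have hs : IsLetter Γ s := (hM'.isFlagStep_iff.2 hgen.tstep).2.2.1
      obtain ⟨i, rfl⟩ := hF.exists_index
      obtain ⟨G₁, hG₁⟩ := exists_isGenericOver hN hsat ((h.sameType.isFlag_iff i).1 hF.1) hs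
      have hext : IsNiceMatch Γ (Sum.elim a F₁) (Sum.elim b G₁) :=
        ⟨h.sameType.extend hM hN h.left h.right hgen hG₁,
          by rw [Set.Sum.elim_range]; exact hgen.isNice hM.toIsGammaSpace hscM h.left,
          by rw [Set.Sum.elim_range]; exact hG₁.isNice hN.toIsGammaSpace hscN h.right⟩
      obtain ⟨κ', hκ', a', b', j, h3, h4, h5, h6⟩ := ih x (wordLT_delete [] x s) _ _ _ hext
        F₁ ⟨h1.2.1.1, fun γ => ⟨Sum.inr γ, rfl⟩⟩ h2
      refine ⟨κ', hκ', a', b', j ∘ Sum.inl, h3, ?_, ?_, h6⟩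
      · rw [← Function.comp_assoc, h4]; rfl
      · rw [← Function.comp_assoc, h5]; rfl
    · push Not at hfar
      obtain ⟨F', hF', h3, h4⟩ := hfar
      have : ∃ y : List (Set V), (∀ t ∈ y, t ⊂ s) ∧ Chain (LStep Γ Set.univ) F' y F₁ := by
        by_contra hn
        exact h4 ⟨h3, fun y hy hc => hn ⟨y, hy, hc⟩⟩
      obtain ⟨y, hy, hc⟩ := this
      exact ih (y ++ x) (wordLT_replace [] x hy) _ _ _ h _ hF' (hc.append h2)

theorem IsNiceMatch.exists_extension (hM : IsPSSpace Γ M) (hN : IsPSSpace Γ N)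
    (hsat : IsOmegaSaturated (gammaLang V) N) [Finite κ] (h : IsNiceMatch Γ a b) (m : M) :
    ∃ (κ' : Type u) (_ : Finite κ') (a' : κ' → M) (b' : κ' → N) (j : κ → κ'),
      IsNiceMatch Γ a' b' ∧ a' ∘ j = a ∧ b' ∘ j = b ∧ m ∈ Set.range a' := by
  obtain ⟨c, hc⟩ := h.left.nonempty
  obtain ⟨F, hF, -⟩ := h.left.vertex_flag c hc
  obtain ⟨G, hG, hm⟩ := hM.vertex_flag m
  obtain ⟨κ', hκ', a', b', j, h1, h2, h3, h4⟩ := IsNiceMatch.exists_extension_of_chain hM hN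
    hsat [diffSet F G] _ _ _ h _ hF (chain_singleton.2 (lstep_of_diffSet (hF.mono (Set.subset_univ _))
      ⟨hG, fun _ => trivial⟩))
  exact ⟨κ', hκ', a', b', j, h1, h2, h3, h4 hm⟩

omit [Finite V] in
theorem exists_index_of_term {α : Type*} {n : ℕ} (v : α → κ) (xs : Fin n → κ)
    (t : (gammaLang V).Term (α ⊕ Fin n)) :
    ∃ k : κ, t.realize (Sum.elim (a ∘ v) (a ∘ xs)) = a k ∧
      t.realize (Sum.elim (b ∘ v) (b ∘ xs)) = b k := by
  cases t with
  | var z =>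
    cases z with
    | inl z => exact ⟨v z, rfl, rfl⟩
    | inr z => exact ⟨xs z, rfl, rfl⟩
  | func f _ => exact Empty.elim f

omit [Finite V] in
theorem SameType.relMap (h : SameType V a b) {n : ℕ} (R : (gammaLang V).Relations n)
    (k : Fin n → κ) : RelMap R (a ∘ k) ↔ RelMap R (b ∘ k) := by
  cases R with
  | edge =>
    have := h.adj_iff (k 0) (k 1)
    have e1 : a ∘ k = ![a (k 0), a (k 1)] := by funext i; fin_cases i <;> rfl
    have e2 : b ∘ k = ![b (k 0), b (k 1)] := by funext i; fin_cases i <;> rfl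
    rw [e1, e2]
    exact this
  | colour γ =>
    have := h.colour_iff γ (k 0)
    have e1 : a ∘ k = ![a (k 0)] := by funext i; fin_cases i; rfl
    have e2 : b ∘ k = ![b (k 0)] := by funext i; fin_cases i; rfl
    rw [e1, e2]
    exact this

/-- Isomorphisms between finite nice sets of `ω`-saturated spaces preserve all formulas. -/
theorem IsNiceMatch.realize_iff (hM : IsPSSpace Γ M) (hN : IsPSSpace Γ N)
    (hsM : IsOmegaSaturated (gammaLang V) M) (hsN : IsOmegaSaturated (gammaLang V) N)
    {α : Type*} {n : ℕ} (φ : (gammaLang V).BoundedFormula α n) :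
    ∀ {κ : Type u} [Finite κ] {a : κ → M} {b : κ → N}, IsNiceMatch Γ a b →
      ∀ (v : α → κ) (xs : Fin n → κ),
      φ.Realize (a ∘ v) (a ∘ xs) ↔ φ.Realize (b ∘ v) (b ∘ xs) := by
  induction φ with
  | falsum => intros; rfl
  | equal t₁ t₂ =>
    intro κ _ a b h v xs
    obtain ⟨k, h1, h2⟩ := exists_index_of_term (a := a) (b := b) v xs t₁
    obtain ⟨l, h3, h4⟩ := exists_index_of_term (a := a) (b := b) v xs t₂
    simp only [BoundedFormula.Realize, h1, h2, h3, h4]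
    exact h.sameType.eq_iff k l
  | rel R ts =>
    intro κ _ a b h v xs
    choose k h1 h2 using fun i => exists_index_of_term (a := a) (b := b) v xs (ts i)
    simp only [BoundedFormula.Realize, h1, h2]
    exact h.sameType.relMap R k
  | imp φ ψ ih₁ ih₂ =>
    intro κ _ a b h v xs
    exact imp_congr (ih₁ h v xs) (ih₂ h v xs)
  | @all n φ ih =>
    intro κ _ a b h v xs
    have key : ∀ {κ' : Type u} [Finite κ'] {a' : κ' → M} {b' : κ' → N} (j : κ → κ') (k : κ'),
        IsNiceMatch Γ a' b' → a' ∘ j = a → b' ∘ j = b →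
        (φ.Realize (a ∘ v) (Fin.snoc (a ∘ xs) (a' k)) ↔
          φ.Realize (b ∘ v) (Fin.snoc (b ∘ xs) (b' k))) := by
      rintro κ' _ a' b' j k h' rfl rfl
      have := ih h' (j ∘ v) (Fin.snoc (j ∘ xs) k)
      rwa [Fin.comp_snoc, Fin.comp_snoc] at this
    constructor
    · intro hφ m
      obtain ⟨κ', hκ', b', a', j, h', hb, ha, k, rfl⟩ := h.symm.exists_extension hN hM hsM m
      exact (key j k h'.symm ha hb).1 (hφ _)
    · intro hφ m
      obtain ⟨κ', hκ', a', b', j, h', ha, hb, k, rfl⟩ := h.exists_extension hM hN hsN m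
      exact (key j k h' ha hb).2 (hφ _)

theorem IsPSSpace.ultraPower [Nonempty M] (hM : IsPSSpace Γ M) : IsPSSpace Γ (UltraPower M) :=
  realize_psAxioms.1 (((diagonal (gammaLang V) M).theory_model_iff _).1 (realize_psAxioms.2 hM))

theorem IsNiceMatch.map [Nonempty M] [Nonempty N] (hM : IsPSSpace Γ M) (hN : IsPSSpace Γ N)
    (h : IsNiceMatch Γ a b) :
    IsNiceMatch Γ (diagonal (gammaLang V) M ∘ a) (diagonal (gammaLang V) N ∘ b) where
  sameType := by
    refine ⟨fun i j => ?_, fun i j => ?_, fun γ i => ?_⟩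
    · simpa [(diagonal (gammaLang V) M).injective.eq_iff,
        (diagonal (gammaLang V) N).injective.eq_iff] using h.sameType.eq_iff i j
    · simpa [map_adj] using h.sameType.adj_iff i j
    · simpa [map_hasColour] using h.sameType.colour_iff γ i
  left := by
    rw [Set.range_comp]
    exact h.left.image hM.toIsGammaGraph hM.ultraPower.toIsGammaGraph _
  right := by
    rw [Set.range_comp]
    exact h.right.image hN.toIsGammaGraph hN.ultraPower.toIsGammaGraph _

/-- Isomorphisms between finite nice sets preserve all formulas. -/
theorem IsNiceMatch.realize_formula_iff [Nonempty M] [Nonempty N] (hM : IsPSSpace Γ M)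
    (hN : IsPSSpace Γ N) [Finite κ] (h : IsNiceMatch Γ a b) {n : ℕ}
    (φ : (gammaLang V).Formula (Fin n)) (v : Fin n → κ) :
    φ.Realize (a ∘ v) ↔ φ.Realize (b ∘ v) := by
  have hs : ∀ n, Countable ((gammaLang V).Formula (Fin n ⊕ Unit)) := fun n =>
    countable_formula _
  -- Both sides are evaluated in the ultrapowers, where the images of the nice sets are still nice
  -- and saturation is available.
  rw [← (diagonal (gammaLang V) M).map_formula, ← (diagonal (gammaLang V) N).map_formula]
  have := (h.map hM hN).realize_iff hM.ultraPower hN.ultraPower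
    (isOmegaSaturated_ultraPower hs) (isOmegaSaturated_ultraPower hs) φ v Fin.elim0
  rwa [Formula.boundedFormula_realize_eq_realize, Formula.boundedFormula_realize_eq_realize]
    at this

end BackAndForth

/-! ### From indexed families to partial isomorphisms; completeness -/

section PartialIsos

variable {V : Type u} {Γ : SimpleGraph V} {M : Type v} {N : Type w} [(gammaLang V).Structure M]
  [(gammaLang V).Structure N] {κ : Type u} {a : κ → M} {b : κ → N}

/-- The substructure on an arbitrary set of vertices. -/
def substructureOn (A : Set M) : (gammaLang V).Substructure M where
  carrier := A
  fun_mem f := Empty.elim f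

theorem SameType.exists_partialEquiv (h : SameType V a b) : ∃ f : M ≃ₚ[gammaLang V] N,
    (f.dom : Set M) = Set.range a ∧ (f.cod : Set N) = Set.range b ∧
      ∀ (i : κ) (hi : a i ∈ f.dom), (f.toEquiv ⟨a i, hi⟩ : N) = b i := by
  classical
  let A : (gammaLang V).Substructure M := substructureOn (Set.range a)
  let B : (gammaLang V).Substructure N := substructureOn (Set.range b)
  have hA : ∀ x : A, ∃ i, a i = x := fun x => x.2
  have hB : ∀ y : B, ∃ i, b i = y := fun y => y.2
  choose p hp using hA
  choose q hq using hB
  let f : A ≃[gammaLang V] B :=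
    { toFun := fun x => ⟨b (p x), p x, rfl⟩
      invFun := fun y => ⟨a (q y), q y, rfl⟩
      left_inv := fun x => Subtype.ext (by
        rw [← hp x]
        exact (h.eq_iff _ _).2 (hq _))
      right_inv := fun y => Subtype.ext (by
        rw [← hq y]
        exact (h.eq_iff _ _).1 (hp _))
      map_fun' := fun f _ => Empty.elim f
      map_rel' := fun R x => by
        have := h.relMap R (p ∘ x)
        refine Iff.trans this.symm (iff_of_eq ?_)
        exact congrArg (RelMap R) (funext fun i => hp (x i)) }
  refine ⟨⟨A, B, f⟩, rfl, rfl, fun i hi => ?_⟩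
  exact (h.eq_iff _ _).1 (hp ⟨a i, hi⟩)

theorem exists_sameType (f : M ≃ₚ[gammaLang V] N) (hf : (f.dom : Set M).Finite) :
    ∃ (κ : Type u) (_ : Finite κ) (a : κ → M) (b : κ → N), SameType V a b ∧
      Set.range a = f.dom ∧ Set.range b = f.cod ∧
      ∀ x : f.dom, ∃ i, a i = x ∧ b i = f.toEquiv x := by
  have : Finite f.dom := hf
  obtain ⟨n, ⟨e⟩⟩ := Finite.exists_equiv_fin f.dom
  -- Index types live in the universe of `V`, because extensions adjoin a copy of `V` to them.
  let e' : ULift.{u} (Fin n) ≃ f.dom := Equiv.ulift.trans e.symm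
  have hrel : ∀ {n : ℕ} (R : (gammaLang V).Relations n) (x : Fin n → f.dom),
      RelMap R (fun i => (f.toEquiv (x i) : N)) ↔ RelMap R (fun i => (x i : M)) :=
    fun R x => f.toEquiv.map_rel R x
  refine ⟨ULift (Fin n), inferInstance, fun i => e' i, fun i => f.toEquiv (e' i),
    ⟨fun i j => ?_, fun i j => ?_, fun γ i => ?_⟩, ?_, ?_,
    fun x => ⟨e'.symm x, by simp, by simp⟩⟩
  · rw [Subtype.coe_inj, Subtype.coe_inj, f.toEquiv.injective.eq_iff]
  · have := hrel (GammaRel.edge (V := V)) ![e' i, e' j]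
    have e1 : (fun k => (![e' i, e' j] k : M)) = ![(e' i : M), e' j] := by
      funext k; fin_cases k <;> rfl
    have e2 : (fun k => (f.toEquiv (![e' i, e' j] k) : N)) =
        ![(f.toEquiv (e' i) : N), f.toEquiv (e' j)] := by
      funext k; fin_cases k <;> rfl
    rw [e1, e2] at this
    exact this.symm
  · have := hrel (GammaRel.colour γ) ![e' i]
    have e1 : (fun k => (![e' i] k : M)) = ![(e' i : M)] := by
      funext k; fin_cases k; rfl
    have e2 : (fun k => (f.toEquiv (![e' i] k) : N)) = ![(f.toEquiv (e' i) : N)] := by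
      funext k; fin_cases k; rfl
    rw [e1, e2] at this
    exact this.symm
  · ext m
    constructor
    · rintro ⟨i, rfl⟩
      exact (e' i).2
    · intro hm
      exact ⟨e'.symm ⟨m, hm⟩, by simp⟩
  · ext m
    constructor
    · rintro ⟨i, rfl⟩
      exact (f.toEquiv (e' i)).2
    · intro hm
      exact ⟨e'.symm (f.toEquiv.symm ⟨m, hm⟩), by simp⟩

theorem IsNiceMatch.exists_mem_nicePartialIsos [Finite κ] (h : IsNiceMatch Γ a b) :
    ∃ f ∈ nicePartialIsos Γ M N, (f.dom : Set M) = Set.range a ∧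
      ∀ (i : κ) (hi : a i ∈ f.dom), (f.toEquiv ⟨a i, hi⟩ : N) = b i := by
  obtain ⟨f, h1, h2, h3⟩ := h.sameType.exists_partialEquiv
  refine ⟨f, ⟨?_, ?_, ?_, ?_⟩, h1, h3⟩
  · rw [h1]; exact Set.finite_range a
  · rw [h2]; exact Set.finite_range b
  · rw [h1]; exact h.left
  · rw [h2]; exact h.right

theorem exists_isNiceMatch {f : M ≃ₚ[gammaLang V] N} (hf : f ∈ nicePartialIsos Γ M N) :
    ∃ (κ : Type u) (_ : Finite κ) (a : κ → M) (b : κ → N), IsNiceMatch Γ a b ∧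
      ∀ x : f.dom, ∃ i, a i = x ∧ b i = f.toEquiv x := by
  obtain ⟨κ, hκ, a, b, h1, h2, h3, h4⟩ := exists_sameType f hf.1
  exact ⟨κ, hκ, a, b, ⟨h1, by rw [h2]; exact hf.2.2.1, by rw [h3]; exact hf.2.2.2⟩, h4⟩

theorem nicePartialIsos_symm {f : M ≃ₚ[gammaLang V] N} (hf : f ∈ nicePartialIsos Γ M N) :
    f.symm ∈ nicePartialIsos Γ N M :=
  ⟨hf.2.1, hf.1, hf.2.2.2, hf.2.2.1⟩

variable [Finite V]

theorem exists_isNiceMatch_flag [Nonempty V] [Nonempty M] [Nonempty N] (hM : IsPSSpace Γ M)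
    (hN : IsPSSpace Γ N) : ∃ (F : V → M) (G : V → N), IsNiceMatch Γ F G := by
  obtain ⟨F, hF, -⟩ := hM.vertex_flag (Classical.arbitrary M)
  obtain ⟨G, hG, -⟩ := hN.vertex_flag (Classical.arbitrary N)
  have hM' := hM.toIsGammaGraph
  have hN' := hN.toIsGammaGraph
  exact ⟨F, G, .of_isFlag hM' hN' hF hG, isNice_range_flag hM' hF, isNice_range_flag hN' hG⟩

theorem nicePartialIsos_forth (hM : IsPSSpace Γ M) (hN : IsPSSpace Γ N)
    (hsat : IsOmegaSaturated (gammaLang V) N) {f : M ≃ₚ[gammaLang V] N}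
    (hf : f ∈ nicePartialIsos Γ M N) (m : M) :
    ∃ g ∈ nicePartialIsos Γ M N, f ≤ g ∧ m ∈ g.dom := by
  obtain ⟨κ, _, a, b, h, hab⟩ := exists_isNiceMatch hf
  obtain ⟨κ', _, a', b', j, h', rfl, rfl, hm⟩ := h.exists_extension hM hN hsat m
  obtain ⟨g, hg, hd, hgi⟩ := h'.exists_mem_nicePartialIsos
  have hdom : ∀ i, a' i ∈ g.dom := fun i => by
    have : a' i ∈ (g.dom : Set M) := by rw [hd]; exact ⟨i, rfl⟩
    exact this
  have hle : f.dom ≤ g.dom := fun x hx => by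
    obtain ⟨i, hi, -⟩ := hab ⟨x, hx⟩
    obtain rfl : a' (j i) = x := hi
    exact hdom (j i)
  refine ⟨g, hg, ⟨hle, ?_⟩, ?_⟩
  · ext ⟨x, hx⟩
    obtain ⟨i, hi, hi'⟩ := hab ⟨x, hx⟩
    obtain rfl : a' (j i) = x := hi
    exact (hgi (j i) (hle hx)).trans hi'
  · obtain ⟨i, rfl⟩ := hm
    exact hdom i

theorem isBackAndForthSystem_nicePartialIsos [Nonempty V] [Nonempty M] [Nonempty N]
    (hM : IsPSSpace Γ M) (hN : IsPSSpace Γ N) (hsM : IsOmegaSaturated (gammaLang V) M)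
    (hsN : IsOmegaSaturated (gammaLang V) N) :
    IsBackAndForthSystem (nicePartialIsos Γ M N) where
  nonempty := by
    obtain ⟨F, G, h⟩ := exists_isNiceMatch_flag hM hN
    obtain ⟨f, hf, -⟩ := h.exists_mem_nicePartialIsos
    exact ⟨f, hf⟩
  forth f hf m := nicePartialIsos_forth hM hN hsN hf m
  back f hf n := by
    obtain ⟨g, hg, hle, hn⟩ := nicePartialIsos_forth hN hM hsM (nicePartialIsos_symm hf) n
    exact ⟨g.symm, nicePartialIsos_symm hg, PartialEquiv.symm_le_iff.1 hle, hn⟩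

theorem isElementaryPartial_of_mem_nicePartialIsos [Nonempty M] [Nonempty N]
    (hM : IsPSSpace Γ M) (hN : IsPSSpace Γ N) {f : M ≃ₚ[gammaLang V] N}
    (hf : f ∈ nicePartialIsos Γ M N) : IsElementaryPartial f := by
  obtain ⟨κ, _, a, b, h, hab⟩ := exists_isNiceMatch hf
  intro n φ x
  choose k hk hk' using fun i => hab (x i)
  have := h.realize_formula_iff hM hN φ k
  simp only [Function.comp_def, hk, hk'] at this
  exact this

/-- A flag in each space gives a nice match to start from, and a sentence is a formula without
variables. -/
theorem IsPSSpace.realize_sentence_iff [Nonempty V] [Nonempty M] [Nonempty N]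
    (hM : IsPSSpace Γ M) (hN : IsPSSpace Γ N) (φ : (gammaLang V).Sentence) : M ⊨ φ ↔ N ⊨ φ := by
  obtain ⟨F, G, h⟩ := exists_isNiceMatch_flag hM hN
  have := h.realize_formula_iff hM hN (φ.relabel (Empty.elim : Empty → Fin 0)) Fin.elim0
  rw [Formula.realize_relabel, Formula.realize_relabel] at this
  rwa [Subsingleton.elim ((F ∘ Fin.elim0) ∘ Empty.elim) default,
    Subsingleton.elim ((G ∘ Fin.elim0) ∘ Empty.elim) default] at this

theorem isComplete_PS [Nonempty V] : (PS Γ).IsComplete := by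
  have : Nonempty (FreeModel Γ) := ⟨FreeModel.baseFlag Γ (Classical.arbitrary V)⟩
  have hfree : IsPSSpace Γ (FreeModel Γ) := FreeModel.isPSSpace
  have hmodel : FreeModel Γ ⊨ PS Γ := model_PS_iff.2 hfree
  have hiff : ∀ (K : (PS Γ).ModelType) (φ : (gammaLang V).Sentence), K ⊨ φ ↔ FreeModel Γ ⊨ φ :=
    fun K φ => (model_PS_iff.1 K.is_model).realize_sentence_iff hfree φ
  refine ⟨⟨Theory.ModelType.of (PS Γ) (FreeModel Γ)⟩, fun φ => ?_⟩
  by_cases hφ : FreeModel Γ ⊨ φ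
  · exact Or.inl (Theory.models_sentence_iff.2 fun K => (hiff K φ).2 hφ)
  · exact Or.inr (Theory.models_sentence_iff.2 fun K =>
      (Sentence.realize_not _).2 fun h => hφ ((hiff K φ).1 h))

end PartialIsos
end RAB

theorem theorem4p14 {V : Type u} [Finite V] [Nonempty V] (Γ : SimpleGraph V) :
    -- `PS Γ` axiomatises the class of simply connected `Γ`-spaces with infinite residues
    (∀ (M : Type v) [Nonempty M] [(gammaLang V).Structure M],
      M ⊨ PS Γ ↔ IsPSSpace Γ M) ∧
    -- back-and-forth between `ω`-saturated models
    (∀ (M : Type v) (N : Type w) [Nonempty M] [Nonempty N]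
      [(gammaLang V).Structure M] [(gammaLang V).Structure N],
      M ⊨ PS Γ → N ⊨ PS Γ →
      IsOmegaSaturated (gammaLang V) M → IsOmegaSaturated (gammaLang V) N →
      IsBackAndForthSystem (nicePartialIsos Γ M N)) ∧
    -- partial isomorphisms between finite nice subsets of arbitrary models are elementary
    (∀ (M : Type v) (N : Type w) [Nonempty M] [Nonempty N]
      [(gammaLang V).Structure M] [(gammaLang V).Structure N],
      M ⊨ PS Γ → N ⊨ PS Γ →
      ∀ f ∈ nicePartialIsos Γ M N, IsElementaryPartial f) ∧
    -- completeness
    (PS Γ).IsComplete := by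
  exact ⟨fun M _ _ => model_PS_iff,
    fun M N _ _ _ _ hM hN hsM hsN =>
      isBackAndForthSystem_nicePartialIsos (model_PS_iff.1 hM) (model_PS_iff.1 hN) hsM hsN,
    fun M N _ _ _ _ hM hN f hf =>
      isElementaryPartial_of_mem_nicePartialIsos (model_PS_iff.1 hM) (model_PS_iff.1 hN) hf,
    isComplete_PS⟩
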